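/- **Theorem.** Let $n\ge 1$, and let $S$ be a set of $n$ segments of non-zero length in $\mathbb{R}^2$. A *stabbing rectangle* for $S$ is a closed axis-parallel rectangle that contains exactly one endpoint of each segment of $S$; two stabbing rectangles are *combinatorially different* if the sets of endpoints of segments of $S$ that they contain are different. A list of rectangles *reports all combinatorially different stabbing rectangles* if each of its entries is a stabbing rectangle, given by four endpoints of segments of $S$ that lie in it, one on each of its four sides (the four endpoints need not be distinct, and a rectangle may degenerate to a segment or a point), no two entries are combinatorially equivalent, and every stabbing rectangle for $S$ is combinatorially equivalent to an entry. 1. There is an algorithm that, given $n$ segments, reports all combinatorially different stabbing rectangles in $O(n^2\log n)$ time. Here the model of computation is a random access machine with unit-cost operations, with words of $O(\log n)$ bits, in which the only operations on the real input coordinates are comparisons of the $x$-coordinates, or of the $y$-coordinates, of two input points. 2. The number of combinatorially different stabbing rectangles for $n$ segments is $O(n^2)$. 3. This bound is attained: there is a constant $c>0$ such that for every $n\ge 1$ there is a set of $n$ segments, none of them horizontal or vertical, with at least $c\,n^2$ combinatorially different stabbing rectangles. -/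

import Mathlib

namespace Stab

/-! ### Segments and stabbing rectangles -/

/-- A point of the plane, given by its two coordinates. -/
abbrev Point := ℝ × ℝ

/-- A segment, given by its two endpoints. -/
abbrev Segment := Point × Point

/-- The `2n` endpoints of `n` segments, numbered `0, …, 2n - 1`: number `i < n` is the first
endpoint of segment `i` and number `n + i` is its second endpoint. -/
def endpoint {n : ℕ} (S : Fin n → Segment) : Fin (n + n) → Point :=
  Fin.append (fun i => (S i).1) (fun i => (S i).2)

/-- The closed region `[a, b] × [c, d]`. -/
def box (a b c d : ℝ) : Set Point := Set.Icc a b ×ˢ Set.Icc c d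

/-- Closed axis-parallel rectangles (sides of length zero are allowed). -/
def IsRectangle (R : Set Point) : Prop :=
  ∃ a b c d : ℝ, a ≤ b ∧ c ≤ d ∧ R = box a b c d

/-- The region `R` contains exactly one endpoint of each segment. -/
def Stabs {n : ℕ} (R : Set Point) (S : Fin n → Segment) : Prop :=
  ∀ i, Xor ((S i).1 ∈ R) ((S i).2 ∈ R)

/-- `R` is a stabbing rectangle for `S`. -/
def IsStabbingRectangle {n : ℕ} (S : Fin n → Segment) (R : Set Point) : Prop :=
  IsRectangle R ∧ Stabs R S

/-- The set of segment endpoints contained in `R`. -/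
def redPoints {n : ℕ} (S : Fin n → Segment) (R : Set Point) : Set Point :=
  Set.range (endpoint S) ∩ R

/-- Two regions are combinatorially equivalent if they contain the same segment endpoints. -/
def CombEquiv {n : ℕ} (S : Fin n → Segment) (R R' : Set Point) : Prop :=
  redPoints S R = redPoints S R'

/-- The combinatorially different stabbing rectangles: one element for each combinatorial
equivalence class, namely the set of endpoints that its members contain. -/
def stabberClasses {n : ℕ} (S : Fin n → Segment) : Set (Set Point) :=
  {A | ∃ R, IsStabbingRectangle S R ∧ redPoints S R = A}

/-! ### A random access machine

The machine has registers and arrays holding natural numbers, all initially zero except for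
register `0`, which holds the number `n` of segments. The coordinates of the input points can be
used in one way only: the `x`-coordinates, or the `y`-coordinates, of two input points with given
numbers can be compared. Programs are finite, and independent of `n`. Every operation takes one
time unit, and every number that occurs in a computation has to fit into a machine word, that is,
it has to be at most the word bound `B`. -/

/-- Memory and output. Registers and arrays are named by natural numbers; a reported rectangle
is a quadruple of numbers of input points (left, right, bottom, top). -/
structure State where
  reg : ℕ → ℕ
  arr : ℕ → ℕ → ℕ
  out : List (ℕ × ℕ × ℕ × ℕ)

/-- The initial state on an input of `n` segments. -/
def State.init (n : ℕ) : State where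
  reg := fun x => if x = 0 then n else 0
  arr := fun _ _ => 0
  out := []

/-- Write the value `v` into register `x`. -/
def State.setReg (s : State) (x v : ℕ) : State :=
  { s with reg := Function.update s.reg x v }

/-- Write the value `v` into cell `i` of array `a`. -/
def State.setArr (s : State) (a i v : ℕ) : State :=
  { s with arr := Function.update s.arr a (Function.update (s.arr a) i v) }

/-- Append a quadruple to the output. -/
def State.report (s : State) (l r b t : ℕ) : State :=
  { s with out := s.out ++ [(l, r, b, t)] }

/-- Arithmetic expressions: constants, registers, array cells, and the operations of word
arithmetic (truncated subtraction, and division rounded down). -/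
inductive Expr where
  | const (k : ℕ)
  | reg (x : ℕ)
  | cell (a : ℕ) (i : Expr)
  | add (e f : Expr)
  | sub (e f : Expr)
  | mul (e f : Expr)
  | div (e f : Expr)

namespace Expr

/-- The value of an expression. -/
def eval (s : State) : Expr → ℕ
  | const k => k
  | reg x => s.reg x
  | cell a i => s.arr a (i.eval s)
  | add e f => e.eval s + f.eval s
  | sub e f => e.eval s - f.eval s
  | mul e f => e.eval s * f.eval s
  | div e f => e.eval s / f.eval s

/-- The time needed to evaluate an expression: one unit for each operation. -/
def cost : Expr → ℕ
  | const _ => 1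
  | reg _ => 1
  | cell _ i => i.cost + 1
  | add e f => e.cost + f.cost + 1
  | sub e f => e.cost + f.cost + 1
  | mul e f => e.cost + f.cost + 1
  | div e f => e.cost + f.cost + 1

/-- All values that occur during the evaluation, addresses included, are at most `B`. -/
def Fits (B : ℕ) (s : State) : Expr → Prop
  | const k => k ≤ B
  | reg x => s.reg x ≤ B
  | cell a i => i.Fits B s ∧ s.arr a (i.eval s) ≤ B
  | add e f => e.Fits B s ∧ f.Fits B s ∧ e.eval s + f.eval s ≤ B
  | sub e f => e.Fits B s ∧ f.Fits B s
  | mul e f => e.Fits B s ∧ f.Fits B s ∧ e.eval s * f.eval s ≤ B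
  | div e f => e.Fits B s ∧ f.Fits B s

end Expr

/-- Tests. The test `xlt e f` compares the `x`-coordinates of the input points with the numbers
`e` and `f`, and `ylt e f` their `y`-coordinates. -/
inductive Test where
  | eq (e f : Expr)
  | lt (e f : Expr)
  | xlt (e f : Expr)
  | ylt (e f : Expr)
  | not (p : Test)
  | and (p q : Test)
  | or (p q : Test)

namespace Test

/-- The truth value of a test; a comparison of coordinates is false if one of the two numbers is
not the number of an input point. -/
def Holds {m : ℕ} (P : Fin m → Point) (s : State) : Test → Prop
  | eq e f => e.eval s = f.eval s
  | lt e f => e.eval s < f.eval s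
  | xlt e f => ∃ i j : Fin m, (i : ℕ) = e.eval s ∧ (j : ℕ) = f.eval s ∧ (P i).1 < (P j).1
  | ylt e f => ∃ i j : Fin m, (i : ℕ) = e.eval s ∧ (j : ℕ) = f.eval s ∧ (P i).2 < (P j).2
  | not p => ¬ p.Holds P s
  | and p q => p.Holds P s ∧ q.Holds P s
  | or p q => p.Holds P s ∨ q.Holds P s

/-- The time needed to evaluate a test. -/
def cost : Test → ℕ
  | eq e f => e.cost + f.cost + 1
  | lt e f => e.cost + f.cost + 1
  | xlt e f => e.cost + f.cost + 1
  | ylt e f => e.cost + f.cost + 1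
  | not p => p.cost + 1
  | and p q => p.cost + q.cost + 1
  | or p q => p.cost + q.cost + 1

/-- All values that occur during the evaluation of a test are at most `B`. -/
def Fits (B : ℕ) (s : State) : Test → Prop
  | eq e f => e.Fits B s ∧ f.Fits B s
  | lt e f => e.Fits B s ∧ f.Fits B s
  | xlt e f => e.Fits B s ∧ f.Fits B s
  | ylt e f => e.Fits B s ∧ f.Fits B s
  | not p => p.Fits B s
  | and p q => p.Fits B s ∧ q.Fits B s
  | or p q => p.Fits B s ∧ q.Fits B s

end Test

/-- Programs. -/
inductive Program where
  | skip
  | assign (x : ℕ) (e : Expr)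
  | store (a : ℕ) (i e : Expr)
  | report (l r b t : Expr)
  | seq (c d : Program)
  | cond (p : Test) (c d : Program)
  | loop (p : Test) (c : Program)

/-- `Exec P B c s s' t`: with the input points `P` and the word bound `B`, the program `c` started
in the state `s` halts in the state `s'` after exactly `t` time units, and all numbers that occur
fit into a word. (`loop p c` repeats `c` as long as `p` holds.) -/
inductive Exec {m : ℕ} (P : Fin m → Point) (B : ℕ) : Program → State → State → ℕ → Prop
  | skip (s : State) : Exec P B Program.skip s s 1
  | assign (s : State) (x : ℕ) (e : Expr) (he : e.Fits B s) :
      Exec P B (Program.assign x e) s (s.setReg x (e.eval s)) (e.cost + 1)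
  | store (s : State) (a : ℕ) (i e : Expr) (hi : i.Fits B s) (he : e.Fits B s) :
      Exec P B (Program.store a i e) s (s.setArr a (i.eval s) (e.eval s)) (i.cost + e.cost + 1)
  | report (s : State) (l r b t : Expr) (hl : l.Fits B s) (hr : r.Fits B s) (hb : b.Fits B s)
      (ht : t.Fits B s) :
      Exec P B (Program.report l r b t) s
        (s.report (l.eval s) (r.eval s) (b.eval s) (t.eval s))
        (l.cost + r.cost + b.cost + t.cost + 1)
  | seq (c d : Program) (s s₁ s₂ : State) (t₁ t₂ : ℕ) (hc : Exec P B c s s₁ t₁)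
      (hd : Exec P B d s₁ s₂ t₂) : Exec P B (Program.seq c d) s s₂ (t₁ + t₂)
  | cond_true (p : Test) (c d : Program) (s s₁ : State) (t : ℕ) (hf : p.Fits B s)
      (hp : p.Holds P s) (hc : Exec P B c s s₁ t) :
      Exec P B (Program.cond p c d) s s₁ (p.cost + t)
  | cond_false (p : Test) (c d : Program) (s s₁ : State) (t : ℕ) (hf : p.Fits B s)
      (hp : ¬ p.Holds P s) (hd : Exec P B d s s₁ t) :
      Exec P B (Program.cond p c d) s s₁ (p.cost + t)
  | loop_false (p : Test) (c : Program) (s : State) (hf : p.Fits B s) (hp : ¬ p.Holds P s) :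
      Exec P B (Program.loop p c) s s p.cost
  | loop_true (p : Test) (c : Program) (s s₁ s₂ : State) (t₁ t₂ : ℕ) (hf : p.Fits B s)
      (hp : p.Holds P s) (hc : Exec P B c s s₁ t₁) (hl : Exec P B (Program.loop p c) s₁ s₂ t₂) :
      Exec P B (Program.loop p c) s s₂ (p.cost + t₁ + t₂)

/-! ### Correct output -/

/-- The quadruple `q = (l, r, b, t)` of endpoint numbers represents the rectangle `R`: it is the
rectangle whose left, right, bottom and top side is determined by the endpoint number `l`, `r`,
`b` and `t`, respectively, and it contains these four endpoints (so they lie on its sides). -/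
def Represents {n : ℕ} (S : Fin n → Segment) (q : ℕ × ℕ × ℕ × ℕ) (R : Set Point) : Prop :=
  ∃ l r b t : Fin (n + n), q = ((l : ℕ), (r : ℕ), (b : ℕ), (t : ℕ)) ∧
    R = box (endpoint S l).1 (endpoint S r).1 (endpoint S b).2 (endpoint S t).2 ∧
    endpoint S l ∈ R ∧ endpoint S r ∈ R ∧ endpoint S b ∈ R ∧ endpoint S t ∈ R

/-- The list `L` reports all combinatorially different stabbing rectangles for `S`: every entry
represents a stabbing rectangle, different entries represent combinatorially different ones, and
every stabbing rectangle is combinatorially equivalent to one that is represented. -/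
def ReportsAll {n : ℕ} (S : Fin n → Segment) (L : List (ℕ × ℕ × ℕ × ℕ)) : Prop :=
  (∀ q ∈ L, ∃ R, Represents S q R ∧ IsStabbingRectangle S R) ∧
  L.Pairwise (fun q q' => ∀ R R', Represents S q R → Represents S q' R' → ¬ CombEquiv S R R') ∧
  ∀ R, IsStabbingRectangle S R → ∃ q ∈ L, ∃ R', Represents S q R' ∧ CombEquiv S R R'

end Stab

/-!
Sort the `2n` endpoints by `x` and by `y`, breaking ties by number, and replace rectangles by boxes
of ranks. A stabbing box contains exactly `n` endpoints, and shrinking it until each of its four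
sides is determined by an endpoint in it gives a *tight* box; different tight boxes contain
different sets of endpoints. A tight box comes from a rectangle unless a tie of coordinates lets
further endpoints into the rectangle spanned by its sides, which is detected by counting.

Upper bound: three sides determine a tight box. If no tight box with the same left and right sides
has a higher bottom side, then the left and right sides determine the box. Otherwise the left and
bottom sides and one bit do: of two such boxes with the same left and bottom sides, only the wider
one reaches the `x`-rank of the partner of the bottom endpoint.

Lower bound: take translates of a long flat segment, shifted to the right, and of a long steep one,
shifted upwards. Sliding a rectangle slightly smaller than these segments to the right and upwards
chooses independently how many segments of each kind it meets in their first endpoints.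

Algorithm: for a fixed left side, sweep the right side. A segment with both endpoints passed forbids
its `y`-interval, and the maximal windows of `y`-ranks that contain no forbidden interval form a
chain, linked through the lower ends of the innermost intervals. A window contains at most one
endpoint of each segment, so a tight box in it contains all endpoints in the window; there is at
most one, which bisection finds with prefix counts. It suffices to examine a window when a new
interval destroys it or the sweep ends. An inserted interval adds one link to the chain and removes
the links of all but one of the windows that it destroys, so a sweep examines `O(n)` windows. The
place of insertion is read off a table that is updated in `O(n)` steps when the left side moves.
Different windows may contain the same tight box, and marks indexed by the right and bottom sides
prevent it from being reported twice.
-/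

namespace Stab

section Endpoints

/-- The number of the other endpoint of the segment that has endpoint number `e`. -/
def partner (n e : ℕ) : ℕ := if e < n then e + n else e - n

/-- The endpoints of `S` indexed by all natural numbers (the values stored by a program), with
the junk value `0` outside the range of endpoint numbers. -/
def pos {n : ℕ} (S : Fin n → Segment) (e : ℕ) : Point :=
  if h : e < n + n then endpoint S ⟨e, h⟩ else 0

variable {n e : ℕ}

lemma partner_lt (he : e < n + n) : partner n e < n + n := by
  unfold partner; split_ifs <;> omega

lemma partner_partner (he : e < n + n) : partner n (partner n e) = e := by
  unfold partner; split_ifs <;> omega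

lemma partner_ne (he : e < n + n) : partner n e ≠ e := by
  unfold partner; split_ifs <;> omega

variable {S : Fin n → Segment} {R R' : Set Point}

lemma pos_coe (S : Fin n → Segment) (e : Fin (n + n)) : pos S e = endpoint S e := by
  simp [pos]

lemma pos_of_lt (S : Fin n → Segment) {i : ℕ} (hi : i < n) : pos S i = (S ⟨i, hi⟩).1 :=
  (pos_coe S (Fin.castAdd n ⟨i, hi⟩)).trans (Fin.append_left _ _ _)

lemma pos_add (S : Fin n → Segment) {i : ℕ} (hi : i < n) : pos S (i + n) = (S ⟨i, hi⟩).2 := by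
  rw [add_comm]
  exact (pos_coe S (Fin.natAdd n ⟨i, hi⟩)).trans (Fin.append_right _ _ _)

lemma stabs_iff : Stabs R S ↔ ∀ e < n + n, (pos S (partner n e) ∈ R ↔ pos S e ∉ R) := by
  constructor
  · intro h e he
    by_cases hn : e < n
    · rw [partner, if_pos hn, pos_add S hn, pos_of_lt S hn]
      exact iff_not_comm.mp (xor_iff_iff_not.mp (h ⟨e, hn⟩))
    · obtain ⟨i, rfl⟩ := Nat.exists_eq_add_of_le' (not_lt.mp hn)
      have hi : i < n := by omega
      rw [partner, if_neg hn, Nat.add_sub_cancel, pos_of_lt S hi, pos_add S hi]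
      exact xor_iff_iff_not.mp (h ⟨i, hi⟩)
  · intro h i
    have hi := h i (by omega)
    rw [partner, if_pos i.2, pos_add S i.2, pos_of_lt S i.2] at hi
    exact xor_iff_iff_not.mpr (iff_not_comm.mp hi)

lemma combEquiv_iff : CombEquiv S R R' ↔ ∀ e < n + n, (pos S e ∈ R ↔ pos S e ∈ R') := by
  simp only [CombEquiv, redPoints, Set.ext_iff, Set.mem_inter_iff, and_congr_right_iff,
    Set.forall_mem_range, ← pos_coe, Fin.forall_iff]

lemma Stabs.congr (h : Stabs R S) (hR : CombEquiv S R R') : Stabs R' S := by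
  rw [stabs_iff] at *
  rw [combEquiv_iff] at hR
  intro e he
  rw [← hR e he, ← hR _ (partner_lt he)]
  exact h e he

lemma Stabs.exists_mem (hn : 1 ≤ n) (h : Stabs R S) : ∃ e < n + n, pos S e ∈ R := by
  by_cases h0 : pos S 0 ∈ R
  · exact ⟨0, by omega, h0⟩
  · exact ⟨_, partner_lt (by omega), (stabs_iff.mp h 0 (by omega)).mpr h0⟩

end Endpoints

/-- The half-open box `(left, right] × (bottom, top]` of pairs of natural numbers. -/
@[ext]
structure Box where
  left : ℕ
  right : ℕ
  bottom : ℕ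
  top : ℕ

/-- Boxes are ordered by inclusion of their sides. -/
instance : LE Box where
  le b c := c.left ≤ b.left ∧ b.right ≤ c.right ∧ c.bottom ≤ b.bottom ∧ b.top ≤ c.top

/-- The four sides of the box determine ranks `left + 1`, `right`, `bottom + 1` and `top` between
`1` and `N`. -/
structure Box.IsWithin (b : Box) (N : ℕ) : Prop where
  left_lt : b.left < N
  right_mem : 1 ≤ b.right ∧ b.right ≤ N
  bottom_lt : b.bottom < N
  top_mem : 1 ≤ b.top ∧ b.top ≤ N

/-- The `2n` endpoints sorted by `x` and by `y`: endpoint `e` has ranks `X e` and `Y e` between `1`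
and `2n`, and `PX r` and `PY r` are the endpoints of rank `r`. -/
structure Ranked (n : ℕ) where
  X : ℕ → ℕ
  Y : ℕ → ℕ
  PX : ℕ → ℕ
  PY : ℕ → ℕ
  x_spec : ∀ e < n + n, 1 ≤ X e ∧ X e ≤ n + n ∧ PX (X e) = e
  y_spec : ∀ e < n + n, 1 ≤ Y e ∧ Y e ≤ n + n ∧ PY (Y e) = e
  px_spec : ∀ r, 1 ≤ r → r ≤ n + n → PX r < n + n ∧ X (PX r) = r
  py_spec : ∀ r, 1 ≤ r → r ≤ n + n → PY r < n + n ∧ Y (PY r) = r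

namespace Ranked

variable {n : ℕ} (I : Ranked n) {b c : Box} {e f : ℕ}

lemma x_inj (he : e < n + n) (hf : f < n + n) (h : I.X e = I.X f) : e = f := by
  rw [← (I.x_spec e he).2.2, h, (I.x_spec f hf).2.2]

lemma y_inj (he : e < n + n) (hf : f < n + n) (h : I.Y e = I.Y f) : e = f := by
  rw [← (I.y_spec e he).2.2, h, (I.y_spec f hf).2.2]

/-- The ranks of endpoint `e` lie in the box `b`. -/
def InBox (b : Box) (e : ℕ) : Prop :=
  (b.left < I.X e ∧ I.X e ≤ b.right) ∧ b.bottom < I.Y e ∧ I.Y e ≤ b.top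

instance (b : Box) : DecidablePred (I.InBox b) := fun e => by
  unfold InBox; infer_instance

/-- The endpoints in a box. -/
def inside (b : Box) : Finset ℕ := {e ∈ Finset.range (n + n) | I.InBox b e}

/-- The number of endpoints in a box. -/
def cnt (b : Box) : ℕ := (I.inside b).card

/-- The box contains exactly one endpoint of each segment. -/
def IsStabbing (b : Box) : Prop :=
  ∀ e < n + n, (I.InBox b (partner n e) ↔ ¬ I.InBox b e)

/-- The box does not contain both endpoints of any segment. -/
def IsFree (b : Box) : Prop :=
  ∀ e < n + n, ¬ (I.InBox b e ∧ I.InBox b (partner n e))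

variable {I}

lemma mem_inside : e ∈ I.inside b ↔ e < n + n ∧ I.InBox b e := by simp [inside]

lemma InBox.mono (hbc : b ≤ c) (h : I.InBox b e) : I.InBox c e :=
  ⟨⟨hbc.1.trans_lt h.1.1, h.1.2.trans hbc.2.1⟩, hbc.2.2.1.trans_lt h.2.1, h.2.2.trans hbc.2.2.2⟩

lemma IsFree.anti (hbc : b ≤ c) (h : I.IsFree c) : I.IsFree b :=
  fun e he hb => h e he ⟨hb.1.mono hbc, hb.2.mono hbc⟩

lemma inside_mono (hbc : b ≤ c) : I.inside b ⊆ I.inside c := fun _ he =>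
  mem_inside.mpr ⟨(mem_inside.mp he).1, (mem_inside.mp he).2.mono hbc⟩

lemma cnt_mono (hbc : b ≤ c) : I.cnt b ≤ I.cnt c := Finset.card_le_card (inside_mono hbc)

lemma cnt_eq_zero (h : b.right ≤ b.left ∨ b.top ≤ b.bottom) : I.cnt b = 0 := by
  refine Finset.card_eq_zero.mpr (Finset.eq_empty_of_forall_notMem fun e he => ?_)
  have := (mem_inside.mp he).2
  unfold InBox at this
  omega

lemma inBox_iff_of_cnt_eq (hbc : b ≤ c) (h : I.cnt b = I.cnt c) (he : e < n + n) :
    I.InBox b e ↔ I.InBox c e := by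
  have := Finset.ext_iff.mp (Finset.eq_of_subset_of_card_le (inside_mono hbc) h.ge) e
  simpa only [mem_inside, he, true_and] using this

lemma mem_inside_or_partner : e ∈ I.inside b ∪ (I.inside b).image (partner n) ↔
    e < n + n ∧ (I.InBox b e ∨ I.InBox b (partner n e)) := by
  simp only [Finset.mem_union, Finset.mem_image, mem_inside]
  constructor
  · rintro (⟨he, hb⟩ | ⟨f, ⟨hf, hb⟩, rfl⟩)
    · exact ⟨he, .inl hb⟩
    · exact ⟨partner_lt hf, .inr ((partner_partner hf).symm ▸ hb)⟩
  · rintro ⟨he, hb | hb⟩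
    · exact .inl ⟨he, hb⟩
    · exact .inr ⟨_, ⟨partner_lt he, hb⟩, partner_partner he⟩

lemma inside_or_partner_subset :
    I.inside b ∪ (I.inside b).image (partner n) ⊆ Finset.range (n + n) :=
  fun _ he => Finset.mem_range.mpr (mem_inside_or_partner.mp he).1

lemma IsFree.card_inside_or_partner (h : I.IsFree b) :
    (I.inside b ∪ (I.inside b).image (partner n)).card = I.cnt b + I.cnt b := by
  have hinj : Set.InjOn (partner n) (I.inside b) := fun e he f hf hef => by
    rw [← partner_partner (mem_inside.mp he).1, hef, partner_partner (mem_inside.mp hf).1]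
  rw [Finset.card_union_of_disjoint, Finset.card_image_of_injOn hinj, cnt]
  refine Finset.disjoint_left.mpr fun e he hp => ?_
  obtain ⟨f, hf, rfl⟩ := Finset.mem_image.mp hp
  rw [mem_inside] at he hf
  exact h f hf.1 ⟨hf.2, he.2⟩

lemma IsFree.cnt_le (h : I.IsFree b) : I.cnt b ≤ n := by
  have := Finset.card_le_card (I.inside_or_partner_subset (b := b))
  rw [h.card_inside_or_partner, Finset.card_range] at this
  omega

lemma isStabbing_iff : I.IsStabbing b ↔ I.IsFree b ∧ I.cnt b = n := by
  constructor
  · intro h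
    have hfree : I.IsFree b := fun e he hb => (h e he).mp hb.2 hb.1
    have hall : I.inside b ∪ (I.inside b).image (partner n) = Finset.range (n + n) := by
      ext e
      rw [mem_inside_or_partner, Finset.mem_range, and_iff_left_iff_imp]
      exact fun he => (Classical.em _).imp_right (h e he).mpr
    have hcard := hfree.card_inside_or_partner
    rw [hall, Finset.card_range] at hcard
    exact ⟨hfree, by omega⟩
  · rintro ⟨hfree, hcnt⟩ e he
    have hall := Finset.eq_of_subset_of_card_le (I.inside_or_partner_subset (b := b))
      (by rw [hfree.card_inside_or_partner, Finset.card_range, hcnt])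
    have hor := (mem_inside_or_partner.mp (hall ▸ Finset.mem_range.mpr he)).2
    have hnot := hfree e he
    tauto

lemma exists_isWithin (I : Ranked n) {T : Finset ℕ} (hT : ∀ e ∈ T, e < n + n) (hne : T.Nonempty) :
    ∃ b : Box, b.IsWithin (n + n) ∧ I.PX (b.left + 1) ∈ T ∧ I.PX b.right ∈ T ∧
      I.PY (b.bottom + 1) ∈ T ∧ I.PY b.top ∈ T ∧ ∀ e ∈ T, I.InBox b e := by
  obtain ⟨l, hl, hlmin⟩ := T.exists_min_image I.X hne
  obtain ⟨r, hr, hrmax⟩ := T.exists_max_image I.X hne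
  obtain ⟨d, hd, hdmin⟩ := T.exists_min_image I.Y hne
  obtain ⟨t, ht, htmax⟩ := T.exists_max_image I.Y hne
  have hlspec := I.x_spec l (hT l hl)
  have hrspec := I.x_spec r (hT r hr)
  have hdspec := I.y_spec d (hT d hd)
  have htspec := I.y_spec t (hT t ht)
  refine ⟨⟨I.X l - 1, I.X r, I.Y d - 1, I.Y t⟩, ⟨?_, ⟨hrspec.1, hrspec.2.1⟩, ?_,
    ⟨htspec.1, htspec.2.1⟩⟩, ?_, ?_, ?_, ?_, fun e he => ?_⟩
  · change I.X l - 1 < n + n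
    omega
  · change I.Y d - 1 < n + n
    omega
  · rwa [Nat.sub_add_cancel hlspec.1, hlspec.2.2]
  · rwa [hrspec.2.2]
  · rwa [Nat.sub_add_cancel hdspec.1, hdspec.2.2]
  · rwa [htspec.2.2]
  · have := hlmin e he
    have := hrmax e he
    have := hdmin e he
    have := htmax e he
    simp only [InBox]
    omega

/-- A stabbing box that contains the endpoints that determine its four sides. -/
structure IsTight (I : Ranked n) (b : Box) : Prop extends b.IsWithin (n + n) where
  isStabbing : I.IsStabbing b
  left : I.InBox b (I.PX (b.left + 1))
  right : I.InBox b (I.PX b.right)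
  bottom : I.InBox b (I.PY (b.bottom + 1))
  top : I.InBox b (I.PY b.top)

namespace IsTight

lemma x_left (hb : I.IsTight b) :
    I.PX (b.left + 1) < n + n ∧ I.X (I.PX (b.left + 1)) = b.left + 1 :=
  I.px_spec _ (Nat.le_add_left 1 _) hb.left_lt

lemma x_right (hb : I.IsTight b) : I.PX b.right < n + n ∧ I.X (I.PX b.right) = b.right :=
  I.px_spec _ hb.right_mem.1 hb.right_mem.2

lemma y_bottom (hb : I.IsTight b) :
    I.PY (b.bottom + 1) < n + n ∧ I.Y (I.PY (b.bottom + 1)) = b.bottom + 1 :=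
  I.py_spec _ (Nat.le_add_left 1 _) hb.bottom_lt

lemma y_top (hb : I.IsTight b) : I.PY b.top < n + n ∧ I.Y (I.PY b.top) = b.top :=
  I.py_spec _ hb.top_mem.1 hb.top_mem.2

lemma cnt_eq (hb : I.IsTight b) : I.cnt b = n := (isStabbing_iff.mp hb.isStabbing).2

lemma isFree (hb : I.IsTight b) : I.IsFree b := (isStabbing_iff.mp hb.isStabbing).1

lemma le_of_inBox_imp (hb : I.IsTight b) (h : ∀ e < n + n, I.InBox b e → I.InBox c e) : b ≤ c := by
  have hl := (h _ hb.x_left.1 hb.left).1.1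
  have hr := (h _ hb.x_right.1 hb.right).1.2
  have hbot := (h _ hb.y_bottom.1 hb.bottom).2.1
  have ht := (h _ hb.y_top.1 hb.top).2.2
  rw [hb.x_left.2] at hl
  rw [hb.x_right.2] at hr
  rw [hb.y_bottom.2] at hbot
  rw [hb.y_top.2] at ht
  exact ⟨Nat.lt_succ_iff.mp hl, hr, Nat.lt_succ_iff.mp hbot, ht⟩

lemma eq_of_inBox_iff (hb : I.IsTight b) (hc : I.IsTight c)
    (h : ∀ e < n + n, (I.InBox b e ↔ I.InBox c e)) : b = c := by
  have hbc := hb.le_of_inBox_imp fun e he => (h e he).mp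
  have hcb := hc.le_of_inBox_imp fun e he => (h e he).mpr
  exact Box.ext (le_antisymm hcb.1 hbc.1) (le_antisymm hbc.2.1 hcb.2.1)
    (le_antisymm hcb.2.2.1 hbc.2.2.1) (le_antisymm hbc.2.2.2 hcb.2.2.2)

lemma eq_of_le (hb : I.IsTight b) (hc : I.IsTight c) (h : b ≤ c) : b = c :=
  hb.eq_of_inBox_iff hc fun _ he => inBox_iff_of_cnt_eq h (hb.cnt_eq.trans hc.cnt_eq.symm) he

lemma eq_of_three_sides (hb : I.IsTight b) (hc : I.IsTight c) (hl : b.left = c.left)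
    (hr : b.right = c.right) (hbot : b.bottom = c.bottom) : b = c := by
  rcases le_total b.top c.top with ht | ht
  · exact hb.eq_of_le hc ⟨hl.ge, hr.le, hbot.ge, ht⟩
  · exact (hc.eq_of_le hb ⟨hl.le, hr.ge, hbot.le, ht⟩).symm

end IsTight

end Ranked

namespace Ranked

section UpperBound

variable {n : ℕ} {I : Ranked n} {b c z : Box}

/-- Some tight box has the same left and right sides as `b` and a higher bottom side. -/
def CanRise (I : Ranked n) (b : Box) : Prop :=
  ∃ z, I.IsTight z ∧ z.left = b.left ∧ z.right = b.right ∧ b.bottom < z.bottom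

lemma IsTight.top_lt_top (hb : I.IsTight b) (hc : I.IsTight c) (hl : b.left = c.left)
    (hbot : b.bottom = c.bottom) (hr : b.right < c.right) : c.top < b.top := by
  by_contra! ht
  exact hr.ne (congrArg Box.right (hb.eq_of_le hc ⟨hl.ge, hr.le, hbot.ge, ht⟩))

lemma IsTight.lt_x_partner (hb : I.IsTight b) (hc : I.IsTight c) (hl : b.left = c.left)
    (hbot : b.bottom = c.bottom) (hr : b.right < c.right) (hrise : I.CanRise c) :
    b.right < I.X (partner n (I.PY (b.bottom + 1))) ∧
      I.X (partner n (I.PY (b.bottom + 1))) ≤ c.right := by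
  obtain ⟨z, hz, hzl, hzr, hzb⟩ := hrise
  have htop := hb.top_lt_top hc hl hbot hr
  have hcl := hc.left
  have hzl' := hz.left
  have hX := hc.x_right.2
  have hY := hb.y_bottom.2
  rw [hzl] at hzl'
  have hright_b := hb.isStabbing _ hc.x_right.1
  have hright_c := hc.isStabbing _ hc.x_right.1
  have hright_z := hz.isStabbing _ (hzr ▸ hz.x_right.1 : I.PX c.right < n + n)
  have hbottom_b := hb.isStabbing _ hb.y_bottom.1
  have hbottom_z := hz.isStabbing _ hb.y_bottom.1
  have hcr := hc.right
  have hzr' := hz.right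
  rw [hzr] at hzr'
  have hbb := hb.bottom
  unfold InBox at *
  omega

lemma IsTight.eq_of_canRise (hb : I.IsTight b) (hc : I.IsTight c) (hl : b.left = c.left)
    (hbot : b.bottom = c.bottom) (hbr : I.CanRise b) (hcr : I.CanRise c)
    (hflag : I.X (partner n (I.PY (b.bottom + 1))) ≤ b.right ↔
      I.X (partner n (I.PY (c.bottom + 1))) ≤ c.right) : b = c := by
  rw [← hbot] at hflag
  rcases lt_trichotomy b.right c.right with hr | hr | hr
  · have := hb.lt_x_partner hc hl hbot hr hcr
    omega
  · exact hb.eq_of_three_sides hc hl hr hbot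
  · have := hc.lt_x_partner hb hl.symm hbot.symm hr hbr
    rw [← hbot] at this
    omega

lemma IsTight.eq_of_not_canRise (hb : I.IsTight b) (hc : I.IsTight c) (hl : b.left = c.left)
    (hr : b.right = c.right) (hbr : ¬ I.CanRise b) (hcr : ¬ I.CanRise c) : b = c := by
  refine hb.eq_of_three_sides hc hl hr (le_antisymm ?_ ?_) <;> by_contra! hlt
  · exact hcr ⟨b, hb, hl, hr, hlt⟩
  · exact hbr ⟨c, hc, hl.symm, hr.symm, hlt⟩

lemma ncard_isTight_canRise_le (I : Ranked n) :
    {b | I.IsTight b ∧ I.CanRise b}.Finite ∧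
      {b | I.IsTight b ∧ I.CanRise b}.ncard ≤ 8 * n ^ 2 := by
  let f : Box → ℕ × ℕ × Bool := fun b =>
    (b.left, b.bottom, decide (I.X (partner n (I.PY (b.bottom + 1))) ≤ b.right))
  let G := Finset.range (n + n) ×ˢ Finset.range (n + n) ×ˢ (Finset.univ : Finset Bool)
  have hmaps : Set.MapsTo f {b | I.IsTight b ∧ I.CanRise b} G := fun b hb => by
    simp only [f, G, Finset.coe_product, Set.mem_prod, Finset.coe_range, Set.mem_Iio,
      Finset.coe_univ, Set.mem_univ, and_true]
    exact ⟨hb.1.left_lt, hb.1.bottom_lt⟩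
  have hinj : Set.InjOn f {b | I.IsTight b ∧ I.CanRise b} := fun b hb c hc h => by
    simp only [f, Prod.mk.injEq, decide_eq_decide] at h
    exact hb.1.eq_of_canRise hc.1 h.1 h.2.1 hb.2 hc.2 h.2.2
  refine ⟨Set.Finite.of_injOn hmaps hinj G.finite_toSet, ?_⟩
  refine (Set.ncard_le_ncard_of_injOn f hmaps hinj G.finite_toSet).trans_eq ?_
  simp only [Set.ncard_coe_finset, G, Finset.card_product, Finset.card_range, Finset.card_univ,
    Fintype.card_bool]
  ring

lemma ncard_isTight_not_canRise_le (I : Ranked n) :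
    {b | I.IsTight b ∧ ¬ I.CanRise b}.Finite ∧
      {b | I.IsTight b ∧ ¬ I.CanRise b}.ncard ≤ 4 * n ^ 2 := by
  let f : Box → ℕ × ℕ := fun b => (b.left, b.right - 1)
  let G := Finset.range (n + n) ×ˢ Finset.range (n + n)
  have hmaps : Set.MapsTo f {b | I.IsTight b ∧ ¬ I.CanRise b} G := fun b hb => by
    have := hb.1.left_lt
    have := hb.1.right_mem
    simp only [f, G, Finset.coe_product, Set.mem_prod, Finset.coe_range, Set.mem_Iio]
    omega
  have hinj : Set.InjOn f {b | I.IsTight b ∧ ¬ I.CanRise b} := fun b hb c hc h => by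
    have := hb.1.right_mem
    have := hc.1.right_mem
    simp only [f, Prod.mk.injEq] at h
    exact hb.1.eq_of_not_canRise hc.1 h.1 (by omega) hb.2 hc.2
  refine ⟨Set.Finite.of_injOn hmaps hinj G.finite_toSet, ?_⟩
  refine (Set.ncard_le_ncard_of_injOn f hmaps hinj G.finite_toSet).trans_eq ?_
  simp only [Set.ncard_coe_finset, G, Finset.card_product, Finset.card_range]
  ring

theorem ncard_isTight_le (I : Ranked n) :
    {b | I.IsTight b}.Finite ∧ {b | I.IsTight b}.ncard ≤ 12 * n ^ 2 := by
  obtain ⟨hfin₁, hcard₁⟩ := I.ncard_isTight_canRise_le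
  obtain ⟨hfin₂, hcard₂⟩ := I.ncard_isTight_not_canRise_le
  have hunion : {b | I.IsTight b} =
      {b | I.IsTight b ∧ I.CanRise b} ∪ {b | I.IsTight b ∧ ¬ I.CanRise b} := by
    ext b
    simp only [Set.mem_ofPred_eq, Set.mem_union]
    tauto
  rw [hunion]
  have := Set.ncard_union_le {b | I.IsTight b ∧ I.CanRise b} {b | I.IsTight b ∧ ¬ I.CanRise b}
  exact ⟨hfin₁.union hfin₂, by omega⟩

end UpperBound

end Ranked

section Rank

variable {α : Type*} [LinearOrder α] {v : ℕ → α} {N e f r : ℕ}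

/-- The number of keys that are smaller than key `e`. -/
def countLt (v : ℕ → α) (N e : ℕ) : ℕ := Nat.count (fun j => v j < v e) N

/-- The number of keys that are not larger than key `e`. -/
def countLe (v : ℕ → α) (N e : ℕ) : ℕ := Nat.count (fun j => v j ≤ v e) N

/-- The rank of key `e`, from `1` to `N`; equal keys are ordered by their numbers. -/
def rank (v : ℕ → α) (N e : ℕ) : ℕ := Nat.count (fun j => toLex (v j, j) ≤ toLex (v e, e)) N

lemma count_lt_count {p q : ℕ → Prop} [DecidablePred p] [DecidablePred q] (he : e < N)
    (hpq : ∀ j, p j → q j) (hp : ¬ p e) (hq : q e) : Nat.count p N < Nat.count q N := by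
  rw [Nat.count_eq_card_filter_range, Nat.count_eq_card_filter_range]
  refine Finset.card_lt_card (Finset.ssubset_iff_subset_ne.mpr
    ⟨Finset.monotone_filter_right _ fun j _ => hpq j, fun heq => hp ?_⟩)
  exact (Finset.mem_filter.mp (heq ▸ Finset.mem_filter.mpr ⟨Finset.mem_range.mpr he, hq⟩)).2

lemma rank_lt (hf : f < N) (h : toLex (v e, e) < toLex (v f, f)) : rank v N e < rank v N f :=
  count_lt_count hf (fun _ hj => hj.trans h.le) h.not_ge le_rfl

lemma rank_pos (he : e < N) : 1 ≤ rank v N e := by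
  rw [rank, Nat.count_eq_card_filter_range]
  exact Finset.card_pos.mpr ⟨e, Finset.mem_filter.mpr ⟨Finset.mem_range.mpr he, le_rfl⟩⟩

lemma rank_le : rank v N e ≤ N := Nat.count_le _

lemma rank_inj (he : e < N) (hf : f < N) (h : rank v N e = rank v N f) : e = f := by
  rcases lt_trichotomy (toLex (v e, e)) (toLex (v f, f)) with hlt | heq | hlt
  · exact absurd h (rank_lt hf hlt).ne
  · exact congrArg Prod.snd (toLex.injective heq)
  · exact absurd h (rank_lt he hlt).ne'

lemma exists_rank_eq (h1 : 1 ≤ r) (h2 : r ≤ N) : ∃ e < N, rank v N e = r := by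
  have hmaps : Set.MapsTo (rank v N) (Finset.range N) (Finset.Icc 1 N) := fun e he =>
    Finset.mem_coe.mpr (Finset.mem_Icc.mpr ⟨rank_pos (Finset.mem_range.mp he), rank_le⟩)
  have hinj : Set.InjOn (rank v N) (Finset.range N) := fun e he f hf =>
    rank_inj (Finset.mem_range.mp he) (Finset.mem_range.mp hf)
  obtain ⟨e, he, hr⟩ := Finset.surjOn_of_injOn_of_card_le _ hmaps hinj (by simp)
    (Finset.mem_coe.mpr (Finset.mem_Icc.mpr ⟨h1, h2⟩))
  exact ⟨e, Finset.mem_range.mp he, hr⟩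

lemma rank_le_countLe (he : e < N) : rank v N e ≤ countLe v N f ↔ v e ≤ v f := by
  refine ⟨fun h => ?_, fun h => Nat.count_mono_left fun j _ hj =>
    (Prod.Lex.toLex_le_toLex'.mp hj).1.trans h⟩
  by_contra! hlt
  exact (count_lt_count he (fun j hj => Prod.Lex.toLex_le_toLex.mpr (.inl (hj.trans_lt hlt)))
    hlt.not_ge le_rfl).not_ge h

lemma countLt_lt_rank (he : e < N) : countLt v N f < rank v N e ↔ v f ≤ v e := by
  refine ⟨fun h => ?_, fun h => count_lt_count he
    (fun j hj => Prod.Lex.toLex_le_toLex.mpr (.inl (hj.trans_le h))) h.not_gt le_rfl⟩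
  by_contra! hlt
  have : rank v N e ≤ countLt v N f := Nat.count_mono_left fun j _ hj =>
    (Prod.Lex.toLex_le_toLex'.mp hj).1.trans_lt hlt
  exact this.not_gt h

open Classical in
/-- The key of a given rank, with the junk value `0` if `r` is not a rank. -/
noncomputable def unrank (v : ℕ → α) (N r : ℕ) : ℕ :=
  if h : ∃ e < N, rank v N e = r then h.choose else 0

lemma unrank_spec (h1 : 1 ≤ r) (h2 : r ≤ N) :
    unrank v N r < N ∧ rank v N (unrank v N r) = r := by
  have h := exists_rank_eq (v := v) h1 h2
  rw [unrank, dif_pos h]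
  exact h.choose_spec

lemma unrank_rank (he : e < N) : unrank v N (rank v N e) = e :=
  have h := unrank_spec (v := v) (rank_pos he) rank_le
  rank_inj h.1 he h.2

end Rank

section RankedSegments

variable {n : ℕ}

/-- The `x`-coordinate of endpoint number `e`. -/
noncomputable def xkey (S : Fin n → Segment) (e : ℕ) : ℝ := (pos S e).1

/-- The `y`-coordinate of endpoint number `e`. -/
noncomputable def ykey (S : Fin n → Segment) (e : ℕ) : ℝ := (pos S e).2

/-- The endpoints of `S`, sorted by their coordinates and, in case of ties, by their numbers. -/
noncomputable def ranked (S : Fin n → Segment) : Ranked n where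
  X := rank (xkey S) (n + n)
  Y := rank (ykey S) (n + n)
  PX := unrank (xkey S) (n + n)
  PY := unrank (ykey S) (n + n)
  x_spec _ he := ⟨rank_pos he, rank_le, unrank_rank he⟩
  y_spec _ he := ⟨rank_pos he, rank_le, unrank_rank he⟩
  px_spec _ h1 h2 := unrank_spec h1 h2
  py_spec _ h1 h2 := unrank_spec h1 h2

/-- The endpoints that determine the left, right, bottom and top side of a box of ranks. -/
def Ranked.quad (I : Ranked n) (b : Box) : ℕ × ℕ × ℕ × ℕ :=
  (I.PX (b.left + 1), I.PX b.right, I.PY (b.bottom + 1), I.PY b.top)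

/-- The rectangle of the plane whose left, right, bottom and top side is determined by the
endpoints of the quadruple `q`. -/
def spanBox (S : Fin n → Segment) (q : ℕ × ℕ × ℕ × ℕ) : Set Point :=
  box (pos S q.1).1 (pos S q.2.1).1 (pos S q.2.2.1).2 (pos S q.2.2.2).2

/-- The box of the ranks of all endpoints in the rectangle `spanBox S q`. -/
noncomputable def rankBox (S : Fin n → Segment) (q : ℕ × ℕ × ℕ × ℕ) : Box where
  left := countLt (xkey S) (n + n) q.1
  right := countLe (xkey S) (n + n) q.2.1
  bottom := countLt (ykey S) (n + n) q.2.2.1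
  top := countLe (ykey S) (n + n) q.2.2.2

/-- The box is tight, and no endpoint enters through a tie of coordinates when it is replaced by
the rectangle of the plane that the endpoints on its sides span. -/
def IsRealized (S : Fin n → Segment) (b : Box) : Prop :=
  (ranked S).IsTight b ∧ (ranked S).cnt (rankBox S ((ranked S).quad b)) = n

variable {S : Fin n → Segment} {b : Box} {e : ℕ} {q : ℕ × ℕ × ℕ × ℕ} {R : Set Point} {x : Point}

lemma mem_spanBox : x ∈ spanBox S q ↔ ((pos S q.1).1 ≤ x.1 ∧ x.1 ≤ (pos S q.2.1).1) ∧
    (pos S q.2.2.1).2 ≤ x.2 ∧ x.2 ≤ (pos S q.2.2.2).2 := by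
  simp only [spanBox, box, Set.mem_prod, Set.mem_Icc]

lemma mem_spanBox_iff_inBox (he : e < n + n) :
    pos S e ∈ spanBox S q ↔ (ranked S).InBox (rankBox S q) e := by
  simp only [mem_spanBox, Ranked.InBox, ranked, rankBox, countLt_lt_rank he, rank_le_countLe he,
    xkey, ykey]

lemma Box.IsWithin.le_rankBox (hb : b.IsWithin (n + n)) :
    b ≤ rankBox S ((ranked S).quad b) := by
  have hl := (ranked S).px_spec _ (Nat.le_add_left 1 _) hb.left_lt
  have hr := (ranked S).px_spec _ hb.right_mem.1 hb.right_mem.2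
  have hbot := (ranked S).py_spec _ (Nat.le_add_left 1 _) hb.bottom_lt
  have ht := (ranked S).py_spec _ hb.top_mem.1 hb.top_mem.2
  exact ⟨Nat.lt_succ_iff.mp (((countLt_lt_rank hl.1).mpr le_rfl).trans_eq hl.2),
    hr.2.ge.trans ((rank_le_countLe hr.1).mpr le_rfl),
    Nat.lt_succ_iff.mp (((countLt_lt_rank hbot.1).mpr le_rfl).trans_eq hbot.2),
    ht.2.ge.trans ((rank_le_countLe ht.1).mpr le_rfl)⟩

lemma IsRealized.mem_spanBox (h : IsRealized S b) (he : e < n + n) :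
    pos S e ∈ spanBox S ((ranked S).quad b) ↔ (ranked S).InBox b e := by
  rw [mem_spanBox_iff_inBox he]
  exact (Ranked.inBox_iff_of_cnt_eq h.1.le_rankBox (h.1.cnt_eq.trans h.2.symm) he).symm

lemma IsRealized.represents (h : IsRealized S b) :
    Represents S ((ranked S).quad b) (spanBox S ((ranked S).quad b)) := by
  have hl := h.1.x_left.1
  have hr := h.1.x_right.1
  have hbot := h.1.y_bottom.1
  have ht := h.1.y_top.1
  have hpos (f) (hf : f < n + n) : endpoint S ⟨f, hf⟩ = pos S f := (pos_coe S ⟨f, hf⟩).symm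
  refine ⟨⟨_, hl⟩, ⟨_, hr⟩, ⟨_, hbot⟩, ⟨_, ht⟩, rfl, by simp only [hpos]; rfl, ?_⟩
  simp only [hpos]
  exact ⟨(h.mem_spanBox hl).mpr h.1.left, (h.mem_spanBox hr).mpr h.1.right,
    (h.mem_spanBox hbot).mpr h.1.bottom, (h.mem_spanBox ht).mpr h.1.top⟩

lemma IsRealized.isStabbingRectangle (h : IsRealized S b) :
    IsStabbingRectangle S (spanBox S ((ranked S).quad b)) := by
  have hl := Stab.mem_spanBox.mp ((h.mem_spanBox h.1.x_left.1).mpr h.1.left)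
  refine ⟨⟨_, _, _, _, hl.1.1.trans hl.1.2, hl.2.1.trans hl.2.2, rfl⟩, stabs_iff.mpr ?_⟩
  intro e he
  rw [h.mem_spanBox he, h.mem_spanBox (partner_lt he)]
  exact h.1.isStabbing e he

lemma Represents.eq_spanBox (h : Represents S q R) : R = spanBox S q := by
  obtain ⟨l, r, b, t, rfl, hR, -⟩ := h
  rw [hR]
  simp only [spanBox, pos_coe]

lemma spanBox_subset (hR : IsRectangle R) (hl : pos S q.1 ∈ R) (hr : pos S q.2.1 ∈ R)
    (hb : pos S q.2.2.1 ∈ R) (ht : pos S q.2.2.2 ∈ R) : spanBox S q ⊆ R := by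
  obtain ⟨a, b, c, d, -, -, rfl⟩ := hR
  exact Set.prod_mono (Set.Icc_subset_Icc hl.1.1 hr.1.2) (Set.Icc_subset_Icc hb.2.1 ht.2.2)

lemma IsStabbingRectangle.exists_isRealized (hn : 1 ≤ n) (h : IsStabbingRectangle S R) :
    ∃ b, IsRealized S b ∧ CombEquiv S R (spanBox S ((ranked S).quad b)) := by
  classical
  obtain ⟨hrect, hstab⟩ := h
  let T : Finset ℕ := {e ∈ Finset.range (n + n) | pos S e ∈ R}
  have hT (e) : e ∈ T ↔ e < n + n ∧ pos S e ∈ R := by simp [T]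
  obtain ⟨e₀, he₀, hR₀⟩ := hstab.exists_mem hn
  obtain ⟨b, hb, hl, hr, hbot, ht, hin⟩ :=
    (ranked S).exists_isWithin (fun e he => ((hT e).mp he).1) ⟨e₀, (hT e₀).mpr ⟨he₀, hR₀⟩⟩
  rw [hT] at hl hr hbot ht
  have hInSpan (e) (he : e < n + n) (h : (ranked S).InBox b e) :
      pos S e ∈ spanBox S ((ranked S).quad b) :=
    (mem_spanBox_iff_inBox he).mpr (h.mono hb.le_rankBox)
  have hSpanR := spanBox_subset (q := (ranked S).quad b) hrect hl.2 hr.2 hbot.2 ht.2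
  have hRIn (e) (he : e < n + n) (h : pos S e ∈ R) : (ranked S).InBox b e :=
    hin e ((hT e).mpr ⟨he, h⟩)
  have hR (e) (he : e < n + n) : pos S e ∈ R ↔ (ranked S).InBox b e :=
    ⟨hRIn e he, fun h => hSpanR (hInSpan e he h)⟩
  have hcomb : CombEquiv S R (spanBox S ((ranked S).quad b)) := combEquiv_iff.mpr fun e he =>
    ⟨fun h => hInSpan e he (hRIn e he h), fun h => hSpanR h⟩
  have hstab' : (ranked S).IsStabbing b := fun e he => by
    rw [← hR e he, ← hR _ (partner_lt he)]
    exact stabs_iff.mp hstab e he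
  have hspan : (ranked S).IsStabbing (rankBox S ((ranked S).quad b)) := fun e he => by
    rw [← mem_spanBox_iff_inBox he, ← mem_spanBox_iff_inBox (partner_lt he)]
    exact stabs_iff.mp (hstab.congr hcomb) e he
  exact ⟨b, ⟨⟨hb, hstab', (hR _ hl.1).mp hl.2, (hR _ hr.1).mp hr.2, (hR _ hbot.1).mp hbot.2,
    (hR _ ht.1).mp ht.2⟩, (Ranked.isStabbing_iff.mp hspan).2⟩, hcomb⟩

theorem reportsAll_of_isRealized (hn : 1 ≤ n) {K : List Box} (hnodup : K.Nodup)
    (hK : ∀ b, b ∈ K ↔ IsRealized S b) : ReportsAll S (K.map (ranked S).quad) := by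
  refine ⟨fun q hq => ?_, ?_, fun R hR => ?_⟩
  · obtain ⟨b, hb, rfl⟩ := List.mem_map.mp hq
    have hb' := (hK b).mp hb
    exact ⟨_, hb'.represents, hb'.isStabbingRectangle⟩
  · rw [List.pairwise_map]
    refine hnodup.imp_of_mem fun {b c} hb hc hne R R' hR hR' hcomb => hne ?_
    rw [hR.eq_spanBox, hR'.eq_spanBox, combEquiv_iff] at hcomb
    have hb' := (hK b).mp hb
    have hc' := (hK c).mp hc
    refine hb'.1.eq_of_inBox_iff hc'.1 fun e he => ?_
    rw [← hb'.mem_spanBox he, ← hc'.mem_spanBox he]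
    exact hcomb e he
  · obtain ⟨b, hb, hcomb⟩ := hR.exists_isRealized hn
    exact ⟨_, List.mem_map.mpr ⟨b, (hK b).mpr hb, rfl⟩, _, hb.represents, hcomb⟩

theorem stabberClasses_ncard_le (hn : 1 ≤ n) (S : Fin n → Segment) :
    (stabberClasses S).Finite ∧ (stabberClasses S).ncard ≤ 12 * n ^ 2 := by
  obtain ⟨hfin, hcard⟩ := (ranked S).ncard_isTight_le
  have hsub : stabberClasses S ⊆
      (fun b => redPoints S (spanBox S ((ranked S).quad b))) '' {b | (ranked S).IsTight b} := by
    rintro A ⟨R, hR, rfl⟩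
    obtain ⟨b, hb, hcomb⟩ := hR.exists_isRealized hn
    exact ⟨b, hb.1, hcomb.symm⟩
  refine ⟨(hfin.image _).subset hsub, (Set.ncard_le_ncard hsub (hfin.image _)).trans ?_⟩
  exact (Set.ncard_image_le hfin).trans hcard

end RankedSegments

section LowerBound

/-- Segment `i` of a family with quadratically many stabbing rectangles: for `i < n / 2` it can
only be crossed by the left or right side, otherwise only by the bottom or top side. -/
def crossSegment (n i : ℕ) : Segment :=
  if i < n / 2 then (((i : ℝ), (n + 1 : ℝ)), ((i + (3 * n + 3) : ℝ), (n + 2 : ℝ)))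
  else (((n + 1 : ℝ), (i : ℝ)), ((n + 2 : ℝ), (i + (3 * n + 3) : ℝ)))

/-- The rectangles that stab the family of the segments `crossSegment n i`: the parameters
`u ≤ n / 2` and `v ≥ n / 2` say which segments of either kind have their first endpoint inside. -/
def crossBox (n u v : ℕ) : Set Point :=
  box u (u + (3 * n + 2) : ℝ) v (v + (3 * n + 2) : ℝ)

variable {n u v u' v' i : ℕ}

lemma fst_mem_crossBox (hu : u ≤ n) (hv : v ≤ n) (hi : i < n) :
    (crossSegment n i).1 ∈ crossBox n u v ↔ if i < n / 2 then u ≤ i else v ≤ i := by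
  have hu' : (u : ℝ) ≤ n := Nat.cast_le.mpr hu
  have hv' : (v : ℝ) ≤ n := Nat.cast_le.mpr hv
  have hi' : (i : ℝ) ≤ n := Nat.cast_le.mpr hi.le
  have : (0 : ℝ) ≤ u := u.cast_nonneg
  have : (0 : ℝ) ≤ v := v.cast_nonneg
  unfold crossSegment crossBox box
  split_ifs <;> simp only [Set.mem_prod, Set.mem_Icc, Nat.cast_le]
  · exact ⟨fun h => h.1.1, fun h => ⟨⟨h, by linarith⟩, by linarith, by linarith⟩⟩
  · exact ⟨fun h => h.2.1, fun h => ⟨⟨by linarith, by linarith⟩, h, by linarith⟩⟩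

lemma snd_mem_crossBox (hu : u ≤ n) (hv : v ≤ n) :
    (crossSegment n i).2 ∈ crossBox n u v ↔ if i < n / 2 then i < u else i < v := by
  have hu' : (u : ℝ) ≤ n := Nat.cast_le.mpr hu
  have hv' : (v : ℝ) ≤ n := Nat.cast_le.mpr hv
  have : (0 : ℝ) ≤ i := i.cast_nonneg
  have : (0 : ℝ) ≤ u := u.cast_nonneg
  have : (0 : ℝ) ≤ v := v.cast_nonneg
  have hfar (w : ℕ) : (i + (3 * n + 3) : ℝ) ≤ w + (3 * n + 2) ↔ i < w := by
    rw [← Nat.add_one_le_iff, ← Nat.cast_le (α := ℝ), Nat.cast_add_one]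
    constructor <;> intro h <;> linarith
  unfold crossSegment crossBox box
  split_ifs <;> simp only [Set.mem_prod, Set.mem_Icc, hfar]
  · exact ⟨fun h => h.1.2, fun h => ⟨⟨by linarith, h⟩, by linarith, by linarith⟩⟩
  · exact ⟨fun h => h.2.2, fun h => ⟨⟨by linarith, by linarith⟩, by linarith, h⟩⟩

lemma crossSegment_lt (n i : ℕ) :
    (crossSegment n i).1.1 < (crossSegment n i).2.1 ∧
      (crossSegment n i).1.2 < (crossSegment n i).2.2 := by
  have : (0 : ℝ) ≤ n := n.cast_nonneg
  unfold crossSegment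
  split_ifs <;> constructor <;> simp only <;> linarith

lemma crossSegment_injective (n : ℕ) :
    Function.Injective fun i : Fin n => s((crossSegment n i).1, (crossSegment n i).2) := by
  intro i j h
  rcases Sym2.eq_iff.mp h with ⟨hfst, -⟩ | ⟨hfst, hsnd⟩
  · have hi : (i : ℝ) < n := Nat.cast_lt.mpr i.2
    have hj : (j : ℝ) < n := Nat.cast_lt.mpr j.2
    unfold crossSegment at hfst
    split_ifs at hfst <;> simp only [Prod.mk.injEq] at hfst
    · exact Fin.ext (Nat.cast_injective hfst.1)
    · linarith [hfst.1]
    · linarith [hfst.1]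
    · exact Fin.ext (Nat.cast_injective hfst.2)
  · have hi := (crossSegment_lt n i).1
    rw [hfst, hsnd] at hi
    exact absurd hi (crossSegment_lt n j).1.not_gt

lemma isStabbingRectangle_crossBox (hu : u ≤ n) (hv : v ≤ n) :
    IsStabbingRectangle (fun i : Fin n => crossSegment n i) (crossBox n u v) := by
  have : (0 : ℝ) ≤ n := n.cast_nonneg
  refine ⟨⟨_, _, _, _, by linarith, by linarith, rfl⟩, fun i => ?_⟩
  rw [xor_iff_iff_not, fst_mem_crossBox hu hv i.2, snd_mem_crossBox hu hv]
  split_ifs <;> omega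

lemma crossBox_inj (hu : u ≤ n / 2) (hv : n / 2 ≤ v) (hvn : v ≤ n) (hu' : u' ≤ n / 2)
    (hv' : n / 2 ≤ v') (hvn' : v' ≤ n)
    (h : CombEquiv (fun i : Fin n => crossSegment n i) (crossBox n u v) (crossBox n u' v')) :
    u = u' ∧ v = v' := by
  have hmem : ∀ i < n, ((if i < n / 2 then u ≤ i else v ≤ i) ↔
      (if i < n / 2 then u' ≤ i else v' ≤ i)) := fun i hi => by
    have := combEquiv_iff.mp h i (by omega)
    rwa [pos_of_lt _ hi, fst_mem_crossBox (by omega) hvn hi,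
      fst_mem_crossBox (by omega) hvn' hi] at this
  constructor <;> by_contra hne
  · have := hmem (min u u') (by omega)
    rw [if_pos (by omega), if_pos (by omega)] at this
    omega
  · have := hmem (min v v') (by omega)
    rw [if_neg (by omega), if_neg (by omega)] at this
    omega

theorem le_ncard_stabberClasses_crossSegment (hn : 1 ≤ n) :
    (n : ℝ) ^ 2 / 4 ≤ ((stabberClasses fun i : Fin n => crossSegment n i).ncard : ℝ) := by
  set S : Fin n → Segment := fun i => crossSegment n i
  let G := Finset.range (n / 2 + 1) ×ˢ Finset.Icc (n / 2) n
  let f : ℕ × ℕ → Set Point := fun p => redPoints S (crossBox n p.1 p.2)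
  have hG : ∀ p ∈ (G : Set (ℕ × ℕ)), p.1 ≤ n / 2 ∧ n / 2 ≤ p.2 ∧ p.2 ≤ n := fun p hp => by
    simpa [G, Nat.lt_succ_iff] using hp
  have hmaps : Set.MapsTo f G (stabberClasses S) := fun p hp =>
    ⟨_, isStabbingRectangle_crossBox ((hG p hp).1.trans (Nat.div_le_self n 2)) (hG p hp).2.2, rfl⟩
  have hinj : Set.InjOn f G := fun p hp q hq h =>
    have huv := crossBox_inj (hG p hp).1 (hG p hp).2.1 (hG p hp).2.2 (hG q hq).1 (hG q hq).2.1
      (hG q hq).2.2 h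
    Prod.ext huv.1 huv.2
  have hcard := Set.ncard_le_ncard_of_injOn f hmaps hinj (stabberClasses_ncard_le hn S).1
  rw [Set.ncard_coe_finset, Finset.card_product, Finset.card_range, Nat.card_Icc] at hcard
  have hfst : (n : ℝ) ≤ 2 * ((n / 2 + 1 : ℕ) : ℝ) := by
    exact_mod_cast (by omega : n ≤ 2 * (n / 2 + 1))
  have hsnd : (n : ℝ) ≤ 2 * ((n + 1 - n / 2 : ℕ) : ℝ) := by
    exact_mod_cast (by omega : n ≤ 2 * (n + 1 - n / 2))
  calc (n : ℝ) ^ 2 / 4 ≤ ((n / 2 + 1 : ℕ) : ℝ) * ((n + 1 - n / 2 : ℕ) : ℝ) := by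
        nlinarith [mul_le_mul hfst hsnd n.cast_nonneg (by positivity)]
    _ ≤ (stabberClasses S).ncard := by exact_mod_cast hcard

end LowerBound

/-- A family of intervals `(l, h)` with ends between `1` and `M - 1`. An interval is determined by
its upper end and also by its lower end, from which the table `up` computes the upper end; the
convention `up M = M` lets `M` play the role of an interval above all others. -/
structure IsIntervalFamily (M : ℕ) (up : ℕ → ℕ) (D : Set (ℕ × ℕ)) : Prop where
  pos : ∀ p ∈ D, 0 < p.1
  lt : ∀ p ∈ D, p.1 < p.2
  snd_lt : ∀ p ∈ D, p.2 < M
  up_fst : ∀ p ∈ D, up p.1 = p.2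
  snd_inj : ∀ p ∈ D, ∀ q ∈ D, p.2 = q.2 → p = q
  up_last : up M = M

/-- The open window `(u, v)` contains no interval of the family. -/
def IsFreeWindow (D : Set (ℕ × ℕ)) (u v : ℕ) : Prop := ∀ p ∈ D, ¬ (u < p.1 ∧ p.2 < v)

/-- An interval that contains no other interval of the family. -/
def IsInnermost (D : Set (ℕ × ℕ)) (p : ℕ × ℕ) : Prop :=
  p ∈ D ∧ ∀ q ∈ D, p.1 ≤ q.1 → q.2 ≤ p.2 → q = p

/-- `f` is the highest lower end of the intervals below `h`, or `0` if there are none. -/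
def IsStart (D : Set (ℕ × ℕ)) (h f : ℕ) : Prop :=
  (∀ p ∈ D, p.2 < h → p.1 ≤ f) ∧ (f = 0 ∨ ∃ p ∈ D, p.2 < h ∧ p.1 = f)

/-- The set `K` consists of `0` and the lower ends of the innermost intervals, and `nxt` links its
elements in increasing order, the last one to `M`. The maximal free windows are then
`(u, up (nxt u))` for `u ∈ K`. -/
structure IsChain (M : ℕ) (D : Set (ℕ × ℕ)) (nxt : ℕ → ℕ) (K : Finset ℕ) : Prop where
  mem_iff : ∀ u, u ∈ K ↔ u = 0 ∨ ∃ p, IsInnermost D p ∧ p.1 = u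
  lt_nxt : ∀ u ∈ K, u < nxt u
  nxt_mem : ∀ u ∈ K, nxt u ∈ K ∨ nxt u = M
  gap : ∀ u ∈ K, ∀ v ∈ K, u < v → nxt u ≤ v

section Windows

variable {M h f u v l z : ℕ} {up nxt : ℕ → ℕ} {D : Set (ℕ × ℕ)} {K : Finset ℕ} {p q : ℕ × ℕ}

lemma isFreeWindow_insert :
    IsFreeWindow (insert p D) u v ↔ ¬ (u < p.1 ∧ p.2 < v) ∧ IsFreeWindow D u v :=
  Set.forall_mem_insert ..

lemma IsStart.insert_of_lt (hf : IsStart D h f) (hp : p.2 < h) :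
    IsStart (insert p D) h (max f p.1) := by
  refine ⟨Set.forall_mem_insert.mpr ⟨fun _ => le_max_right _ _, fun q hq hqh =>
    le_max_of_le_left (hf.1 q hq hqh)⟩, ?_⟩
  rcases le_total f p.1 with hle | hle
  · exact .inr ⟨p, .inl rfl, hp, (max_eq_right hle).symm⟩
  · rw [max_eq_left hle]
    exact hf.2.imp_right fun ⟨q, hq, hqf⟩ => ⟨q, .inr hq, hqf⟩

lemma IsStart.insert_of_le (hf : IsStart D h f) (hp : h ≤ p.2) : IsStart (insert p D) h f :=
  ⟨Set.forall_mem_insert.mpr ⟨fun hlt => absurd hlt hp.not_gt, hf.1⟩,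
    hf.2.imp_right fun ⟨q, hq, hqf⟩ => ⟨q, .inr hq, hqf⟩⟩

lemma IsStart.le_of_isFreeWindow (hf : IsStart D h f) (hw : IsFreeWindow D u v) (hv : h ≤ v) :
    f ≤ u := by
  rcases hf.2 with rfl | ⟨p, hp, hph, rfl⟩
  · exact u.zero_le
  · exact not_lt.mp fun hu => hw p hp ⟨hu, hph.trans_le hv⟩

lemma IsFreeWindow.insert (hw : IsFreeWindow D u v) (hf : IsStart D p.2 f) (hfp : p.1 < f) :
    IsFreeWindow (insert p D) u v :=
  isFreeWindow_insert.mpr ⟨fun hp => ((hf.le_of_isFreeWindow hw hp.2.le).trans_lt hp.1).not_gt hfp,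
    hw⟩

lemma IsInnermost.snd_lt_snd (hp : IsInnermost D p)
    (hq : IsInnermost D q) (hpq : p.1 < q.1) : p.2 < q.2 := by
  by_contra hle
  exact hpq.ne (congrArg Prod.fst (hp.2 q hq.1 hpq.le (not_lt.mp hle))).symm

namespace IsIntervalFamily

lemma eq_of_fst_eq (hD : IsIntervalFamily M up D) (hp : p ∈ D) (hq : q ∈ D) (hpq : p.1 = q.1) :
    p = q :=
  Prod.ext hpq (by rw [← hD.up_fst p hp, hpq, hD.up_fst q hq])

lemma mono {D' : Set (ℕ × ℕ)} (hD : IsIntervalFamily M up D) (hD' : D' ⊆ D) :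
    IsIntervalFamily M up D' where
  pos p hp := hD.pos p (hD' hp)
  lt p hp := hD.lt p (hD' hp)
  snd_lt p hp := hD.snd_lt p (hD' hp)
  up_fst p hp := hD.up_fst p (hD' hp)
  snd_inj p hp q hq := hD.snd_inj p (hD' hp) q (hD' hq)
  up_last := hD.up_last

lemma fst_ne_of_isStart (hD : IsIntervalFamily M up (insert p D)) (hpD : p ∉ D)
    (hf : IsStart D h f) : p.1 ≠ f := by
  rintro rfl
  rcases hf.2 with h0 | ⟨q, hq, -, hqp⟩
  · exact (hD.pos p (.inl rfl)).ne' h0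
  · exact hpD (hD.eq_of_fst_eq (.inr hq) (.inl rfl) hqp ▸ hq)

lemma lt_of_isStart (hD : IsIntervalFamily M up D) (hf : IsStart D h f) (hh : 0 < h) : f < h := by
  rcases hf.2 with rfl | ⟨p, hp, hph, rfl⟩
  · exact hh
  · exact (hD.lt p hp).trans hph

lemma exists_isInnermost (hD : IsIntervalFamily M up D) (hp : p ∈ D) :
    ∃ q, IsInnermost D q ∧ p.1 ≤ q.1 ∧ q.2 ≤ p.2 := by
  induction hlen : p.2 - p.1 using Nat.strong_induction_on generalizing p with
  | _ d ih =>
    by_cases hpi : IsInnermost D p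
    · exact ⟨p, hpi, le_rfl, le_rfl⟩
    · obtain ⟨q, hq, h1, h2, hne⟩ : ∃ q ∈ D, p.1 ≤ q.1 ∧ q.2 ≤ p.2 ∧ q ≠ p := by
        simpa [IsInnermost, hp] using hpi
      have hfst : p.1 ≠ q.1 := fun h => hne (hD.eq_of_fst_eq hp hq h).symm
      have hlt := hD.lt q hq
      obtain ⟨r, hr, h3, h4⟩ := ih (q.2 - q.1) (by omega) hq rfl
      exact ⟨r, hr, h1.trans h3, h4.trans h2⟩

lemma isInnermost_insert (hD : IsIntervalFamily M up (insert p D)) (hpD : p ∉ D)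
    (hf : IsStart D p.2 f) (hfp : f < p.1) :
    IsInnermost (insert p D) q ↔ q = p ∨ IsInnermost D q ∧ ¬ (f < q.1 ∧ q.1 < p.1) := by
  have snd_ne : ∀ q ∈ D, q.2 ≠ p.2 := fun q hq h =>
    hpD (hD.snd_inj q (.inr hq) p (.inl rfl) h ▸ hq)
  constructor
  · rintro ⟨rfl | hq, hmin⟩
    · exact .inl rfl
    · refine .inr ⟨⟨hq, fun r hr => hmin r (.inr hr)⟩, fun hfq => ?_⟩
      have hlt : p.2 < q.2 := lt_of_le_of_ne
        (not_lt.mp fun h => (hf.1 q hq h).not_gt hfq.1) (snd_ne q hq).symm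
      exact hpD (hmin p (.inl rfl) hfq.2.le hlt.le ▸ hq)
  · rintro (rfl | ⟨hq, hfq⟩)
    · refine ⟨.inl rfl, fun r hr h1 h2 => hr.resolve_right fun hrD => ?_⟩
      have := hf.1 r hrD (lt_of_le_of_ne h2 (snd_ne r hrD))
      omega
    · refine ⟨.inr hq.1, ?_⟩
      rintro r (rfl | hr) h1 h2
      · have hqr : q.1 ≠ r.1 := fun h =>
          hpD (hD.eq_of_fst_eq (.inr hq.1) (.inl rfl) h ▸ hq.1)
        rcases hf.2 with rfl | ⟨t, ht, htr, rfl⟩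
        · have := hD.pos q (.inr hq.1)
          omega
        · obtain rfl := hq.2 t ht (by omega) (by omega)
          omega
      · exact hq.2 r hr h1 h2

lemma isInnermost_insert_of_lt (hpD : p ∉ D) (hf : IsStart D p.2 f) (hfp : p.1 < f) :
    IsInnermost (insert p D) q ↔ IsInnermost D q := by
  obtain ⟨t, ht, htp, rfl⟩ := hf.2.resolve_left (by omega)
  constructor
  · rintro ⟨rfl | hq, hmin⟩
    · exact absurd (hmin t (.inr ht) hfp.le htp.le ▸ ht) hpD
    · exact ⟨hq, fun r hr => hmin r (.inr hr)⟩
  · rintro ⟨hq, hmin⟩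
    refine ⟨.inr hq, ?_⟩
    rintro r (rfl | hr) h1 h2
    · obtain rfl := hmin t ht (by omega) (by omega)
      omega
    · exact hmin r hr h1 h2

end IsIntervalFamily

lemma isChain_empty (hM : 0 < M) (h0 : nxt 0 = M) : IsChain M ∅ nxt {0} where
  mem_iff u := by simp [IsInnermost]
  lt_nxt := by simpa [h0] using hM
  nxt_mem := by simp [h0]
  gap := by simp

namespace IsChain

lemma zero_mem (hK : IsChain M D nxt K) : 0 ∈ K := (hK.mem_iff 0).mpr (.inl rfl)

lemma nxt_eq_or_isInnermost (hK : IsChain M D nxt K) (hu : u ∈ K) :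
    nxt u = M ∨ ∃ p, IsInnermost D p ∧ p.1 = nxt u := by
  have hlt := hK.lt_nxt u hu
  rcases hK.nxt_mem u hu with h | h
  · exact .inr (((hK.mem_iff _).mp h).resolve_left (by omega))
  · exact .inl h

section

variable (hK : IsChain M D nxt K) (hD : IsIntervalFamily M up D)
include hK hD

lemma nxt_le (hu : u ∈ K) : nxt u ≤ M := by
  rcases hK.nxt_eq_or_isInnermost hu with h | ⟨p, hp, h⟩
  · exact h.le
  · have := hD.lt p hp.1
    have := hD.snd_lt p hp.1
    omega

lemma lt_of_mem (hu : u ∈ K) : u < M := (hK.lt_nxt u hu).trans_le (hK.nxt_le hD hu)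

lemma lt_up_nxt (hu : u ∈ K) : u < up (nxt u) := by
  have hlt := hK.lt_nxt u hu
  rcases hK.nxt_eq_or_isInnermost hu with h | ⟨p, hp, h⟩
  · rwa [h, hD.up_last, ← h]
  · rw [← h, hD.up_fst p hp.1]
    exact (h ▸ hlt).trans (hD.lt p hp.1)

lemma up_nxt_le (hu : u ∈ K) : up (nxt u) ≤ M := by
  rcases hK.nxt_eq_or_isInnermost hu with h | ⟨p, hp, h⟩
  · rw [h, hD.up_last]
  · rw [← h, hD.up_fst p hp.1]
    exact (hD.snd_lt p hp.1).le

lemma isFreeWindow (hu : u ∈ K) : IsFreeWindow D u (up (nxt u)) := by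
  rintro p hp ⟨hup, hpv⟩
  obtain ⟨q, hq, h1, h2⟩ := hD.exists_isInnermost hp
  have hle : nxt u ≤ q.1 :=
    hK.gap u hu q.1 ((hK.mem_iff _).mpr (.inr ⟨q, hq, rfl⟩)) (hup.trans_le h1)
  have hqM := hD.snd_lt q hq.1
  have hqlt := hD.lt q hq.1
  rcases hK.nxt_eq_or_isInnermost hu with h | ⟨r, hr, hrn⟩
  · omega
  · rw [← hrn, hD.up_fst r hr.1] at hpv
    rcases (hrn ▸ hle).eq_or_lt with heq | hlt
    · rw [hD.eq_of_fst_eq hr.1 hq.1 heq] at hpv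
      omega
    · have := hr.snd_lt_snd hq hlt
      omega

lemma exists_window_ge (hw : IsFreeWindow D u v) (hv : v ≤ M) :
    ∃ w ∈ K, w ≤ u ∧ v ≤ up (nxt w) := by
  have hne : (K.filter (· ≤ u)).Nonempty := ⟨0, by simp [hK.zero_mem]⟩
  obtain ⟨hwK, hwu⟩ := Finset.mem_filter.mp (Finset.max'_mem _ hne)
  set w := (K.filter (· ≤ u)).max' hne
  refine ⟨w, hwK, hwu, ?_⟩
  rcases hK.nxt_eq_or_isInnermost hwK with h | ⟨p, hp, hpw⟩
  · rwa [h, hD.up_last]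
  · have hup : u < nxt w := by
      by_contra hle
      have hmem : nxt w ∈ K := (hK.mem_iff _).mpr (.inr ⟨p, hp, hpw⟩)
      exact (hK.lt_nxt w hwK).not_ge
        (Finset.le_max' (K.filter (· ≤ u)) _
          (Finset.mem_filter.mpr ⟨hmem, not_lt.mp hle⟩))
    rw [← hpw, hD.up_fst p hp.1]
    exact not_lt.mp fun hlt => hw p hp.1 ⟨hpw ▸ hup, hlt⟩

lemma mem_of_isStart (hf : IsStart D h f) : f ∈ K := by
  rw [hK.mem_iff]
  refine hf.2.imp_right ?_
  rintro ⟨p, hp, hph, rfl⟩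
  refine ⟨p, ⟨hp, fun q hq h1 h2 => ?_⟩, rfl⟩
  exact hD.eq_of_fst_eq hq hp ((hf.1 q hq (h2.trans_lt hph)).antisymm h1)

end

lemma card_filter_le_eq (hK : IsChain M D nxt K) (hv : v ∈ K) (hvl : v < l) :
    (K.filter fun u => v ≤ u ∧ u < l).card = (K.filter fun u => nxt v ≤ u ∧ u < l).card + 1 := by
  have hlt := hK.lt_nxt v hv
  rw [← Finset.card_insert_of_notMem (a := v) (by simp [hlt])]
  congr 1
  ext u
  simp only [Finset.mem_filter, Finset.mem_insert]
  constructor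
  · rintro ⟨hu, hvu, hul⟩
    exact hvu.eq_or_lt.imp Eq.symm fun h => ⟨hu, hK.gap v hv u hu h, hul⟩
  · rintro (rfl | ⟨hu, hvu, hul⟩)
    exacts [⟨hv, le_rfl, hvl⟩, ⟨hu, hlt.le.trans hvu, hul⟩]

lemma insert_of_lt (hK : IsChain M D nxt K) (hpD : p ∉ D) (hf : IsStart D p.2 f) (hfp : p.1 < f) :
    IsChain M (insert p D) nxt K where
  __ := hK
  mem_iff u := by
    simp only [IsIntervalFamily.isInnermost_insert_of_lt hpD hf hfp, hK.mem_iff]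

lemma fst_notMem (hK : IsChain M D nxt K) (hD : IsIntervalFamily M up (insert p D))
    (hpD : p ∉ D) : p.1 ∉ K := fun hmem => by
  rcases (hK.mem_iff _).mp hmem with h | ⟨q, hq, hqp⟩
  · exact (hD.pos p (.inl rfl)).ne' h
  · exact hpD (hD.eq_of_fst_eq (.inr hq.1) (.inl rfl) hqp ▸ hq.1)

lemma mem_insert_iff (hK : IsChain M D nxt K) (hD : IsIntervalFamily M up (insert p D))
    (hpD : p ∉ D) (hf : IsStart D p.2 f) (hfp : f < p.1) :
    u = p.1 ∨ u ∈ K ∧ ¬ (f < u ∧ u < p.1) ↔ u = 0 ∨ ∃ q, IsInnermost (insert p D) q ∧ q.1 = u := by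
  simp only [hK.mem_iff, hD.isInnermost_insert hpD hf hfp]
  constructor
  · rintro (rfl | ⟨rfl | ⟨q, hq, rfl⟩, hfu⟩)
    exacts [.inr ⟨p, .inl rfl, rfl⟩, .inl rfl, .inr ⟨q, .inr ⟨hq, hfu⟩, rfl⟩]
  · rintro (rfl | ⟨q, rfl | ⟨hq, hfq⟩, rfl⟩)
    exacts [.inr ⟨.inl rfl, by omega⟩, .inl rfl, .inr ⟨.inr ⟨q, hq, rfl⟩, hfq⟩]

lemma insert (hK : IsChain M D nxt K) (hD : IsIntervalFamily M up (insert p D)) (hpD : p ∉ D)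
    (hf : IsStart D p.2 f) (hfp : f < p.1) (hz : z ∈ K ∨ z = M) (hpz : p.1 < z)
    (hgap : ∀ u ∈ K, f ≤ u → u < z → u < p.1) :
    IsChain M (insert p D) (Function.update (Function.update nxt f p.1) p.1 z)
      (insert p.1 (K.filter fun u => ¬ (f < u ∧ u < p.1))) := by
  have hfK := hK.mem_of_isStart (hD.mono (Set.subset_insert p D)) hf
  have hpK := hK.fst_notMem hD hpD
  set nxt' := Function.update (Function.update nxt f p.1) p.1 z
  have nxt_p : nxt' p.1 = z := by simp [nxt']
  have nxt_f : nxt' f = p.1 := by simp [nxt', hfp.ne]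
  have cases_of {u : ℕ} (hu : u ∈ K ∧ ¬ (f < u ∧ u < p.1)) :
      u = f ∨ nxt' u = nxt u ∧ (u < f ∨ p.1 < u) := by
    have hup : u ≠ p.1 := fun h => hpK (h ▸ hu.1)
    by_cases huf : u = f
    · exact .inl huf
    · exact .inr ⟨by simp [nxt', hup, huf], by omega⟩
  constructor <;> simp only [Finset.mem_insert, Finset.mem_filter]
  · exact fun u => hK.mem_insert_iff hD hpD hf hfp
  · rintro u (rfl | hu)
    · rwa [nxt_p]
    · rcases cases_of hu with rfl | ⟨h, -⟩
      · rwa [nxt_f]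
      · exact h ▸ hK.lt_nxt u hu.1
  · rintro u (rfl | hu)
    · rw [nxt_p]
      exact hz.imp_left fun h => .inr ⟨h, by omega⟩
    · rcases cases_of hu with rfl | ⟨h, hor⟩
      · exact .inl (.inl nxt_f)
      · rw [h]
        refine (hK.nxt_mem u hu.1).imp_left fun hmem => .inr ⟨hmem, fun hn => ?_⟩
        have := hK.lt_nxt u hu.1
        have := hK.gap u hu.1 f hfK
        omega
  · rintro u (rfl | hu) v hv huv
    · have := hgap v (hv.resolve_left (by omega)).1 (by omega)
      rw [nxt_p]
      omega
    · rcases cases_of hu with rfl | ⟨h, hor⟩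
      · rw [nxt_f]
        omega
      · have := hK.gap u hu.1 f hfK
        rcases hv with rfl | hv
        · omega
        · exact h ▸ hK.gap u hu.1 v hv.1 huv

end IsChain

lemma card_insert_filter_add_le :
    (insert l (K.filter fun u => ¬ (f < u ∧ u < l))).card + (K.filter fun u => f ≤ u ∧ u < l).card
      ≤ K.card + 2 := by
  have hnew := Finset.card_insert_le l (K.filter fun u => ¬ (f < u ∧ u < l))
  have hsplit := K.card_filter_add_card_filter_not fun u => f < u ∧ u < l
  have hsub : (K.filter fun u => f ≤ u ∧ u < l) ⊆
      insert f (K.filter fun u => f < u ∧ u < l) := by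
    intro u
    simp only [Finset.mem_filter, Finset.mem_insert]
    rintro ⟨hu, hfu, hul⟩
    exact hfu.eq_or_lt.imp Eq.symm fun h => ⟨hu, h, hul⟩
  have hold := (Finset.card_le_card hsub).trans (Finset.card_insert_le _ _)
  omega

end Windows

namespace Ranked

variable {n : ℕ} (I : Ranked n)

/-- The lower rank of the segment of endpoint `e`. -/
def lo (e : ℕ) : ℕ := min (I.Y e) (I.Y (partner n e))

/-- The higher rank of the segment of endpoint `e`. -/
def hi (e : ℕ) : ℕ := max (I.Y e) (I.Y (partner n e))

/-- The `y`-intervals of the segments whose two endpoints have `x`-ranks in `W`. -/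
def spans (W : Set ℕ) : Set (ℕ × ℕ) :=
  {p | ∃ e < n + n, I.X e ∈ W ∧ I.X (partner n e) ∈ W ∧ (I.lo e, I.hi e) = p}

/-- The table `up` gives the upper end of the segment with a given lower end, and `2n + 1` at
`2n + 1`. -/
structure IsUpper (up : ℕ → ℕ) : Prop where
  last : up (n + n + 1) = n + n + 1
  lo : ∀ e < n + n, up (I.lo e) = I.hi e

variable {I} {A b e f r u v : ℕ} {V W : Set ℕ}

lemma lo_partner (he : e < n + n) : I.lo (partner n e) = I.lo e := by
  rw [lo, lo, partner_partner he, min_comm]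

lemma hi_partner (he : e < n + n) : I.hi (partner n e) = I.hi e := by
  rw [hi, hi, partner_partner he, max_comm]

lemma lo_pos (he : e < n + n) : 1 ≤ I.lo e :=
  le_min (I.y_spec e he).1 (I.y_spec _ (partner_lt he)).1

lemma hi_le (he : e < n + n) : I.hi e ≤ n + n :=
  max_le (I.y_spec e he).2.1 (I.y_spec _ (partner_lt he)).2.1

lemma lo_lt_hi (he : e < n + n) : I.lo e < I.hi e :=
  min_lt_max.mpr fun h => partner_ne he (I.y_inj he (partner_lt he) h).symm

lemma eq_or_eq_partner_of_hi_eq (he : e < n + n) (hf : f < n + n) (h : I.hi e = I.hi f) :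
    f = e ∨ f = partner n e := by
  have inj {i j : ℕ} (hi : i < n + n) (hj : j < n + n) : I.Y i = I.Y j → i = j := I.y_inj hi hj
  have he' := partner_lt he
  have hf' := partner_lt hf
  unfold hi at h
  rcases max_choice (I.Y e) (I.Y (partner n e)) with h1 | h1 <;>
    rcases max_choice (I.Y f) (I.Y (partner n f)) with h2 | h2 <;> rw [h1, h2] at h
  · exact .inl (inj he hf h).symm
  · exact .inr (by rw [inj he hf' h, partner_partner hf])
  · exact .inr (inj he' hf h).symm
  · exact .inl (by rw [← partner_partner he, inj he' hf' h, partner_partner hf])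

lemma isFreeWindow_spans_iff :
    IsFreeWindow (I.spans (Set.Ioo A b)) u v ↔ I.IsFree ⟨A, b - 1, u, v - 1⟩ := by
  constructor
  · intro h e he hb
    simp only [InBox] at hb
    exact h _ ⟨e, he, ⟨by omega, by omega⟩, ⟨by omega, by omega⟩, rfl⟩
      ⟨by simp only [lo]; omega, by simp only [hi]; omega⟩
  · rintro h _ ⟨e, he, h1, h2, rfl⟩ hb
    simp only [lo, hi, Set.mem_Ioo] at h1 h2 hb
    exact h e he (by simp only [InBox]; omega)

lemma isIntervalFamily_spans {up : ℕ → ℕ} (hup : I.IsUpper up) :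
    IsIntervalFamily (n + n + 1) up (I.spans W) where
  pos := by rintro _ ⟨e, he, -, -, rfl⟩; exact lo_pos he
  lt := by rintro _ ⟨e, he, -, -, rfl⟩; exact lo_lt_hi he
  snd_lt := by rintro _ ⟨e, he, -, -, rfl⟩; exact Nat.lt_succ_of_le (hi_le he)
  up_fst := by rintro _ ⟨e, he, -, -, rfl⟩; exact hup.lo e he
  snd_inj := by
    rintro _ ⟨e, he, -, -, rfl⟩ _ ⟨f, hf, -, -, rfl⟩ h
    rcases eq_or_eq_partner_of_hi_eq he hf h with rfl | rfl
    · rfl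
    · rw [lo_partner he, hi_partner he]
  up_last := hup.last

lemma spans_mono (h : V ⊆ W) : I.spans V ⊆ I.spans W := by
  rintro p ⟨e, he, h1, h2, rfl⟩
  exact ⟨e, he, h h1, h h2, rfl⟩

lemma spans_eq_empty (h : W.Subsingleton) : I.spans W = ∅ := by
  rw [Set.eq_empty_iff_forall_notMem]
  rintro p ⟨e, he, h1, h2, -⟩
  exact partner_ne he (I.x_inj (partner_lt he) he (h h2 h1))

lemma notMem_spans (he : e < n + n) (hW : I.X e ∉ W) : (I.lo e, I.hi e) ∉ I.spans W := by
  rintro ⟨f, hf, h1, h2, h⟩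
  rcases eq_or_eq_partner_of_hi_eq hf he (congrArg Prod.snd h) with rfl | rfl
  · exact hW h1
  · exact hW h2

lemma spans_insert (he : e < n + n) (hX : I.X e = r) (hW : I.X (partner n e) ∈ W) :
    I.spans (insert r W) = insert (I.lo e, I.hi e) (I.spans W) := by
  refine Set.Subset.antisymm ?_ (Set.insert_subset
    ⟨e, he, .inl hX, .inr hW, rfl⟩ (spans_mono (Set.subset_insert r W)))
  rintro p ⟨f, hf, h1 | h1, h2, rfl⟩
  · exact .inl (by rw [I.x_inj hf he (h1.trans hX.symm)])
  rcases h2 with h2 | h2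
  · rw [← I.x_inj (partner_lt hf) he (h2.trans hX.symm), lo_partner hf, hi_partner hf]
    exact .inl rfl
  · exact .inr ⟨f, hf, h1, h2, rfl⟩

lemma spans_insert_of_notMem (he : e < n + n) (hX : I.X e = r) (hW : I.X (partner n e) ∉ W) :
    I.spans (insert r W) = I.spans W := by
  have hpr : I.X (partner n e) ∉ insert r W := by
    rintro (h | h)
    · exact partner_ne he (I.x_inj (partner_lt he) he (h.trans hX.symm))
    · exact hW h
  refine Set.Subset.antisymm ?_ (spans_mono (Set.subset_insert r W))
  rintro p ⟨f, hf, h1, h2, rfl⟩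
  refine ⟨f, hf, h1.resolve_left fun h => ?_, h2.resolve_left fun h => ?_, rfl⟩
  · exact hpr (I.x_inj hf he (h.trans hX.symm) ▸ h2)
  · rw [← I.x_inj (partner_lt hf) he (h.trans hX.symm), partner_partner hf] at hpr
    exact hpr h1

lemma spans_Ioo_succ (he : e < n + n) (hX : I.X e = b) (hA : A < I.X (partner n e))
    (hb : I.X (partner n e) < b) :
    I.spans (Set.Ioo A (b + 1)) = insert (I.lo e, I.hi e) (I.spans (Set.Ioo A b)) := by
  have hIoo : Set.Ioo A (b + 1) = insert b (Set.Ioo A b) := by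
    ext
    simp only [Set.mem_Ioo, Set.mem_insert_iff]
    omega
  rw [hIoo, spans_insert he hX (Set.mem_Ioo.mpr ⟨hA, hb⟩)]

lemma spans_Ioo_succ_of_notMem (he : e < n + n) (hX : I.X e = b)
    (hp : I.X (partner n e) ∉ Set.Ioo A b) :
    I.spans (Set.Ioo A (b + 1)) = I.spans (Set.Ioo A b) := by
  by_cases hAb : A < b
  · have hIoo : Set.Ioo A (b + 1) = insert b (Set.Ioo A b) := by
      ext
      simp only [Set.mem_Ioo, Set.mem_insert_iff]
      omega
    rw [hIoo, spans_insert_of_notMem he hX hp]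
  · rw [spans_eq_empty, spans_eq_empty] <;> intro i hi <;> simp only [Set.mem_Ioo] at hi <;> omega

lemma Ioo_eq_insert_of_lt (hAb : A + 1 < b) : Set.Ioo A b = insert (A + 1) (Set.Ioo (A + 1) b) := by
  ext
  simp only [Set.mem_Ioo, Set.mem_insert_iff]
  omega

lemma spans_Ioo_of_succ (he : e < n + n) (hX : I.X (partner n e) = A + 1) (hA : A + 1 < I.X e)
    (hb : I.X e < b) :
    I.spans (Set.Ioo A b) = insert (I.lo e, I.hi e) (I.spans (Set.Ioo (A + 1) b)) := by
  rw [Ioo_eq_insert_of_lt (hA.trans hb), spans_insert (partner_lt he) hX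
    (by rw [partner_partner he]; exact ⟨hA, hb⟩), lo_partner he, hi_partner he]

lemma spans_Ioo_of_succ_of_notMem (he : e < n + n) (hX : I.X (partner n e) = A + 1)
    (hp : I.X e ∉ Set.Ioo (A + 1) b) :
    I.spans (Set.Ioo A b) = I.spans (Set.Ioo (A + 1) b) := by
  by_cases hAb : A + 1 < b
  · rw [Ioo_eq_insert_of_lt hAb, spans_insert_of_notMem (partner_lt he) hX
      (by rwa [partner_partner he])]
  · rw [spans_eq_empty, spans_eq_empty] <;> intro i hi j hj <;>
      simp only [Set.mem_Ioo] at hi hj <;> omega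

end Ranked

local infixr:30 ";;" => Program.seq

section Logic

variable {m : ℕ} (P : Fin m → Point) (B : ℕ)

/-- Total correctness with a time bound: started in `s`, the program `c` halts within time `T`, in
a state that satisfies `Q`. -/
def Runs (c : Program) (s : State) (T : ℕ) (Q : State → Prop) : Prop :=
  ∃ s₁ t, Exec P B c s s₁ t ∧ t ≤ T ∧ Q s₁

/-- The expression `e` can be evaluated in the state `s`, with value `v`. -/
def Val (s : State) (e : Expr) (v : ℕ) : Prop := e.Fits B s ∧ e.eval s = v

/-- The test `p` can be evaluated in the state `s`, and expresses `R`. -/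
def Tests (s : State) (p : Test) (R : Prop) : Prop := p.Fits B s ∧ (p.Holds P s ↔ R)

variable {P B} {c d : Program} {s : State} {T T' T₁ T₂ : ℕ} {Q Q' : State → Prop}
  {e f : Expr} {v w : ℕ} {p q : Test} {R R' : Prop}

lemma Val.const (h : v ≤ B) : Val B s (.const v) v := ⟨h, rfl⟩

lemma Val.reg {x : ℕ} (h : s.reg x = v) (hv : v ≤ B) : Val B s (.reg x) v := ⟨h.le.trans hv, h⟩

lemma Val.cell {a : ℕ} (he : Val B s e v) (h : s.arr a v = w) (hw : w ≤ B) :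
    Val B s (.cell a e) w := by
  obtain ⟨h1, rfl⟩ := he
  exact ⟨⟨h1, h.le.trans hw⟩, h⟩

lemma Val.add (he : Val B s e v) (hf : Val B s f w) (h : v + w ≤ B) :
    Val B s (.add e f) (v + w) := by
  obtain ⟨h1, rfl⟩ := he
  obtain ⟨h2, rfl⟩ := hf
  exact ⟨⟨h1, h2, h⟩, rfl⟩

lemma Val.sub (he : Val B s e v) (hf : Val B s f w) : Val B s (.sub e f) (v - w) := by
  obtain ⟨h1, rfl⟩ := he
  obtain ⟨h2, rfl⟩ := hf
  exact ⟨⟨h1, h2⟩, rfl⟩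

lemma Val.mul (he : Val B s e v) (hf : Val B s f w) (h : v * w ≤ B) :
    Val B s (.mul e f) (v * w) := by
  obtain ⟨h1, rfl⟩ := he
  obtain ⟨h2, rfl⟩ := hf
  exact ⟨⟨h1, h2, h⟩, rfl⟩

lemma Val.div (he : Val B s e v) (hf : Val B s f w) : Val B s (.div e f) (v / w) := by
  obtain ⟨h1, rfl⟩ := he
  obtain ⟨h2, rfl⟩ := hf
  exact ⟨⟨h1, h2⟩, rfl⟩

lemma Tests.eq (he : Val B s e v) (hf : Val B s f w) : Tests P B s (.eq e f) (v = w) := by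
  obtain ⟨h1, rfl⟩ := he
  obtain ⟨h2, rfl⟩ := hf
  exact ⟨⟨h1, h2⟩, Iff.rfl⟩

lemma Tests.lt (he : Val B s e v) (hf : Val B s f w) : Tests P B s (.lt e f) (v < w) := by
  obtain ⟨h1, rfl⟩ := he
  obtain ⟨h2, rfl⟩ := hf
  exact ⟨⟨h1, h2⟩, Iff.rfl⟩

lemma Tests.xlt {i j : Fin m} (he : Val B s e i) (hf : Val B s f j) :
    Tests P B s (.xlt e f) ((P i).1 < (P j).1) := by
  refine ⟨⟨he.1, hf.1⟩, fun ⟨i', j', hi, hj, h⟩ => ?_, fun h =>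
    ⟨i, j, he.2.symm, hf.2.symm, h⟩⟩
  rwa [Fin.ext (hi.trans he.2), Fin.ext (hj.trans hf.2)] at h

lemma Tests.ylt {i j : Fin m} (he : Val B s e i) (hf : Val B s f j) :
    Tests P B s (.ylt e f) ((P i).2 < (P j).2) := by
  refine ⟨⟨he.1, hf.1⟩, fun ⟨i', j', hi, hj, h⟩ => ?_, fun h =>
    ⟨i, j, he.2.symm, hf.2.symm, h⟩⟩
  rwa [Fin.ext (hi.trans he.2), Fin.ext (hj.trans hf.2)] at h

lemma Tests.not (h : Tests P B s p R) : Tests P B s (.not p) (¬ R) := ⟨h.1, not_congr h.2⟩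

lemma Tests.and (h : Tests P B s p R) (h' : Tests P B s q R') :
    Tests P B s (.and p q) (R ∧ R') :=
  ⟨⟨h.1, h'.1⟩, and_congr h.2 h'.2⟩

lemma Tests.or (h : Tests P B s p R) (h' : Tests P B s q R') : Tests P B s (.or p q) (R ∨ R') :=
  ⟨⟨h.1, h'.1⟩, or_congr h.2 h'.2⟩

lemma Runs.mono (h : Runs P B c s T Q) (hT : T ≤ T') (hQ : ∀ s', Q s' → Q' s') :
    Runs P B c s T' Q' :=
  let ⟨s', t, hc, ht, hs'⟩ := h
  ⟨s', t, hc, ht.trans hT, hQ s' hs'⟩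

lemma Runs.of_le (h : Runs P B c s T Q) (hT : T ≤ T') : Runs P B c s T' Q := h.mono hT fun _ => id

lemma Runs.imp (h : Runs P B c s T Q) (hQ : ∀ s', Q s' → Q' s') : Runs P B c s T Q' :=
  h.mono le_rfl hQ

lemma runs_skip (h : Q s) : Runs P B .skip s 1 Q := ⟨s, 1, .skip s, le_rfl, h⟩

lemma Val.runs_assign {x : ℕ} (he : Val B s e v) (h : Q (s.setReg x v)) :
    Runs P B (.assign x e) s (e.cost + 1) Q := by
  obtain ⟨h1, rfl⟩ := he
  exact ⟨_, _, .assign s x e h1, le_rfl, h⟩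

lemma Val.runs_store {a : ℕ} (he : Val B s e v) (hf : Val B s f w) (h : Q (s.setArr a v w)) :
    Runs P B (.store a e f) s (e.cost + f.cost + 1) Q := by
  obtain ⟨h1, rfl⟩ := he
  obtain ⟨h2, rfl⟩ := hf
  exact ⟨_, _, .store s a e f h1 h2, le_rfl, h⟩

lemma runs_report {e₁ e₂ e₃ e₄ : Expr} {v₁ v₂ v₃ v₄ : ℕ} (h₁ : Val B s e₁ v₁)
    (h₂ : Val B s e₂ v₂) (h₃ : Val B s e₃ v₃) (h₄ : Val B s e₄ v₄)
    (h : Q (s.report v₁ v₂ v₃ v₄)) :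
    Runs P B (.report e₁ e₂ e₃ e₄) s (e₁.cost + e₂.cost + e₃.cost + e₄.cost + 1) Q := by
  obtain ⟨h₁, rfl⟩ := h₁
  obtain ⟨h₂, rfl⟩ := h₂
  obtain ⟨h₃, rfl⟩ := h₃
  obtain ⟨h₄, rfl⟩ := h₄
  exact ⟨_, _, .report s e₁ e₂ e₃ e₄ h₁ h₂ h₃ h₄, le_rfl, h⟩

lemma runs_seq (h : Runs P B c s T₁ fun s₁ => Runs P B d s₁ T₂ Q) :
    Runs P B (c ;; d) s (T₁ + T₂) Q :=
  let ⟨s₁, t₁, hc, ht₁, s₂, t₂, hd, ht₂, hQ⟩ := h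
  ⟨s₂, t₁ + t₂, .seq c d s s₁ s₂ t₁ t₂ hc hd, Nat.add_le_add ht₁ ht₂, hQ⟩

lemma Val.runs_assign_seq {x : ℕ} (he : Val B s e v) (h : Runs P B d (s.setReg x v) T Q) :
    Runs P B (.assign x e ;; d) s (e.cost + 1 + T) Q :=
  runs_seq (he.runs_assign h)

lemma Val.runs_store_seq {a : ℕ} (he : Val B s e v) (hf : Val B s f w)
    (h : Runs P B d (s.setArr a v w) T Q) :
    Runs P B (.store a e f ;; d) s (e.cost + f.cost + 1 + T) Q :=
  runs_seq (he.runs_store hf h)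

lemma Tests.runs_cond (h : Tests P B s p R) (hc : R → Runs P B c s T₁ Q)
    (hd : ¬ R → Runs P B d s T₂ Q) : Runs P B (.cond p c d) s (p.cost + max T₁ T₂) Q := by
  by_cases hR : R
  · obtain ⟨s', t, hc, ht, hQ⟩ := hc hR
    exact ⟨s', _, .cond_true p c d s s' t h.1 (h.2.mpr hR) hc, by omega, hQ⟩
  · obtain ⟨s', t, hd, ht, hQ⟩ := hd hR
    exact ⟨s', _, .cond_false p c d s s' t h.1 (mt h.2.mp hR) hd, by omega, hQ⟩

/-- The number `φ` is the time that is left. -/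
lemma runs_loop (Inv : ℕ → State → Prop) (hp : 0 < p.cost)
    (h : ∀ φ s, Inv φ s → ∃ R, Tests P B s p R ∧ p.cost ≤ φ ∧ (¬ R → Q s) ∧
      (R → ∃ T, Runs P B c s T fun s' => ∃ φ', Inv φ' s' ∧ p.cost + T + φ' ≤ φ)) {φ : ℕ}
    (hs : Inv φ s) : Runs P B (.loop p c) s φ Q := by
  induction φ using Nat.strong_induction_on generalizing s with
  | _ φ ih =>
    obtain ⟨R, hT, hφ, hn, hy⟩ := h φ s hs
    by_cases hR : R
    · obtain ⟨T, s₁, t₁, hc, ht₁, φ', hInv, hφ'⟩ := hy hR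
      obtain ⟨s₂, t₂, hl, ht₂, hQ⟩ := ih φ' (by omega) hInv
      exact ⟨s₂, _, .loop_true p c s s₁ s₂ t₁ t₂ hT.1 (hT.2.mpr hR) hc hl, by omega, hQ⟩
    · exact ⟨s, _, .loop_false p c s hT.1 (mt hT.2.mp hR), hφ, hn hR⟩

end Logic

section States

variable (s : State) (x y v a i b : ℕ)

@[simp] lemma setReg_reg : (s.setReg x v).reg y = if y = x then v else s.reg y :=
  Function.update_apply ..

@[simp] lemma setReg_arr : (s.setReg x v).arr = s.arr := rfl

@[simp] lemma setArr_reg : (s.setArr a i v).reg = s.reg := rfl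

@[simp] lemma setArr_arr :
    (s.setArr a i v).arr b = if b = a then Function.update (s.arr a) i v else s.arr b :=
  Function.update_apply ..

end States

section Loops

variable {m : ℕ} {P : Fin m → Point} {B : ℕ}

/-- Repeat `c`, counting register `x` upwards as long as it is less than register `y`. -/
def countUp (x y : ℕ) (c : Program) : Program :=
  .loop (.lt (.reg x) (.reg y)) (c ;; .assign x (.add (.reg x) (.const 1)))

/-- The number `φ` is the time that is left for the loop body. -/
lemma runs_countUp {x y : ℕ} {c : Program} {L : ℕ} (hL : L ≤ B) (hB : 1 ≤ B)
    (Inv : ℕ → ℕ → State → Prop)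
    (hI : ∀ i φ s, Inv i φ s → s.reg x = i ∧ s.reg y = L)
    (h : ∀ i φ s, i < L → Inv i φ s → ∃ T, Runs P B c s T fun s' => s'.reg x = i ∧
      ∃ φ', T + φ' ≤ φ ∧ Inv (i + 1) φ' (s'.setReg x (i + 1)))
    {i φ : ℕ} {s : State} (hi : i ≤ L) (hs : Inv i φ s) :
    Runs P B (countUp x y c) s (φ + 7 * (L - i) + 3) fun s' => ∃ φ', Inv L φ' s' := by
  refine runs_loop (fun ψ s => ∃ i φ, i ≤ L ∧ Inv i φ s ∧ ψ = φ + 7 * (L - i) + 3)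
    (by simp [Test.cost]) ?_ ⟨i, φ, hi, hs, rfl⟩
  rintro ψ s ⟨i, φ, hi, hs, rfl⟩
  obtain ⟨hx, hy⟩ := hI i φ s hs
  refine ⟨i < L, .lt (.reg hx (by omega)) (.reg hy hL), by simp [Test.cost, Expr.cost],
    fun hn => ⟨φ, (hi.antisymm (not_lt.mp hn)) ▸ hs⟩, fun hlt => ?_⟩
  obtain ⟨T, hT⟩ := h i φ s hlt hs
  refine ⟨T + 4, runs_seq (T₂ := 4) (hT.imp ?_)⟩
  rintro s' ⟨hx', φ', hφ, hI'⟩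
  refine ((Val.reg hx' (by omega)).add (.const hB) (by omega)).runs_assign
    ⟨_, ⟨i + 1, φ', hlt, hI', rfl⟩, ?_⟩
  simp only [Test.cost, Expr.cost]
  omega

lemma runs_countUp_const {x y : ℕ} {c : Program} {L : ℕ} (hL : L ≤ B) (hB : 1 ≤ B) (T : ℕ)
    (Inv : ℕ → State → Prop) (hI : ∀ i s, Inv i s → s.reg x = i ∧ s.reg y = L)
    (h : ∀ i s, i < L → Inv i s → Runs P B c s T fun s' => s'.reg x = i ∧
      Inv (i + 1) (s'.setReg x (i + 1)))
    {i : ℕ} {s : State} (hi : i ≤ L) (hs : Inv i s) :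
    Runs P B (countUp x y c) s ((T + 7) * (L - i) + 3) (Inv L) := by
  refine (runs_countUp hL hB (fun i φ s => Inv i s ∧ φ = T * (L - i))
    (fun i φ s h => hI i s h.1) ?_ hi ⟨hs, rfl⟩).mono (by rw [Nat.add_mul]) fun s' ⟨_, h⟩ => h.1
  rintro i φ s hlt ⟨hs, rfl⟩
  refine ⟨T, (h i s hlt hs).imp fun s' h' => ⟨h'.1, T * (L - (i + 1)), ?_, h'.2, rfl⟩⟩
  rw [show L - i = L - (i + 1) + 1 by omega, Nat.mul_succ]
  omega

end Loops

local notation "rSegments" => (0 : ℕ)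
local notation "rSize" => (1 : ℕ)
local notation "rWidth" => (2 : ℕ)
local notation "rKey" => (3 : ℕ)
local notation "rOther" => (4 : ℕ)
local notation "rCount" => (5 : ℕ)
local notation "rLeft" => (3 : ℕ)
local notation "rRight" => (4 : ℕ)
local notation "rPoint" => (5 : ℕ)
local notation "rStart" => (6 : ℕ)
local notation "rBottom" => (7 : ℕ)
local notation "rStop" => (8 : ℕ)
local notation "rTop" => (9 : ℕ)
local notation "rBoxRight" => (10 : ℕ)
local notation "rBoxBottom" => (11 : ℕ)
local notation "rBoxTop" => (12 : ℕ)
local notation "rLow" => (13 : ℕ)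
local notation "rHigh" => (14 : ℕ)
local notation "rMid" => (15 : ℕ)
local notation "aXLt" => (0 : ℕ)
local notation "aXLe" => (1 : ℕ)
local notation "aX" => (2 : ℕ)
local notation "aPX" => (3 : ℕ)
local notation "aYLt" => (4 : ℕ)
local notation "aYLe" => (5 : ℕ)
local notation "aY" => (6 : ℕ)
local notation "aPY" => (7 : ℕ)
local notation "aPartner" => (8 : ℕ)
local notation "aLo" => (9 : ℕ)
local notation "aHi" => (10 : ℕ)
local notation "aUp" => (11 : ℕ)
local notation "aCount" => (12 : ℕ)
local notation "aStart" => (13 : ℕ)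
local notation "aNext" => (14 : ℕ)
local notation "aMark" => (15 : ℕ)

section Bisection

/-- The states `s` and `s'` differ at most in the registers from number `k` on. -/
structure Keeps (k : ℕ) (s s' : State) : Prop where
  arr : s'.arr = s.arr
  out : s'.out = s.out
  reg : ∀ x < k, s'.reg x = s.reg x

lemma Keeps.refl (k : ℕ) (s : State) : Keeps k s s := ⟨rfl, rfl, fun _ _ => rfl⟩

lemma Keeps.setReg {k x : ℕ} {s s' : State} (h : Keeps k s s') (hx : k ≤ x) (v : ℕ) :
    Keeps k s (s'.setReg x v) :=
  ⟨h.arr, h.out, fun y hy => by simp [h.reg y hy, show y ≠ x by omega]⟩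

lemma Keeps.trans {j k : ℕ} {s s' s'' : State} (h : Keeps j s s') (h' : Keeps k s' s'')
    (hjk : j ≤ k) : Keeps j s s'' :=
  ⟨h'.arr.trans h.arr, h'.out.trans h.out,
    fun x hx => (h'.reg x (by omega)).trans (h.reg x hx)⟩

/-- Bisection: between the values of the registers `x` and `y`, find two consecutive numbers such
that the test `p`, which reads its argument from the register `rMid`, fails for the first and
holds for the second. -/
def bisect (x y : ℕ) (p : Test) : Program :=
  .assign rLow (.reg x) ;; .assign rHigh (.reg y) ;;
  .loop (.lt (.add (.const 1) (.reg rLow)) (.reg rHigh))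
    (.assign rMid (.div (.add (.reg rLow) (.reg rHigh)) (.const 2)) ;;
     .cond p (.assign rHigh (.reg rMid)) (.assign rLow (.reg rMid)))

/-- The invariant of the bisection between `u` and `v` that was started in the state `s`. -/
structure Bisecting (V : ℕ → Prop) (u v : ℕ) (s : State) (i j : ℕ) (s' : State) : Prop where
  keeps : Keeps rLow s s'
  low : s'.reg rLow = i
  high : s'.reg rHigh = j
  start_le : u ≤ i
  lt : i < j
  le_end : j ≤ v
  not_low : ¬ V i
  of_high : V j

variable {m : ℕ} {P : Fin m → Point} {B : ℕ} {p : Test} {s : State} {V : ℕ → Prop} {u v : ℕ}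

lemma clog_two_add_one_le {g g' : ℕ} (hg : 2 ≤ g) (hg' : 2 * g' ≤ g + 1) :
    Nat.clog 2 g' + 1 ≤ Nat.clog 2 g := by
  rw [Nat.clog_of_two_le one_lt_two hg]
  exact Nat.succ_le_succ (Nat.clog_mono_right 2 (by omega))

lemma runs_bisect_step (hB : 2 ≤ B) (hvB : 2 * v ≤ B)
    (hp : ∀ s', Keeps rLow s s' → u ≤ s'.reg rMid → s'.reg rMid ≤ v →
      Tests P B s' p (V (s'.reg rMid)))
    {i j : ℕ} {s' : State} (h : Bisecting V u v s i j s') (hij : 1 + i < j) :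
    Runs P B (.assign rMid (.div (.add (.reg rLow) (.reg rHigh)) (.const 2)) ;;
      .cond p (.assign rHigh (.reg rMid)) (.assign rLow (.reg rMid))) s' (p.cost + 8) fun s'' =>
      ∃ i' j', Bisecting V u v s i' j' s'' ∧ 2 * (j' - i') ≤ j - i + 1 := by
  obtain ⟨hk, hi, hj, hui, -, hjv, hVi, hVj⟩ := h
  set k := (i + j) / 2
  have hk₁ : Keeps rLow s (s'.setReg rMid k) := hk.setReg (by omega) _
  have hmid : Val B (s'.setReg rMid k) (.reg rMid) k := .reg (by simp) (by omega)
  refine (Val.runs_assign_seq (((Val.reg hi (by omega)).add (.reg hj (by omega)) (by omega)).div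
    (.const hB)) ((hp _ hk₁ (by simp; omega) (by simp; omega)).runs_cond (T₁ := 2) (T₂ := 2)
      (fun hV => hmid.runs_assign ⟨i, k, ?_, by omega⟩)
      (fun hV => hmid.runs_assign ⟨k, j, ?_, by omega⟩))).of_le
    (by simp only [Expr.cost]; omega)
  · exact ⟨hk₁.setReg (by omega) _, by simp [hi], by simp, hui, by omega, by omega, hVi,
      by simpa using hV⟩
  · exact ⟨hk₁.setReg (by omega) _, by simp, by simp [hj], by omega, by omega, hjv,
      by simpa using hV, hVj⟩

lemma runs_bisect {x y M : ℕ} (hy : y < rLow) (hB : 2 ≤ B) (hu : s.reg x = u)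
    (hv : s.reg y = v) (hvB : 2 * v ≤ B) (hM : v ≤ M)
    (hp : ∀ s', Keeps rLow s s' → u ≤ s'.reg rMid → s'.reg rMid ≤ v →
      Tests P B s' p (V (s'.reg rMid)))
    (huv : u < v) (hVu : ¬ V u) (hVv : V v) :
    Runs P B (bisect x y p) s ((p.cost + 13) * Nat.clog 2 M + 9) fun s' =>
      ∃ k, Bisecting V u v s k (k + 1) s' := by
  refine (Val.runs_assign_seq (.reg hu (by omega)) (Val.runs_assign_seq (v := v)
    (.reg (by simp [hv, hy.ne]) (by omega)) (runs_loop (fun φ s' => ∃ i j,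
      Bisecting V u v s i j s' ∧ φ = (p.cost + 13) * Nat.clog 2 (j - i) + 5)
      (by simp [Test.cost]) ?_ ⟨u, v, ?_, rfl⟩))).of_le ?_
  · rintro φ s' ⟨i, j, h, rfl⟩
    have hjv := h.le_end
    have hij := h.lt
    refine ⟨1 + i < j, .lt (.add (.const (by omega)) (.reg h.low (by omega)) (by omega))
      (.reg h.high (by omega)), by simp [Test.cost, Expr.cost], fun hn => ⟨i, ?_⟩,
      fun hlt => ⟨_, (runs_bisect_step hB hvB hp h hlt).imp ?_⟩⟩
    · rwa [show i + 1 = j by omega]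
    · rintro s'' ⟨i', j', h', hgap⟩
      refine ⟨_, ⟨i', j', h', rfl⟩, ?_⟩
      have := Nat.mul_le_mul_left (p.cost + 13) (clog_two_add_one_le (by omega) hgap)
      rw [mul_add_one] at this
      simp only [Test.cost, Expr.cost]
      omega
  · exact ⟨((Keeps.refl _ s).setReg le_rfl _).setReg (by omega) _, by simp, by simp, le_rfl, huv,
      le_rfl, hVu, hVv⟩
  · have := Nat.mul_le_mul_left (p.cost + 13) (Nat.clog_mono_right 2 (show v - u ≤ M by omega))
    simp only [Expr.cost]
    omega

end Bisection

section PrefixCount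

namespace Ranked

variable {n : ℕ} (I : Ranked n)

/-- The number of endpoints with `x`-rank at most `A` and `y`-rank at most `C`; the number of
endpoints in a box is an alternating sum of four of these. -/
def prefixCount (A C : ℕ) : ℕ :=
  ((Finset.range (n + n)).filter fun e => I.X e ≤ A ∧ I.Y e ≤ C).card

variable {A B C D : ℕ}

lemma prefixCount_zero (C : ℕ) : I.prefixCount 0 C = 0 := by
  rw [prefixCount, Finset.card_eq_zero, Finset.filter_eq_empty_iff]
  intro e he
  have := I.x_spec e (Finset.mem_range.mp he)
  omega

lemma prefixCount_succ (hA : A < n + n) (C : ℕ) :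
    I.prefixCount (A + 1) C = I.prefixCount A C + if I.Y (I.PX (A + 1)) ≤ C then 1 else 0 := by
  obtain ⟨hlt, hX⟩ := I.px_spec (A + 1) (by omega) hA
  have hone : (if I.Y (I.PX (A + 1)) ≤ C then 1 else 0 : ℕ) =
      ∑ e ∈ Finset.range (n + n),
        (if e = I.PX (A + 1) then (if I.Y e ≤ C then 1 else 0) else 0 : ℕ) := by
    simp [hlt]
  simp only [prefixCount, Finset.card_filter]
  rw [hone, ← Finset.sum_add_distrib]
  refine Finset.sum_congr rfl fun e he => ?_
  have hiff : e = I.PX (A + 1) ↔ I.X e = A + 1 :=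
    ⟨fun h => h ▸ hX, fun h => I.x_inj (Finset.mem_range.mp he) hlt (h.trans hX.symm)⟩
  simp only [hiff]
  split_ifs <;> omega

lemma cnt_add_prefixCount (hAB : A ≤ B) (hCD : C ≤ D) :
    I.cnt ⟨A, B, C, D⟩ + (I.prefixCount A D + I.prefixCount B C) =
      I.prefixCount B D + I.prefixCount A C := by
  simp only [cnt, inside, prefixCount, Finset.card_filter, ← Finset.sum_add_distrib]
  refine Finset.sum_congr rfl fun e _ => ?_
  simp only [InBox]
  grind

lemma prefixCount_le (A C : ℕ) : I.prefixCount A C ≤ n + n :=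
  (Finset.card_filter_le _ _).trans (Finset.card_range _).le

end Ranked

end PrefixCount

section Tables

variable {n : ℕ} (S : Fin n → Segment)

/-- Words can hold the indices of a square table whose indices run from `0` to `2n`. -/
structure WordBound (n B : ℕ) : Prop where
  pos : 1 ≤ n
  small : 4 * (n + n + 2) ≤ B
  square : (n + n + 2) * (n + n + 2) ≤ B

/-- The array `t` is correct as the table of number `a`. Square tables are stored row by row, with
rows of length `2n + 1`. -/
def IsTable (a : ℕ) (t : ℕ → ℕ) : Prop :=
  match a with
  | aXLt => ∀ e < n + n, t e = countLt (xkey S) (n + n) e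
  | aXLe => ∀ e < n + n, t e = countLe (xkey S) (n + n) e
  | aX => ∀ e < n + n, t e = (ranked S).X e
  | aPX => ∀ r, 1 ≤ r → r ≤ n + n → t r = (ranked S).PX r
  | aYLt => ∀ e < n + n, t e = countLt (ykey S) (n + n) e
  | aYLe => ∀ e < n + n, t e = countLe (ykey S) (n + n) e
  | aY => ∀ e < n + n, t e = (ranked S).Y e
  | aPY => ∀ r, 1 ≤ r → r ≤ n + n → t r = (ranked S).PY r
  | aPartner => ∀ e < n + n, t e = partner n e
  | aLo => ∀ e < n + n, t e = (ranked S).lo e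
  | aHi => ∀ e < n + n, t e = (ranked S).hi e
  | aUp => (ranked S).IsUpper t
  | aCount => ∀ A ≤ n + n, ∀ C ≤ n + n, t (A * (n + n + 1) + C) = (ranked S).prefixCount A C
  | _ => False

/-- The sizes and the tables with numbers below `k` have been computed. -/
structure Prepared (k : ℕ) (s : State) : Prop where
  segments : s.reg rSegments = n
  size : s.reg rSize = n + n
  width : s.reg rWidth = n + n + 1
  tables : ∀ a < k, IsTable S a (s.arr a)

/-- The preprocessing has been completed. -/
abbrev Ready (s : State) : Prop := Prepared S aStart s

variable {S} {B k : ℕ} {s s' : State}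

lemma Prepared.congr (h : Prepared S k s) (hr : ∀ x < rLeft, s'.reg x = s.reg x)
    (ha : ∀ a < k, s'.arr a = s.arr a) : Prepared S k s' :=
  ⟨(hr _ (by omega)).trans h.segments, (hr _ (by omega)).trans h.size,
    (hr _ (by omega)).trans h.width, fun a hak => ha a hak ▸ h.tables a hak⟩

lemma Prepared.setReg (h : Prepared S k s) {x : ℕ} (hx : rLeft ≤ x) (v : ℕ) :
    Prepared S k (s.setReg x v) :=
  h.congr (fun y hy => by simp [show y ≠ x by omega]) fun _ _ => rfl

lemma Prepared.setArr (h : Prepared S k s) {a : ℕ} (ha : k ≤ a) (i v : ℕ) :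
    Prepared S k (s.setArr a i v) :=
  h.congr (fun _ _ => rfl) fun b hb => by simp [show b ≠ a by omega]

lemma Keeps.prepared {j : ℕ} (h : Keeps j s s') (hj : rLeft ≤ j) (hs : Prepared S k s) :
    Prepared S k s' :=
  hs.congr (fun x hx => h.reg x (by omega)) fun a _ => by rw [h.arr]

lemma Ready.xlt (h : Ready S s) : ∀ e < n + n, s.arr aXLt e = countLt (xkey S) (n + n) e :=
  h.tables aXLt (by omega)

lemma Ready.xle (h : Ready S s) : ∀ e < n + n, s.arr aXLe e = countLe (xkey S) (n + n) e :=
  h.tables aXLe (by omega)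

lemma Ready.x (h : Ready S s) : ∀ e < n + n, s.arr aX e = (ranked S).X e :=
  h.tables aX (by omega)

lemma Ready.px (h : Ready S s) : ∀ r, 1 ≤ r → r ≤ n + n → s.arr aPX r = (ranked S).PX r :=
  h.tables aPX (by omega)

lemma Ready.ylt (h : Ready S s) : ∀ e < n + n, s.arr aYLt e = countLt (ykey S) (n + n) e :=
  h.tables aYLt (by omega)

lemma Ready.yle (h : Ready S s) : ∀ e < n + n, s.arr aYLe e = countLe (ykey S) (n + n) e :=
  h.tables aYLe (by omega)

lemma Ready.y (h : Ready S s) : ∀ e < n + n, s.arr aY e = (ranked S).Y e :=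
  h.tables aY (by omega)

lemma Ready.py (h : Ready S s) : ∀ r, 1 ≤ r → r ≤ n + n → s.arr aPY r = (ranked S).PY r :=
  h.tables aPY (by omega)

lemma Ready.partner (h : Ready S s) : ∀ e < n + n, s.arr aPartner e = partner n e :=
  h.tables aPartner (by omega)

lemma Ready.lo (h : Ready S s) : ∀ e < n + n, s.arr aLo e = (ranked S).lo e :=
  h.tables aLo (by omega)

lemma Ready.hi (h : Ready S s) : ∀ e < n + n, s.arr aHi e = (ranked S).hi e :=
  h.tables aHi (by omega)

lemma Ready.up (h : Ready S s) : (ranked S).IsUpper (s.arr aUp) :=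
  h.tables aUp (by omega)

lemma Ready.count (h : Ready S s) : ∀ A ≤ n + n, ∀ C ≤ n + n,
    s.arr aCount (A * (n + n + 1) + C) = (ranked S).prefixCount A C :=
  h.tables aCount (by omega)

lemma countLt_le (v : ℕ → ℝ) (N e : ℕ) : countLt v N e ≤ N := Nat.count_le _

lemma countLe_le (v : ℕ → ℝ) (N e : ℕ) : countLe v N e ≤ N := Nat.count_le _

/-- The index of the entry in row `a` and column `c` of a square table. -/
def idx (a c : Expr) : Expr := .add (.mul a (.reg rWidth)) c

lemma idx_le {N a c : ℕ} (ha : a ≤ N) (hc : c ≤ N) : a * (N + 1) + c ≤ (N + 2) * (N + 2) := by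
  nlinarith

lemma idx_inj {N a c a' c' : ℕ} (hc : c ≤ N) (hc' : c' ≤ N)
    (h : a * (N + 1) + c = a' * (N + 1) + c') : a = a' ∧ c = c' := by
  have hdiv : ∀ {a c : ℕ}, c ≤ N → (a * (N + 1) + c) / (N + 1) = a := fun {a c} hc => by
    rw [mul_comm, Nat.mul_add_div (by omega), Nat.div_eq_of_lt (by omega), add_zero]
  obtain rfl : a = a' := by rw [← hdiv (a := a) hc, h, hdiv hc']
  exact ⟨rfl, Nat.add_left_cancel h⟩

lemma Val.idx (hB : WordBound n B) (hw : s.reg rWidth = n + n + 1) {a c : Expr} {i j : ℕ}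
    (ha : Val B s a i) (hc : Val B s c j) (hi : i ≤ n + n) (hj : j ≤ n + n) :
    Val B s (idx a c) (i * (n + n + 1) + j) := by
  have hij := idx_le hi hj
  have hsq := hB.square
  have hsm := hB.small
  exact (ha.mul (.reg hw (by omega)) (by omega)).add hc (by omega)

/-- The number of endpoints in the box with the sides `a`, `b`, `c`, `d`. -/
def countExpr (a b c d : Expr) : Expr :=
  .sub (.add (.cell aCount (idx b d)) (.cell aCount (idx a c)))
    (.add (.cell aCount (idx a d)) (.cell aCount (idx b c)))

lemma Val.countExpr (hB : WordBound n B) (hs : Ready S s) {a b c d : Expr} {b' : Box}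
    (ha : Val B s a b'.left) (hb : Val B s b b'.right) (hc : Val B s c b'.bottom)
    (hd : Val B s d b'.top) (hab : b'.left ≤ b'.right) (hb' : b'.right ≤ n + n)
    (hcd : b'.bottom ≤ b'.top) (hd' : b'.top ≤ n + n) :
    Val B s (countExpr a b c d) ((ranked S).cnt b') := by
  have hsm := hB.small
  have hcell : ∀ {a c : Expr} {i k : ℕ}, Val B s a i → Val B s c k → i ≤ n + n → k ≤ n + n →
      Val B s (.cell aCount (Stab.idx a c)) ((ranked S).prefixCount i k) := fun ha hc hi hk =>
    (ha.idx hB hs.width hc hi hk).cell (hs.count _ hi _ hk)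
      (((ranked S).prefixCount_le _ _).trans (by omega))
  have hle := (ranked S).prefixCount_le
  have hle₁ := hle b'.right b'.top
  have hle₂ := hle b'.left b'.bottom
  have hle₃ := hle b'.left b'.top
  have hle₄ := hle b'.right b'.bottom
  rw [Nat.eq_sub_of_add_eq ((ranked S).cnt_add_prefixCount hab hcd)]
  exact ((hcell hb hd hb' hd').add (hcell ha hc (by omega) (by omega)) (by omega)).sub
    ((hcell ha hd (by omega) hd').add (hcell hb hc hb' (by omega)) (by omega))

end Tables

section Shrinking

namespace Ranked

variable {n : ℕ} {I : Ranked n} {b c w : Box}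

lemma exists_inBox_of_cnt_ne (h : I.cnt b ≠ I.cnt c) (hbc : b ≤ c) :
    ∃ e < n + n, I.InBox c e ∧ ¬ I.InBox b e := by
  by_contra! hall
  exact h (congrArg Finset.card (Finset.Subset.antisymm (inside_mono hbc) fun e he =>
    mem_inside.mpr ⟨(mem_inside.mp he).1, hall e (mem_inside.mp he).1 (mem_inside.mp he).2⟩))

lemma inBox_px_of_cnt_ne {A B C D : ℕ} (h : I.cnt ⟨A, B, C, D⟩ ≠ I.cnt ⟨A, B + 1, C, D⟩) :
    I.InBox ⟨A, B + 1, C, D⟩ (I.PX (B + 1)) := by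
  obtain ⟨e, he, hin, hout⟩ := exists_inBox_of_cnt_ne h ⟨le_rfl, B.le_succ, le_rfl, le_rfl⟩
  have hX : I.X e = B + 1 := by simp only [InBox] at hin hout; omega
  have hP := (I.x_spec e he).2.2
  rw [hX] at hP
  rwa [hP]

lemma inBox_py_bottom_of_cnt_ne {A B C D : ℕ}
    (h : I.cnt ⟨A, B, C + 1, D⟩ ≠ I.cnt ⟨A, B, C, D⟩) :
    I.InBox ⟨A, B, C, D⟩ (I.PY (C + 1)) := by
  obtain ⟨e, he, hin, hout⟩ := exists_inBox_of_cnt_ne h ⟨le_rfl, le_rfl, C.le_succ, le_rfl⟩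
  have hY : I.Y e = C + 1 := by simp only [InBox] at hin hout; omega
  have hP := (I.y_spec e he).2.2
  rw [hY] at hP
  rwa [hP]

lemma inBox_py_top_of_cnt_ne {A B C D : ℕ} (h : I.cnt ⟨A, B, C, D⟩ ≠ I.cnt ⟨A, B, C, D + 1⟩) :
    I.InBox ⟨A, B, C, D + 1⟩ (I.PY (D + 1)) := by
  obtain ⟨e, he, hin, hout⟩ := exists_inBox_of_cnt_ne h ⟨le_rfl, le_rfl, le_rfl, D.le_succ⟩
  have hY : I.Y e = D + 1 := by simp only [InBox] at hin hout; omega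
  have hP := (I.y_spec e he).2.2
  rw [hY] at hP
  rwa [hP]

lemma IsTight.eq_of_le_of_le (hb : I.IsTight b) (hc : I.IsTight c) (hbw : b ≤ w) (hcw : c ≤ w)
    (hw : I.cnt w = n) : b = c :=
  hb.eq_of_inBox_iff hc fun _ he =>
    (inBox_iff_of_cnt_eq hbw (hb.cnt_eq.trans hw.symm) he).trans
      (inBox_iff_of_cnt_eq hcw (hc.cnt_eq.trans hw.symm) he).symm

lemma IsFree.isTight_shrink (hw : I.IsFree w) (hcnt : I.cnt w = n) (hright : w.right ≤ n + n)
    (htop : w.top ≤ n + n) (hleft : I.InBox w (I.PX (w.left + 1))) {B C D : ℕ}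
    (hAB : w.left ≤ B) (hB : B + 1 ≤ w.right) (hC : w.bottom ≤ C) (hCD : C ≤ D)
    (hD : D + 1 ≤ w.top) (hBout : I.cnt ⟨w.left, B, w.bottom, w.top⟩ ≠ n)
    (hCin : I.cnt ⟨w.left, B + 1, C, w.top⟩ = n)
    (hCout : I.cnt ⟨w.left, B + 1, C + 1, w.top⟩ ≠ n)
    (hDin : I.cnt ⟨w.left, B + 1, C, D + 1⟩ = n) (hDout : I.cnt ⟨w.left, B + 1, C, D⟩ ≠ n) :
    I.IsTight ⟨w.left, B + 1, C, D + 1⟩ := by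
  have hle : (⟨w.left, B + 1, C, D + 1⟩ : Box) ≤ w := ⟨le_rfl, hB, hC, hD⟩
  have hshrunk (c : Box) (hc : ⟨w.left, B + 1, C, D + 1⟩ ≤ c) (hcw : c ≤ w) {e : ℕ}
      (he : e < n + n) : I.InBox ⟨w.left, B + 1, C, D + 1⟩ e ↔ I.InBox c e :=
    inBox_iff_of_cnt_eq hc (((cnt_mono hc).antisymm ((cnt_mono hcw).trans_eq
      (hcnt.trans hDin.symm)))) he
  have hPX := I.px_spec (B + 1) (by omega) (by omega)
  have hPY := I.py_spec (C + 1) (by omega) (by omega)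
  have hPL := I.px_spec (w.left + 1) (by omega) (by omega)
  have hBw : (⟨w.left, B + 1, w.bottom, w.top⟩ : Box) ≤ w := ⟨le_rfl, hB, le_rfl, le_rfl⟩
  have hCB : (⟨w.left, B + 1, C, w.top⟩ : Box) ≤ ⟨w.left, B + 1, w.bottom, w.top⟩ :=
    ⟨le_rfl, le_rfl, hC, le_rfl⟩
  have hBin : I.cnt ⟨w.left, B + 1, w.bottom, w.top⟩ = n :=
    ((cnt_mono hBw).trans_eq hcnt).antisymm (hCin.ge.trans (cnt_mono hCB))
  exact
    { left_lt := by change w.left < n + n; omega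
      right_mem := ⟨Nat.le_add_left 1 B, hB.trans hright⟩
      bottom_lt := by change C < n + n; omega
      top_mem := ⟨Nat.le_add_left 1 D, hD.trans htop⟩
      isStabbing := isStabbing_iff.mpr ⟨hw.anti hle, hDin⟩
      left := (hshrunk w hle ⟨le_rfl, le_rfl, le_rfl, le_rfl⟩ hPL.1).mpr hleft
      right := (hshrunk ⟨w.left, B + 1, w.bottom, w.top⟩ ⟨le_rfl, le_rfl, hC, hD⟩ hBw hPX.1).mpr
        (inBox_px_of_cnt_ne (hBout.trans_eq hBin.symm))
      bottom := (hshrunk ⟨w.left, B + 1, C, w.top⟩ ⟨le_rfl, le_rfl, le_rfl, hD⟩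
        ⟨le_rfl, hB, hC, le_rfl⟩ hPY.1).mpr
        (inBox_py_bottom_of_cnt_ne (hCout.trans_eq hCin.symm))
      top := inBox_py_top_of_cnt_ne (hDout.trans_eq hDin.symm) }

end Ranked

end Shrinking

section Emit

variable {n : ℕ} (S : Fin n → Segment)

/-- The table of marks records that the box `b` has been found. A mark is never erased: it is the
left side of its box, so that a mark made for another left side counts as absent. -/
def Marked (n : ℕ) (s : State) (b : Box) : Prop :=
  s.arr aMark (b.right * (n + n + 1) + b.bottom) = b.left + 1

/-- The realized boxes that have been reported are those to the right of `A`, and those with left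
side `A` that are marked. -/
structure Reported (A : ℕ) (s : State) : Prop where
  list : ∃ K : List Box, s.out = K.map (ranked S).quad ∧ K.Nodup ∧
    ∀ y, y ∈ K ↔ IsRealized S y ∧ (A < y.left ∨ y.left = A ∧ Marked n s y)
  marks : ∀ i, s.arr aMark i = 0 ∨ A + 1 ≤ s.arr aMark i ∧ s.arr aMark i ≤ n + n

/-- The state `s'` arises from `s` by finding boxes with left side `A`, and changing registers from
number `k` on. -/
structure Advances (A k : ℕ) (s s' : State) : Prop where
  reported : Reported S A s → Reported S A s'
  marked : ∀ b : Box, b.left = A → Marked n s b → Marked n s' b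
  reg : ∀ x < k, s'.reg x = s.reg x
  arr : ∀ a < aMark, s'.arr a = s.arr a

/-- Mark the box `b`. -/
def markBox (n : ℕ) (s : State) (b : Box) : State :=
  s.setArr aMark (b.right * (n + n + 1) + b.bottom) (b.left + 1)

/-- Append the box `b` to the output. -/
noncomputable def reportBox (s : State) (b : Box) : State :=
  s.report ((ranked S).PX (b.left + 1)) ((ranked S).PX b.right) ((ranked S).PY (b.bottom + 1))
    ((ranked S).PY b.top)

variable {S} {A j k : ℕ} {b y : Box} {s s' s'' : State}

lemma Reported.congr (h : Reported S A s) (harr : s'.arr aMark = s.arr aMark)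
    (hout : s'.out = s.out) : Reported S A s' where
  list := by simpa only [hout, Marked, harr] using h.list
  marks := by simpa only [harr] using h.marks

lemma Keeps.advances (h : Keeps k s s') : Advances S A k s s' where
  reg := h.reg
  arr a _ := by rw [h.arr]
  reported hr := hr.congr (by rw [h.arr]) h.out
  marked b _ hb := by rwa [Marked, h.arr]

lemma Advances.refl : Advances S A k s s := (Keeps.refl k s).advances

lemma Advances.trans (h : Advances S A j s s') (h' : Advances S A k s' s'') (hjk : j ≤ k) :
    Advances S A j s s'' where
  reg x hx := (h'.reg x (hx.trans_le hjk)).trans (h.reg x hx)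
  arr a ha := (h'.arr a ha).trans (h.arr a ha)
  reported hr := h'.reported (h.reported hr)
  marked b hb hm := h'.marked b hb (h.marked b hb hm)

lemma Advances.ready (h : Advances S A k s s') (hk : rLeft ≤ k) (hs : Ready S s) : Ready S s' :=
  hs.congr (fun x hx => h.reg x (by omega)) fun a ha => h.arr a (by omega)

lemma marked_markBox (h : Marked n s y) (hyb : y.left = b.left) : Marked n (markBox n s b) y := by
  simp only [Marked, markBox, setArr_arr, if_true, Function.update_apply] at h ⊢
  split_ifs <;> omega

lemma marked_markBox_iff (hb : (ranked S).IsTight b) (hy : (ranked S).IsTight y)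
    (hyb : y.left = b.left) : Marked n (markBox n s b) y ↔ Marked n s y ∨ y = b := by
  refine ⟨fun h => ?_, ?_⟩
  · simp only [Marked, markBox, setArr_arr, if_true, Function.update_apply] at h
    split_ifs at h with hi
    · have hsides := idx_inj hy.bottom_lt.le hb.bottom_lt.le hi
      exact .inr (hy.eq_of_three_sides hb hyb hsides.1 hsides.2)
    · exact .inl h
  · rintro (h | rfl)
    · exact marked_markBox h hyb
    · simp [Marked, markBox]

lemma Reported.marks_markBox (hr : Reported S b.left s) (hb : b.left < n + n) (i : ℕ) :
    (markBox n s b).arr aMark i = 0 ∨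
      b.left + 1 ≤ (markBox n s b).arr aMark i ∧ (markBox n s b).arr aMark i ≤ n + n := by
  have hi := hr.marks i
  simp only [markBox, setArr_arr, if_true, Function.update_apply]
  split_ifs <;> omega

lemma Reported.markBox (hr : Reported S b.left s) (hb : (ranked S).IsTight b)
    (hne : ¬ IsRealized S b) : Reported S b.left (markBox n s b) where
  list := by
    obtain ⟨K, hout, hnodup, hK⟩ := hr.list
    refine ⟨K, hout, hnodup, fun y => (hK y).trans ?_⟩
    refine and_congr_right fun hy => or_congr_right (and_congr_right fun hyb => ?_)
    rw [marked_markBox_iff hb hy.1 hyb, or_iff_left]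
    rintro rfl
    exact hne hy
  marks := hr.marks_markBox hb.left_lt

lemma Reported.reportBox (hr : Reported S b.left s) (hb : IsRealized S b)
    (hne : ¬ Marked n s b) : Reported S b.left (reportBox S (Stab.markBox n s b) b) where
  list := by
    obtain ⟨K, hout, hnodup, hK⟩ := hr.list
    refine ⟨K ++ [b], ?_, ?_, fun y => ?_⟩
    · rw [List.map_append, ← hout]
      rfl
    · rw [List.nodup_append_comm]
      exact List.nodup_cons.mpr ⟨fun hmem => by simpa [hne] using ((hK b).mp hmem).2, hnodup⟩
    · change _ ↔ _ ∧ (_ ∨ _ ∧ Marked n (Stab.markBox n s b) y)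
      rw [List.mem_append, List.mem_singleton, hK]
      constructor
      · rintro (⟨hy, hA | ⟨hA, hm⟩⟩ | rfl)
        · exact ⟨hy, .inl hA⟩
        · exact ⟨hy, .inr ⟨hA, marked_markBox hm hA⟩⟩
        · exact ⟨hb, .inr ⟨rfl, (marked_markBox_iff hb.1 hb.1 rfl).mpr (.inr rfl)⟩⟩
      · rintro ⟨hy, hA | ⟨hA, hm⟩⟩
        · exact .inl ⟨hy, .inl hA⟩
        · exact ((marked_markBox_iff hb.1 hy.1 hA).mp hm).imp_left fun hm => ⟨hy, .inr ⟨hA, hm⟩⟩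
  marks := hr.marks_markBox hb.1.left_lt

/-- The registers hold the box `b`. -/
structure HoldsBox (b : Box) (s : State) : Prop where
  left : s.reg rLeft = b.left
  right : s.reg rBoxRight = b.right
  bottom : s.reg rBoxBottom = b.bottom
  top : s.reg rBoxTop = b.top

/-- The endpoint on the left side of the box in the registers. -/
def leftPoint : Expr := .cell aPX (.add (.reg rLeft) (.const 1))

/-- The endpoint on the right side of the box in the registers. -/
def rightPoint : Expr := .cell aPX (.reg rBoxRight)

/-- The endpoint on the bottom side of the box in the registers. -/
def bottomPoint : Expr := .cell aPY (.add (.reg rBoxBottom) (.const 1))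

/-- The endpoint on the top side of the box in the registers. -/
def topPoint : Expr := .cell aPY (.reg rBoxTop)

/-- Report the box in the registers if it is realized. -/
def reportIfRealized : Program :=
  .cond (.eq (countExpr (.cell aXLt leftPoint) (.cell aXLe rightPoint) (.cell aYLt bottomPoint)
      (.cell aYLe topPoint)) (.reg rSegments))
    (.report leftPoint rightPoint bottomPoint topPoint)
    .skip

/-- Mark the box in the registers and report it if it is realized, unless it is marked. -/
def emit : Program :=
  .cond (.eq (.cell aMark (idx (.reg rBoxRight) (.reg rBoxBottom)))
      (.add (.reg rLeft) (.const 1)))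
    .skip
    (.store aMark (idx (.reg rBoxRight) (.reg rBoxBottom)) (.add (.reg rLeft) (.const 1)) ;;
      reportIfRealized)

variable {m : ℕ} {P : Fin m → Point} {B : ℕ}

lemma Val.leftPoint (hB : WordBound n B) (hs : Ready S s) (hA : s.reg rLeft = A)
    (hlt : A < n + n) : Val B s leftPoint ((ranked S).PX (A + 1)) := by
  have hsm := hB.small
  have hp := ((ranked S).px_spec (A + 1) (by omega) hlt).1
  exact ((Val.reg hA (by omega)).add (.const (by omega)) (by omega)).cell
    (hs.px _ (by omega) hlt) (by omega)

lemma Val.rightPoint (hB : WordBound n B) (hs : Ready S s) (h : HoldsBox b s)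
    (hb : b.IsWithin (n + n)) : Val B s rightPoint ((ranked S).PX b.right) := by
  have hsm := hB.small
  obtain ⟨hpos, hle⟩ := hb.right_mem
  have hp := ((ranked S).px_spec _ hpos hle).1
  exact (Val.reg h.right (by omega)).cell (hs.px _ hpos hle) (by omega)

lemma Val.bottomPoint (hB : WordBound n B) (hs : Ready S s) (h : HoldsBox b s)
    (hb : b.IsWithin (n + n)) : Val B s bottomPoint ((ranked S).PY (b.bottom + 1)) := by
  have hsm := hB.small
  have hlt := hb.bottom_lt
  have hp := ((ranked S).py_spec (b.bottom + 1) (by omega) hlt).1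
  exact ((Val.reg h.bottom (by omega)).add (.const (by omega)) (by omega)).cell
    (hs.py _ (by omega) hlt) (by omega)

lemma Val.topPoint (hB : WordBound n B) (hs : Ready S s) (h : HoldsBox b s)
    (hb : b.IsWithin (n + n)) : Val B s topPoint ((ranked S).PY b.top) := by
  have hsm := hB.small
  obtain ⟨hpos, hle⟩ := hb.top_mem
  have hp := ((ranked S).py_spec _ hpos hle).1
  exact (Val.reg h.top (by omega)).cell (hs.py _ hpos hle) (by omega)

lemma runs_reportIfRealized (hB : WordBound n B) (hs : Ready S s) (hb : (ranked S).IsTight b)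
    (h : HoldsBox b s) {Q : State → Prop} (hyes : IsRealized S b → Q (reportBox S s b))
    (hno : ¬ IsRealized S b → Q s) : Runs P B reportIfRealized s 70 Q := by
  have hsm := hB.small
  have hl := Val.leftPoint hB hs h.left hb.left_lt
  have hr := Val.rightPoint hB hs h hb.toIsWithin
  have hbot := Val.bottomPoint hB hs h hb.toIsWithin
  have ht := Val.topPoint hB hs h hb.toIsWithin
  obtain ⟨hle₁, hle₂, hle₃, hle₄⟩ := hb.le_rankBox (S := S)
  have hx := hb.left.1
  have hy := hb.left.2
  have hcount := Val.countExpr hB hs (b' := rankBox S ((ranked S).quad b))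
    (hl.cell (hs.xlt _ hb.x_left.1) ((countLt_le _ _ _).trans (by omega)))
    (hr.cell (hs.xle _ hb.x_right.1) ((countLe_le _ _ _).trans (by omega)))
    (hbot.cell (hs.ylt _ hb.y_bottom.1) ((countLt_le _ _ _).trans (by omega)))
    (ht.cell (hs.yle _ hb.y_top.1) ((countLe_le _ _ _).trans (by omega)))
    (by omega) (countLe_le _ _ _) (by omega) (countLe_le _ _ _)
  refine (Tests.runs_cond (.eq hcount (.reg hs.segments (by omega)))
    (fun hn => runs_report hl hr hbot ht (hyes ⟨hb, hn⟩))
    (fun hn => runs_skip (hno fun hreal => hn hreal.2))).of_le (by decide)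

lemma runs_emit (hB : WordBound n B) (hs : Ready S s) (hb : (ranked S).IsTight b)
    (h : HoldsBox b s) (hr : Reported S b.left s) :
    Runs P B emit s 100 fun s' => Advances S b.left rBoxRight s s' ∧ Marked n s' b := by
  have hsm := hB.small
  have hlt := hb.left_lt
  have hbot := hb.bottom_lt
  have hright := hb.right_mem
  have hmark := hr.marks (b.right * (n + n + 1) + b.bottom)
  have hidx : Val B s (idx (.reg rBoxRight) (.reg rBoxBottom))
      (b.right * (n + n + 1) + b.bottom) :=
    (Val.reg h.right (by omega)).idx hB hs.width (.reg h.bottom (by omega)) hright.2 hbot.le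
  have hleft : Val B s (.add (.reg rLeft) (.const 1)) (b.left + 1) :=
    (Val.reg h.left (by omega)).add (.const (by omega)) (by omega)
  have hmarked : Marked n (markBox n s b) b := (marked_markBox_iff hb hb rfl).mpr (.inr rfl)
  have harr : ∀ a < aMark, (markBox n s b).arr a = s.arr a := fun a ha => by
    simp only [markBox, setArr_arr, if_neg ha.ne]
  refine (Tests.runs_cond (.eq (hidx.cell (a := aMark) rfl (by omega)) hleft)
    (fun hm => runs_skip ⟨.refl, hm⟩) fun hm => hidx.runs_store_seq hleft <|
      runs_reportIfRealized hB (hs.setArr (by omega) _ _) hb ⟨h.left, h.right, h.bottom, h.top⟩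
        (fun hreal => ?_) fun hreal => ?_).of_le (by decide)
  · exact ⟨⟨fun _ => hr.reportBox hreal hm, fun y hy hym => marked_markBox hym hy,
      fun _ _ => rfl, harr⟩, hmarked⟩
  · exact ⟨⟨fun _ => hr.markBox hb hreal, fun y hy hym => marked_markBox hym hy,
      fun _ _ => rfl, harr⟩, hmarked⟩

end Emit

section Examine

variable {n : ℕ} (S : Fin n → Segment)

/-- All tight boxes that share the left side of `w` and lie in `w` have been found. -/
def Covered (w : Box) (s : State) : Prop :=
  ∀ b, (ranked S).IsTight b → b.left = w.left → b ≤ w → Marked n s b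

/-- The registers hold the window `w`, with the exclusive upper bounds of an open window. -/
structure HoldsWindow (w : Box) (s : State) : Prop where
  left : s.reg rLeft = w.left
  right : s.reg rRight = w.right + 1
  bottom : s.reg rBottom = w.bottom
  top : s.reg rTop = w.top + 1

/-- The box with the sides `a`, `b`, `c`, `d` contains as many endpoints as there are segments. -/
def fullTest (a b c d : Expr) : Test := .eq (countExpr a b c d) (.reg rSegments)

/-- The box in the registers contains as many endpoints as there are segments, the first one in
the order of `x` that is to the right of its left side included. -/
def candidateTest : Test :=
  .and (.and (.lt (.reg rBoxBottom) (.cell aY leftPoint))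
      (.not (.lt (.reg rBoxTop) (.cell aY leftPoint))))
    (fullTest (.reg rLeft) (.reg rBoxRight) (.reg rBoxBottom) (.reg rBoxTop))

/-- Copy the window in the registers to the registers for the box. -/
def loadBox : Program :=
  .assign rBoxRight (.sub (.reg rRight) (.const 1)) ;; .assign rBoxBottom (.reg rBottom) ;;
  .assign rBoxTop (.sub (.reg rTop) (.const 1))

/-- Move the right side of the box in the registers to the left as far as the number of endpoints
permits. -/
def shrinkRight : Program :=
  bisect rLeft rBoxRight (fullTest (.reg rLeft) (.reg rMid) (.reg rBoxBottom) (.reg rBoxTop)) ;;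
  .assign rBoxRight (.reg rHigh)

/-- Move the bottom side of the box in the registers up as far as the number of endpoints
permits. -/
def shrinkBottom : Program :=
  bisect rBoxBottom rBoxTop
    (.not (fullTest (.reg rLeft) (.reg rBoxRight) (.reg rMid) (.reg rBoxTop))) ;;
  .assign rBoxBottom (.reg rLow)

/-- Move the top side of the box in the registers down as far as the number of endpoints
permits. -/
def shrinkTop : Program :=
  bisect rBoxBottom rBoxTop
    (fullTest (.reg rLeft) (.reg rBoxRight) (.reg rBoxBottom) (.reg rMid)) ;;
  .assign rBoxTop (.reg rHigh)

/-- Find and report the tight box with the left side of the window in the registers, if the window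
contains one. -/
def examine : Program :=
  loadBox ;; .cond candidateTest (shrinkRight ;; shrinkBottom ;; shrinkTop ;; emit) .skip

/-- The time for shrinking one side of a box. -/
def shrinkTime (n : ℕ) : ℕ := 43 * Nat.clog 2 (n + n) + 11

/-- The time for examining a window. -/
def examineTime (n : ℕ) : ℕ := 3 * shrinkTime n + 170

variable {S} {m : ℕ} {P : Fin m → Point} {B : ℕ} {b w : Box} {s s' : State}

lemma HoldsBox.of_keeps (h : HoldsBox w s) (hk : Keeps rLow s s') : HoldsBox w s' where
  left := (hk.reg _ (by omega)).trans h.left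
  right := (hk.reg _ (by omega)).trans h.right
  bottom := (hk.reg _ (by omega)).trans h.bottom
  top := (hk.reg _ (by omega)).trans h.top

lemma Tests.fullTest (hB : WordBound n B) (hs : Ready S s) {a b c d : Expr} {A R C D : ℕ}
    (ha : Val B s a A) (hb : Val B s b R) (hc : Val B s c C) (hd : Val B s d D) (hAR : A ≤ R)
    (hR : R ≤ n + n) (hCD : C ≤ D) (hD : D ≤ n + n) :
    Tests P B s (fullTest a b c d) ((ranked S).cnt ⟨A, R, C, D⟩ = n) :=
  .eq (.countExpr (b' := ⟨A, R, C, D⟩) hB hs ha hb hc hd hAR hR hCD hD)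
    (.reg hs.segments (by have := hB.small; omega))

lemma Ranked.lt_of_cnt_eq {I : Ranked n} (hn : 1 ≤ n) (h : I.cnt b = n) :
    b.left < b.right ∧ b.bottom < b.top := by
  by_contra hb
  have := I.cnt_eq_zero (b := b) (by omega)
  omega

lemma runs_shrinkRight (hB : WordBound n B) (hs : Ready S s) (h : HoldsBox w s)
    (hcnt : (ranked S).cnt w = n) (hright : w.right ≤ n + n) (htop : w.top ≤ n + n) :
    Runs P B shrinkRight s (shrinkTime n) fun s' => Keeps rBoxRight s s' ∧
      ∃ k, w.left ≤ k ∧ k + 1 ≤ w.right ∧ HoldsBox ⟨w.left, k + 1, w.bottom, w.top⟩ s' ∧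
        (ranked S).cnt ⟨w.left, k, w.bottom, w.top⟩ ≠ n ∧
        (ranked S).cnt ⟨w.left, k + 1, w.bottom, w.top⟩ = n := by
  have hpos := hB.pos
  have hsm := hB.small
  obtain ⟨hlr, hbt⟩ := Ranked.lt_of_cnt_eq hpos hcnt
  refine (runs_seq (T₂ := 2) ((runs_bisect (y := rBoxRight) (M := n + n)
    (V := fun k => (ranked S).cnt ⟨w.left, k, w.bottom, w.top⟩ = n) (by omega) (by omega) h.left
    h.right (by omega) hright (fun s' hk hl hr => ?_) hlr ?_ hcnt).imp ?_)).of_le ?_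
  · have h' := h.of_keeps hk
    exact .fullTest hB (hk.prepared (by omega) hs)
      (.reg h'.left (by omega)) (.reg rfl (by omega)) (.reg h'.bottom (by omega))
      (.reg h'.top (by omega)) hl (by omega) hbt.le htop
  · exact fun hk => (Ranked.lt_of_cnt_eq hpos hk).1.ne rfl
  · rintro s' ⟨k, hk⟩
    have h' := h.of_keeps hk.keeps
    exact (Val.reg hk.high (by have := hk.le_end; omega)).runs_assign
      ⟨((Keeps.refl rBoxRight s).trans hk.keeps (by omega)).setReg (by omega) _, k, hk.start_le,
        hk.le_end, ⟨h'.left, by simp, h'.bottom, h'.top⟩, hk.not_low, hk.of_high⟩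
  · exact Nat.add_le_add_right (Nat.mul_le_mul_right (Nat.clog 2 (n + n)) (by decide)) 11

lemma runs_shrinkBottom (hB : WordBound n B) (hs : Ready S s) (h : HoldsBox w s)
    (hcnt : (ranked S).cnt w = n) (hright : w.right ≤ n + n) (htop : w.top ≤ n + n) :
    Runs P B shrinkBottom s (shrinkTime n) fun s' => Keeps rBoxRight s s' ∧
      ∃ k, w.bottom ≤ k ∧ k + 1 ≤ w.top ∧ HoldsBox ⟨w.left, w.right, k, w.top⟩ s' ∧
        (ranked S).cnt ⟨w.left, w.right, k, w.top⟩ = n ∧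
        (ranked S).cnt ⟨w.left, w.right, k + 1, w.top⟩ ≠ n := by
  have hpos := hB.pos
  have hsm := hB.small
  obtain ⟨hlr, hbt⟩ := Ranked.lt_of_cnt_eq hpos hcnt
  refine runs_seq (T₂ := 2) ((runs_bisect (y := rBoxTop) (M := n + n)
    (V := fun k => ¬ (ranked S).cnt ⟨w.left, w.right, k, w.top⟩ = n) (by omega) (by omega)
    h.bottom h.top (by omega) htop (fun s' hk _ hr => ?_) hbt (not_not.mpr hcnt) ?_).imp ?_)
  · have h' := h.of_keeps hk
    exact (Tests.fullTest hB (hk.prepared (by omega) hs)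
      (.reg h'.left (by omega)) (.reg h'.right (by omega)) (.reg rfl (by omega))
      (.reg h'.top (by omega)) hlr.le hright hr htop).not
  · exact fun hk => (Ranked.lt_of_cnt_eq hpos hk).2.ne rfl
  · rintro s' ⟨k, hk⟩
    have h' := h.of_keeps hk.keeps
    exact (Val.reg hk.low (by have := hk.le_end; omega)).runs_assign
      ⟨((Keeps.refl rBoxRight s).trans hk.keeps (by omega)).setReg (by omega) _, k, hk.start_le,
        hk.le_end, ⟨h'.left, h'.right, by simp, h'.top⟩, not_not.mp hk.not_low, hk.of_high⟩

lemma runs_shrinkTop (hB : WordBound n B) (hs : Ready S s) (h : HoldsBox w s)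
    (hcnt : (ranked S).cnt w = n) (hright : w.right ≤ n + n) (htop : w.top ≤ n + n) :
    Runs P B shrinkTop s (shrinkTime n) fun s' => Keeps rBoxRight s s' ∧
      ∃ k, w.bottom ≤ k ∧ k + 1 ≤ w.top ∧ HoldsBox ⟨w.left, w.right, w.bottom, k + 1⟩ s' ∧
        (ranked S).cnt ⟨w.left, w.right, w.bottom, k⟩ ≠ n ∧
        (ranked S).cnt ⟨w.left, w.right, w.bottom, k + 1⟩ = n := by
  have hpos := hB.pos
  have hsm := hB.small
  obtain ⟨hlr, hbt⟩ := Ranked.lt_of_cnt_eq hpos hcnt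
  refine (runs_seq (T₂ := 2) ((runs_bisect (y := rBoxTop) (M := n + n)
    (V := fun k => (ranked S).cnt ⟨w.left, w.right, w.bottom, k⟩ = n) (by omega) (by omega)
    h.bottom h.top (by omega) htop (fun s' hk hl hr => ?_) hbt ?_ hcnt).imp ?_)).of_le ?_
  · have h' := h.of_keeps hk
    exact .fullTest hB (hk.prepared (by omega) hs)
      (.reg h'.left (by omega)) (.reg h'.right (by omega)) (.reg h'.bottom (by omega))
      (.reg rfl (by omega)) hlr.le hright hl (by omega)
  · exact fun hk => (Ranked.lt_of_cnt_eq hpos hk).2.ne rfl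
  · rintro s' ⟨k, hk⟩
    have h' := h.of_keeps hk.keeps
    exact (Val.reg hk.high (by have := hk.le_end; omega)).runs_assign
      ⟨((Keeps.refl rBoxRight s).trans hk.keeps (by omega)).setReg (by omega) _, k, hk.start_le,
        hk.le_end, ⟨h'.left, h'.right, h'.bottom, by simp⟩, hk.not_low, hk.of_high⟩
  · exact Nat.add_le_add_right (Nat.mul_le_mul_right (Nat.clog 2 (n + n)) (by decide)) 11

lemma Tests.candidate (hB : WordBound n B) (hs : Ready S s) (h : HoldsBox w s)
    (hlr : w.left < w.right) (hright : w.right ≤ n + n) (hbt : w.bottom ≤ w.top)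
    (htop : w.top ≤ n + n) : Tests P B s candidateTest
      ((ranked S).InBox w ((ranked S).PX (w.left + 1)) ∧ (ranked S).cnt w = n) := by
  have hsm := hB.small
  obtain ⟨hlt, hX⟩ := (ranked S).px_spec (w.left + 1) (by omega) (by omega)
  have hY := (ranked S).y_spec _ hlt
  have hcell : Val B s (.cell aY leftPoint) ((ranked S).Y ((ranked S).PX (w.left + 1))) :=
    (Val.leftPoint hB hs h.left (by omega)).cell (hs.y _ hlt) (by omega)
  have hin : (ranked S).InBox w ((ranked S).PX (w.left + 1)) ↔
      w.bottom < (ranked S).Y ((ranked S).PX (w.left + 1)) ∧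
        ¬ w.top < (ranked S).Y ((ranked S).PX (w.left + 1)) := by
    rw [Ranked.InBox, hX]
    omega
  rw [hin]
  exact ((Tests.lt (.reg h.bottom (by omega)) hcell).and
    (Tests.lt (.reg h.top (by omega)) hcell).not).and
      (.fullTest hB hs (.reg h.left (by omega)) (.reg h.right (by omega))
        (.reg h.bottom (by omega)) (.reg h.top (by omega)) hlr.le hright hbt htop)

lemma runs_loadBox (hw : HoldsWindow w s) (hright : w.right < B) (hbottom : w.bottom ≤ B)
    (htop : w.top < B) :
    Runs P B loadBox s 10 fun s' => Keeps rBoxRight s s' ∧ HoldsBox w s' := by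
  refine (((Val.reg hw.right hright).sub (.const (by omega))).runs_assign_seq
    ((Val.reg (by simpa using hw.bottom) hbottom).runs_assign_seq
      (((Val.reg (by simpa using hw.top) htop).sub (.const (by omega))).runs_assign
        ⟨?_, ?_, ?_, ?_, ?_⟩))).of_le (by decide)
  · exact (((Keeps.refl _ s).setReg le_rfl _).setReg (by omega) _).setReg (by omega) _
  all_goals simp [hw.left]

lemma runs_shrink (hB : WordBound n B) (hs : Ready S s) (h : HoldsBox w s)
    (hfree : (ranked S).IsFree w) (hleft : (ranked S).InBox w ((ranked S).PX (w.left + 1)))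
    (hcnt : (ranked S).cnt w = n) (hright : w.right ≤ n + n) (htop : w.top ≤ n + n)
    {c : Program} {T : ℕ} {Q : State → Prop}
    (hc : ∀ b s', (ranked S).IsTight b → b ≤ w → b.left = w.left → Keeps rBoxRight s s' →
      HoldsBox b s' → Runs P B c s' T Q) :
    Runs P B (shrinkRight ;; shrinkBottom ;; shrinkTop ;; c) s (3 * shrinkTime n + T) Q := by
  refine (runs_seq ((runs_shrinkRight hB hs h hcnt hright htop).imp ?_)).of_le
    (T := shrinkTime n + (shrinkTime n + (shrinkTime n + T))) (by omega)
  rintro s₁ ⟨hk₁, b, hAb, hbw, h₁, hbOut, hbIn⟩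
  have hs₁ := hk₁.prepared (by omega) hs
  refine runs_seq ((runs_shrinkBottom hB hs₁ h₁ hbIn (by simp; omega) htop).imp ?_)
  rintro s₂ ⟨hk₂, k, hwk, -, h₂, hkIn, hkOut⟩
  have hs₂ := hk₂.prepared (by omega) hs₁
  refine runs_seq ((runs_shrinkTop hB hs₂ h₂ hkIn (by simp; omega) htop).imp ?_)
  rintro s₃ ⟨hk₃, l, hkl, hlw, h₃, hlOut, hlIn⟩
  simp only at *
  exact hc ⟨w.left, b + 1, k, l + 1⟩ s₃ (hfree.isTight_shrink hcnt hright htop hleft hAb hbw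
    hwk hkl hlw hbOut hkIn hkOut hlIn hlOut) ⟨le_rfl, hbw, hwk, hlw⟩ rfl
    ((hk₁.trans hk₂ le_rfl).trans hk₃ le_rfl) h₃

/-- A free window contains at most `n` endpoints, so if it contains fewer then no box inside it is
tight, and otherwise at most one with the given left side is. -/
lemma runs_examine (hB : WordBound n B) (hs : Ready S s) (hw : HoldsWindow w s)
    (hfree : (ranked S).IsFree w) (hlr : w.left < w.right) (hright : w.right ≤ n + n)
    (hbt : w.bottom ≤ w.top) (htop : w.top ≤ n + n) (hr : Reported S w.left s) :
    Runs P B examine s (examineTime n) fun s' =>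
      Advances S w.left rBoxRight s s' ∧ Covered S w s' := by
  have hsm := hB.small
  refine (runs_seq ((runs_loadBox hw (by omega) (by omega) (by omega)).imp ?_)).of_le
    (T := 10 + (60 + max (3 * shrinkTime n + 100) 1)) (by simp [examineTime]; omega)
  rintro s₁ ⟨hk, h⟩
  have hs₁ := hk.prepared (by omega) hs
  have hr₁ : Reported S w.left s₁ := hr.congr (by rw [hk.arr]) hk.out
  refine (Tests.runs_cond (.candidate hB hs₁ h hlr hright hbt htop)
    (fun ⟨hleft, hcnt⟩ => runs_shrink hB hs₁ h hfree hleft hcnt hright htop ?_)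
    (fun hno => runs_skip ⟨hk.advances, ?_⟩)).of_le
    (Nat.add_le_add_right (by decide) (max (3 * shrinkTime n + 100) 1))
  · intro b s₂ hb hbw hbl hk₂ h₂
    rw [← hbl] at hr₁ ⊢
    refine (runs_emit hB (hk₂.prepared (by omega) hs₁) hb h₂
      (hr₁.congr (by rw [hk₂.arr]) hk₂.out)).imp fun s₃ ⟨hadv, hm⟩ =>
        ⟨(hk.trans hk₂ le_rfl).advances.trans hadv le_rfl, fun c hc _ hcw => ?_⟩
    rwa [hc.eq_of_le_of_le hb hcw hbw hcnt]
  · intro c hc hcl hcw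
    have hge := (ranked S).cnt_mono hcw
    rw [hc.cnt_eq] at hge
    exact absurd ⟨(hcl ▸ hc.left : (ranked S).InBox c _).mono hcw, (hfree.cnt_le).antisymm hge⟩
      hno

end Examine

section Flush

variable {n : ℕ} (S : Fin n → Segment)

/-- The window of the chain at `u`, for the sweep with left side `A` that has reached `b`. -/
def chainWindow (A b : ℕ) (s : State) (u : ℕ) : Box :=
  ⟨A, b - 1, u, s.arr aUp (s.arr aNext u) - 1⟩

/-- Examine the window of the chain whose lower end is in `rBottom`, and move on to the next. -/
def flushStep : Program :=
  .assign rTop (.cell aUp (.cell aNext (.reg rBottom))) ;; examine ;;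
  .assign rBottom (.cell aNext (.reg rBottom))

/-- Examine the windows of the chain with lower ends from `rBottom` up to, but not including,
`rStop`. -/
def flush : Program := .loop (.lt (.reg rBottom) (.reg rStop)) flushStep

/-- The invariant of flushing the windows with lower ends in `[c, l)` from the state `s`. -/
structure Flushing (A b c l : ℕ) (K : Finset ℕ) (s s' : State) : Prop where
  advances : Advances S A rBottom s s'
  limit : s'.reg rStop = l
  bottom_mem : s'.reg rBottom ∈ K ∨ s'.reg rBottom = n + n + 1
  lt_limit : ∀ u ∈ K, c ≤ u → u < s'.reg rBottom → u < l
  covered : ∀ u ∈ K, c ≤ u → u < s'.reg rBottom → Covered S (chainWindow A b s u) s'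

variable {S} {m : ℕ} {P : Fin m → Point} {A B b c k l : ℕ} {K : Finset ℕ} {s s' : State} {w : Box}

lemma Covered.of_advances (h : Covered S w s) (hadv : Advances S w.left k s s') :
    Covered S w s' := fun y hy hyl hyw => hadv.marked y hyl (h y hy hyl hyw)

lemma Ready.isIntervalFamily (hs : Ready S s) (W : Set ℕ) :
    IsIntervalFamily (n + n + 1) (s.arr aUp) ((ranked S).spans W) :=
  Ranked.isIntervalFamily_spans hs.up

lemma Flushing.advance (h : Flushing S A b c l K s s') {v : ℕ} (hv : s'.reg rBottom = v)
    (hvK : v ∈ K) (hvl : v < l) {nxt : ℕ → ℕ} {D : Set (ℕ × ℕ)}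
    (hK : IsChain (n + n + 1) D nxt K) {s'' : State} (hadv : Advances S A rTop s' s'')
    (hcov : Covered S (chainWindow A b s v) s'') :
    Flushing S A b c l K s (s''.setReg rBottom (nxt v)) := by
  have hle : ∀ u ∈ K, u < nxt v → u ≤ v := fun u hu hlt =>
    not_lt.mp fun hvu => (hK.gap v hvK u hu hvu).not_gt hlt
  have hset : Advances S A rBottom s'' (s''.setReg rBottom (nxt v)) :=
    ((Keeps.refl _ _).setReg le_rfl _).advances
  refine ⟨(h.advances.trans hadv (by omega)).trans hset le_rfl, ?_, ?_, ?_, ?_⟩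
  · simp [hadv.reg, h.limit]
  · simpa using hK.nxt_mem v hvK
  · intro u hu _ hun
    exact (hle u hu (by simpa using hun)).trans_lt hvl
  · intro u hu hcu hun
    refine Covered.of_advances ?_ hset
    rcases (hle u hu (by simpa using hun)).eq_or_lt with rfl | hlt
    · exact hcov
    · exact (h.covered u hu hcu (hv ▸ hlt)).of_advances hadv

lemma runs_flushStep (hB : WordBound n B) (hs : Ready S s) (hleft : s.reg rLeft = A)
    (hright : s.reg rRight = b) (hAb : A + 1 < b) (hb : b ≤ n + n + 1)
    (hl : l ≤ n + n + 1)
    (hK : IsChain (n + n + 1) ((ranked S).spans (Set.Ioo A b)) (s.arr aNext) K)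
    (hr : Reported S A s) (h : Flushing S A b c l K s s') (hlt : s'.reg rBottom < l) :
    Runs P B flushStep s' (examineTime n + 7) fun s'' => Flushing S A b c l K s s'' ∧
      s''.reg rBottom = s.arr aNext (s'.reg rBottom) := by
  have hsm := hB.small
  have hD := hs.isIntervalFamily (Set.Ioo A b)
  set v := s'.reg rBottom with hv
  have hvK : v ∈ K := h.bottom_mem.resolve_right (by omega)
  have hnext := hK.nxt_le hD hvK
  have hup := hK.lt_up_nxt hD hvK
  have hupM := hK.up_nxt_le hD hvK
  set t := s.arr aUp (s.arr aNext v)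
  have hs' := h.advances.ready (by omega) hs
  have hk : Keeps rTop s' (s'.setReg rTop t) := (Keeps.refl _ _).setReg le_rfl _
  have hcell : Val B s' (.cell aNext (.reg rBottom)) (s.arr aNext v) :=
    (Val.reg hv.symm (by omega)).cell (by rw [h.advances.arr _ (by omega)]) (by omega)
  refine (Val.runs_assign_seq (hcell.cell (w := t) (by rw [h.advances.arr _ (by omega)])
    (by omega)) (runs_seq (T₂ := 3) ((runs_examine (w := chainWindow A b s v) hB
      (hk.prepared (by omega) hs') ⟨?_, ?_, ?_, ?_⟩ ?_ ?_ ?_ ?_ ?_ ?_).imp ?_))).of_le ?_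
  · simp [h.advances.reg, hleft, chainWindow]
  · simp [h.advances.reg, hright, chainWindow]
    omega
  · simp [chainWindow, ← hv]
  · simp [chainWindow]
    omega
  · exact Ranked.isFreeWindow_spans_iff.mp (hK.isFreeWindow hD hvK)
  · simp only [chainWindow]
    omega
  · simp only [chainWindow]
    omega
  · simp only [chainWindow]
    omega
  · simp only [chainWindow]
    omega
  · exact (h.advances.reported hr).congr rfl rfl
  · rintro s'' ⟨hadv, hcov⟩
    have hadv' := hk.advances.trans hadv (by omega)
    refine Val.runs_assign ((Val.reg ((hadv'.reg _ (by omega)).trans hv.symm) (by omega)).cell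
      ?_ (by omega)) ⟨h.advance hv.symm hvK hlt hK hadv' hcov, by simp⟩
    rw [hadv'.arr _ (by omega), h.advances.arr _ (by omega)]
  · simp only [Expr.cost]
    omega

lemma runs_flush (hB : WordBound n B) (hs : Ready S s) (hleft : s.reg rLeft = A)
    (hright : s.reg rRight = b) (hbottom : s.reg rBottom = c) (hlimit : s.reg rStop = l)
    (hAb : A + 1 < b) (hb : b ≤ n + n + 1) (hl : l ≤ n + n + 1) (hc : c ∈ K ∨ c = n + n + 1)
    (hK : IsChain (n + n + 1) ((ranked S).spans (Set.Ioo A b)) (s.arr aNext) K)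
    (hr : Reported S A s) :
    Runs P B flush s ((examineTime n + 10) * (K.filter fun u => c ≤ u ∧ u < l).card + 3)
      fun s' => Flushing S A b c l K s s' ∧ l ≤ s'.reg rBottom := by
  have hsm := hB.small
  refine runs_loop (fun φ s' => Flushing S A b c l K s s' ∧ φ =
      (examineTime n + 10) * (K.filter fun u => s'.reg rBottom ≤ u ∧ u < l).card + 3)
    (by simp [Test.cost]) ?_ ⟨⟨.refl, hlimit, hbottom ▸ hc, fun u _ _ _ => by omega,
      fun u _ _ _ => by omega⟩, by rw [hbottom]⟩
  rintro φ s' ⟨h, rfl⟩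
  have hle : s'.reg rBottom ≤ n + n + 1 :=
    h.bottom_mem.elim (fun hmem => (hK.lt_of_mem (hs.isIntervalFamily _) hmem).le) Eq.le
  refine ⟨_, .lt (.reg rfl (by omega)) (.reg h.limit (by omega)), by simp [Test.cost, Expr.cost],
    fun hn => ⟨h, not_lt.mp hn⟩, fun hlt => ⟨_,
      (runs_flushStep hB hs hleft hright hAb hb hl hK hr h hlt).imp fun s'' ⟨h', hnext⟩ =>
        ⟨_, ⟨h', rfl⟩, ?_⟩⟩⟩
  rw [hK.card_filter_le_eq (h.bottom_mem.resolve_right (by omega)) hlt, hnext, Nat.mul_succ]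
  simp only [Test.cost, Expr.cost]
  omega

end Flush

section Sweep

variable {n : ℕ} (S : Fin n → Segment)

/-- Insert the segment of the point in `rPoint` into the chain, after examining the windows that
contain its vertical range. -/
def insertSpan : Program :=
  .assign rBottom (.cell aStart (.reg rPoint)) ;; .assign rStop (.cell aLo (.reg rPoint)) ;;
  flush ;; .store aNext (.cell aStart (.reg rPoint)) (.cell aLo (.reg rPoint)) ;;
  .store aNext (.cell aLo (.reg rPoint)) (.reg rBottom)

/-- Pass the point whose `x`-rank is in `rRight`: if it is the right endpoint of a segment that
starts to the right of the left side, and the vertical range of this segment contains that of no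
segment seen before, then insert this segment into the chain. -/
def sweepStep : Program :=
  .assign rPoint (.cell aPX (.reg rRight)) ;; .assign rStart (.cell aPartner (.reg rPoint)) ;;
  .cond (.and (.lt (.reg rLeft) (.cell aX (.reg rStart)))
      (.and (.lt (.cell aX (.reg rStart)) (.reg rRight))
        (.lt (.cell aStart (.reg rPoint)) (.cell aLo (.reg rPoint)))))
    insertSpan .skip

/-- Find all boxes with the left side in `rLeft`. -/
def sweep : Program :=
  .store aNext (.const 0) (.reg rWidth) ;; .assign rRight (.const 1) ;;
  countUp rRight rWidth sweepStep ;;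
  .assign rBottom (.const 0) ;; .assign rStop (.reg rWidth) ;; flush

/-- Every tight box with left side `A` and right side before `b` has been found, or it is in a
window that is still open. -/
def Settled (A b : ℕ) (s : State) : Prop :=
  ∀ y, (ranked S).IsTight y → y.left = A → y.right < b →
    Marked n s y ∨ IsFreeWindow ((ranked S).spans (Set.Ioo A b)) y.bottom (y.top + 1)

/-- The table `aStart` gives, for each endpoint, the lower end of the highest window below the top
of its segment, at the time when the sweep with left side `A` reaches this endpoint. -/
def HasStarts (A : ℕ) (s : State) : Prop :=
  ∀ e < n + n, IsStart ((ranked S).spans (Set.Ioo A ((ranked S).X e))) ((ranked S).hi e)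
    (s.arr aStart e)

/-- The state of the sweep with left side `A` before the point with rank `b` is passed. -/
structure Sweep (A b : ℕ) (K : Finset ℕ) (s : State) : Prop where
  ready : Ready S s
  left : s.reg rLeft = A
  cur : s.reg rRight = b
  chain : IsChain (n + n + 1) ((ranked S).spans (Set.Ioo A b)) (s.arr aNext) K
  starts : HasStarts S A s
  reported : Reported S A s
  settled : Settled S A b s

variable {S} {m : ℕ} {P : Fin m → Point} {A B b e : ℕ} {K : Finset ℕ} {s s' : State}

lemma Settled.succ (h : Settled S A b s)
    (hmark : ∀ y : Box, y.left = A → Marked n s y → Marked n s' y)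
    (hopen : ∀ y, (ranked S).IsTight y → y.left = A → y.right < b →
      IsFreeWindow ((ranked S).spans (Set.Ioo A b)) y.bottom (y.top + 1) → Marked n s' y ∨
        IsFreeWindow ((ranked S).spans (Set.Ioo A (b + 1))) y.bottom (y.top + 1)) :
    Settled S A (b + 1) s' := by
  intro y hy hyA hyb
  rcases (Nat.lt_succ_iff.mp hyb).eq_or_lt with rfl | hlt
  · exact .inr (Ranked.isFreeWindow_spans_iff.mpr (by simpa [← hyA] using hy.isFree))
  · exact (h y hy hyA hlt).elim (fun hm => .inl (hmark y hyA hm)) (hopen y hy hyA hlt)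

lemma Settled.of_flush {s₁ s₂ : State} {c l h : ℕ} (hset : Settled S A b s)
    (hs : Ready S s₁) (hK : IsChain (n + n + 1) ((ranked S).spans (Set.Ioo A b)) (s₁.arr aNext) K)
    (hstart : IsStart ((ranked S).spans (Set.Ioo A b)) h c)
    (hmark : s₁.arr aMark = s.arr aMark) (hmark' : s'.arr aMark = s₂.arr aMark)
    (hflush : Flushing S A b c l K s₁ s₂) (hl : l ≤ s₂.reg rBottom)
    (hsucc : (ranked S).spans (Set.Ioo A (b + 1)) =
      insert (l, h) ((ranked S).spans (Set.Ioo A b))) :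
    Settled S A (b + 1) s' := by
  refine hset.succ (fun y hyA hy => ?_) fun y hy hyA hyb hw => ?_
  · rw [Marked, hmark']
    exact hflush.advances.marked y hyA (by rwa [Marked, hmark])
  · rw [hsucc, isFreeWindow_insert]
    refine or_iff_not_imp_right.mpr fun hkilled => ?_
    simp only [hw, and_true, not_not] at hkilled
    have htop := hy.top_mem.2
    obtain ⟨w, hwK, hwy, hyw⟩ := hK.exists_window_ge (hs.isIntervalFamily _) hw (by omega)
    have hcw := hstart.le_of_isFreeWindow (hK.isFreeWindow (hs.isIntervalFamily _) hwK)
      (hkilled.2.le.trans hyw)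
    rw [Marked, hmark']
    refine hflush.covered w hwK hcw (by omega) y hy hyA ⟨?_, ?_, ?_, ?_⟩ <;>
      simp only [chainWindow] <;> omega

lemma Sweep.skip (h : Sweep S A b K s) (he : e < n + n) (hX : (ranked S).X e = b)
    (hnone : ¬ (A < (ranked S).X (partner n e) ∧ (ranked S).X (partner n e) < b ∧
      s.arr aStart e < (ranked S).lo e)) (hk : Keeps rPoint s s') :
    Sweep S A (b + 1) K (s'.setReg rRight (b + 1)) := by
  have hchain : IsChain (n + n + 1) ((ranked S).spans (Set.Ioo A (b + 1))) (s.arr aNext) K ∧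
      ∀ u v, IsFreeWindow ((ranked S).spans (Set.Ioo A b)) u v →
        IsFreeWindow ((ranked S).spans (Set.Ioo A (b + 1))) u v := by
    by_cases hp : (ranked S).X (partner n e) ∈ Set.Ioo A b
    · have hpD := Ranked.notMem_spans (I := ranked S) (W := Set.Ioo A b) he (by simp [hX])
      have hsucc := Ranked.spans_Ioo_succ he hX hp.1 hp.2
      have hstart := hX ▸ h.starts e he
      have hlt : (ranked S).lo e < s.arr aStart e :=
        lt_of_le_of_ne (not_lt.mp fun hlt => hnone ⟨hp.1, hp.2, hlt⟩)
          ((hsucc ▸ h.ready.isIntervalFamily _).fst_ne_of_isStart hpD hstart)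
      rw [hsucc]
      exact ⟨h.chain.insert_of_lt hpD hstart hlt, fun u v hw => hw.insert hstart hlt⟩
    · rw [Ranked.spans_Ioo_succ_of_notMem he hX hp]
      exact ⟨h.chain, fun u v => id⟩
  have harr : (s'.setReg rRight (b + 1)).arr = s.arr := hk.arr
  refine ⟨(hk.prepared (by omega) h.ready).setReg (by omega) _, ?_, by simp, harr ▸ hchain.1, ?_,
    h.reported.congr (by rw [harr]) hk.out, ?_⟩
  · simpa [hk.reg] using h.left
  · rw [HasStarts, harr]
    exact h.starts
  · refine h.settled.succ (fun y _ hm => ?_) fun y _ _ _ hw => .inr (hchain.2 _ _ hw)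
    rwa [Marked, harr]

lemma Sweep.insertSpan {s₁ s₂ : State} (h : Sweep S A b K s) (he : e < n + n)
    (hX : (ranked S).X e = b) (hA : A < (ranked S).X (partner n e))
    (hb : (ranked S).X (partner n e) < b) (hlt : s.arr aStart e < (ranked S).lo e)
    (hk : Keeps rBottom s s₁)
    (hflush : Flushing S A b (s.arr aStart e) ((ranked S).lo e) K s₁ s₂)
    (hl : (ranked S).lo e ≤ s₂.reg rBottom) :
    Sweep S A (b + 1) (insert ((ranked S).lo e)
        (K.filter fun u => ¬ (s.arr aStart e < u ∧ u < (ranked S).lo e)))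
      (((s₂.setArr aNext (s.arr aStart e) ((ranked S).lo e)).setArr aNext ((ranked S).lo e)
        (s₂.reg rBottom)).setReg rRight (b + 1)) := by
  have hstart := hX ▸ h.starts e he
  have hsucc := Ranked.spans_Ioo_succ he hX hA hb
  have hpD := Ranked.notMem_spans (I := ranked S) (W := Set.Ioo A b) he (by simp [hX])
  have hD := h.ready.isIntervalFamily (Set.Ioo A (b + 1))
  rw [hsucc] at hD
  have hready := hk.prepared (by omega) h.ready
  have hlo := Ranked.lo_lt_hi (I := ranked S) he
  have hhi := Ranked.hi_le (I := ranked S) he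
  have hne : s₂.reg rBottom ≠ (ranked S).lo e := fun hne => by
    rcases hflush.bottom_mem with hmem | hlast
    · exact h.chain.fst_notMem hD hpD (hne ▸ hmem)
    · omega
  have hnext := h.chain.insert hD hpD hstart hlt hflush.bottom_mem (lt_of_le_of_ne hl hne.symm)
    hflush.lt_limit
  refine ⟨(((hflush.advances.ready (by omega) hready).setArr (by omega) _ _).setArr
    (by omega) _ _).setReg (by omega) _, ?_, by simp, ?_, ?_, ?_, ?_⟩
  · simp [hflush.advances.reg, hk.reg, h.left]
  · rw [hsucc]
    simpa [hflush.advances.arr, hk.arr] using hnext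
  · intro t ht
    simpa [hflush.advances.arr, hk.arr] using h.starts t ht
  · exact (hflush.advances.reported (h.reported.congr (by rw [hk.arr]) hk.out)).congr
      (by simp) rfl
  · exact h.settled.of_flush hready (hk.arr ▸ h.chain) hstart (by rw [hk.arr]) (by simp) hflush hl
      hsucc

lemma runs_insertSpan (hB : WordBound n B) (h : Sweep S A b K s) (he : e < n + n)
    (hX : (ranked S).X e = b) (hpoint : s.reg rPoint = e)
    (hA : A < (ranked S).X (partner n e)) (hb : (ranked S).X (partner n e) < b)
    (hlt : s.arr aStart e < (ranked S).lo e) :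
    Runs P B insertSpan s ((examineTime n + 10) *
        (K.filter fun u => s.arr aStart e ≤ u ∧ u < (ranked S).lo e).card + 18) fun s' =>
      s'.reg rRight = b ∧ s'.arr aStart = s.arr aStart ∧
      Sweep S A (b + 1) (insert ((ranked S).lo e)
        (K.filter fun u => ¬ (s.arr aStart e < u ∧ u < (ranked S).lo e)))
        (s'.setReg rRight (b + 1)) := by
  have hsm := hB.small
  have hbn := hX ▸ ((ranked S).x_spec e he).2
  have hlh := Ranked.lo_lt_hi (I := ranked S) he
  have hhi := Ranked.hi_le (I := ranked S) he
  have hlo := h.ready.lo e he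
  have hstart := hX ▸ h.starts e he
  set f := s.arr aStart e
  set l := (ranked S).lo e
  have hk : Keeps rBottom s ((s.setReg rBottom f).setReg rStop l) :=
    ((Keeps.refl _ _).setReg le_rfl _).setReg (by omega) _
  have hready := hk.prepared (by omega) h.ready
  refine (Val.runs_assign_seq (v := f) ((Val.reg hpoint (by omega)).cell rfl (by omega))
    (Val.runs_assign_seq (v := l) ((Val.reg (by simpa using hpoint) (by omega)).cell hlo (by omega))
    (runs_seq (T₂ := 9) ((runs_flush hB hready (c := f) (l := l) (A := A) (b := b)
      ?_ ?_ (by simp) (by simp) (by omega) (by omega) (by omega)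
      (.inl (h.chain.mem_of_isStart (h.ready.isIntervalFamily _) hstart)) h.chain
      (h.reported.congr rfl rfl)).imp ?_)))).of_le
    (by simp only [Expr.cost]; omega)
  · simpa using h.left
  · simpa using h.cur
  rintro s' ⟨hflush, hl⟩
  have hpoint' : s'.reg rPoint = e := by simp [hflush.advances.reg, hpoint]
  have hlo' : s'.arr aLo e = l := by simp [hflush.advances.arr, hlo]
  have hcur : s'.reg rRight = b := by simp [hflush.advances.reg, h.cur]
  have hzn : s'.reg rBottom ≤ n + n + 1 := hflush.bottom_mem.elim
    (fun hmem => (h.chain.lt_of_mem (h.ready.isIntervalFamily _) hmem).le) Eq.le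
  refine Val.runs_store_seq (v := f) (w := l)
    ((Val.reg hpoint' (by omega)).cell (by simp [hflush.advances.arr, f]) (by omega))
    ((Val.reg hpoint' (by omega)).cell hlo' (by omega))
    (Val.runs_store (v := l) (w := s'.reg rBottom)
      ((Val.reg (by simpa using hpoint') (by omega)).cell (by simpa using hlo') (by omega))
      (.reg rfl (by omega)) ⟨by simpa using hcur, ?_,
        h.insertSpan he hX hA hb hlt hk hflush hl⟩)
  funext t
  simp [hflush.advances.arr]

lemma runs_sweepStep_of {T : ℕ} {Q : State → Prop} (hB : WordBound n B) (h : Sweep S A b K s)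
    (hA : A < n + n) (hb1 : 1 ≤ b) (hb : b ≤ n + n)
    (he : (ranked S).PX b = e) (hT : 1 ≤ T)
    (hpos : A < (ranked S).X (partner n e) ∧ (ranked S).X (partner n e) < b ∧
        s.arr aStart e < (ranked S).lo e →
      Runs P B insertSpan ((s.setReg rPoint e).setReg rStart (partner n e)) T Q)
    (hneg : ¬ (A < (ranked S).X (partner n e) ∧ (ranked S).X (partner n e) < b ∧
        s.arr aStart e < (ranked S).lo e) →
      Q ((s.setReg rPoint e).setReg rStart (partner n e))) :
    Runs P B sweepStep s (T + 21) Q := by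
  subst he
  have hsm := hB.small
  have he := ((ranked S).px_spec b hb1 hb).1
  set e := (ranked S).PX b
  have hpe := partner_lt he
  have hXp := (ranked S).x_spec _ hpe
  have hlo := Ranked.lo_lt_hi (I := ranked S) he
  have hhi := Ranked.hi_le (I := ranked S) he
  have hfh := (h.ready.isIntervalFamily _).lt_of_isStart (h.starts e he) (by omega)
  set s₁ := (s.setReg rPoint e).setReg rStart (partner n e) with hs₁
  have hx : Val B s₁ (.cell aX (.reg rStart)) ((ranked S).X (partner n e)) :=
    (Val.reg (by simp [hs₁]) (by omega)).cell (h.ready.x _ hpe) (by omega)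
  have hpoint : Val B s₁ (.reg rPoint) e := .reg (by simp [hs₁]) (by omega)
  have hleft : Val B s₁ (.reg rLeft) A := .reg (by simp [hs₁, h.left]) (by omega)
  have hright : Val B s₁ (.reg rRight) b := .reg (by simp [hs₁, h.cur]) (by omega)
  have hstart : Val B s₁ (.cell aStart (.reg rPoint)) (s.arr aStart e) :=
    hpoint.cell rfl (by omega)
  have hlow : Val B s₁ (.cell aLo (.reg rPoint)) ((ranked S).lo e) :=
    hpoint.cell (h.ready.lo e he) (by omega)
  refine (Val.runs_assign_seq ((Val.reg h.cur (by omega)).cell (h.ready.px b hb1 hb) (by omega))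
    (Val.runs_assign_seq ((Val.reg (by simp; rfl) (by omega)).cell (h.ready.partner e he)
      (by omega))
      (((Tests.lt hleft hx).and ((Tests.lt hx hright).and (.lt hstart hlow))).runs_cond hpos
        fun hn => runs_skip (hneg hn)))).of_le ?_
  simp only [Expr.cost, Test.cost]
  omega

lemma runs_sweepStep (hB : WordBound n B) (hA : A < n + n) (hb1 : 1 ≤ b) (hb : b ≤ n + n)
    (h : Sweep S A b K s) :
    ∃ T K', Runs P B sweepStep s T (fun s' => s'.reg rRight = b ∧ s'.arr aStart = s.arr aStart ∧
        Sweep S A (b + 1) K' (s'.setReg rRight (b + 1))) ∧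
      T + (examineTime n + 10) * K'.card ≤ (examineTime n + 10) * (K.card + 2) + 39 := by
  obtain ⟨he, hX⟩ := (ranked S).px_spec b hb1 hb
  set e := (ranked S).PX b with hpx
  set s₁ := (s.setReg rPoint e).setReg rStart (partner n e) with hs₁
  have hk : Keeps rPoint s s₁ := ((Keeps.refl _ _).setReg le_rfl _).setReg (by omega) _
  by_cases hins : A < (ranked S).X (partner n e) ∧ (ranked S).X (partner n e) < b ∧
      s.arr aStart e < (ranked S).lo e
  · have h₁ : Sweep S A b K s₁ :=
      ⟨hk.prepared (by omega) h.ready, by simp [hs₁, h.left], by simp [hs₁, h.cur], h.chain,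
        h.starts, h.reported.congr rfl rfl, h.settled⟩
    have hrun := runs_insertSpan (P := P) hB h₁ he hX (by simp [hs₁]) hins.1 hins.2.1 hins.2.2
    refine ⟨_, _, runs_sweepStep_of hB h hA hb1 hb hpx.symm (by omega) (fun _ => hrun)
      fun hn => absurd hins hn, ?_⟩
    have hcard := Nat.mul_le_mul_left (examineTime n + 10)
      (card_insert_filter_add_le (K := K) (f := s₁.arr aStart e) (l := (ranked S).lo e))
    rw [Nat.mul_add] at hcard
    omega
  · exact ⟨1 + 21, K, runs_sweepStep_of hB h hA hb1 hb hpx.symm le_rfl (fun hy => absurd hy hins)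
      fun _ => ⟨by simp [h.cur], rfl, h.skip he hX hins hk⟩, by rw [Nat.mul_add]; omega⟩

lemma sweep_initial (hs : Ready S s) (hleft : s.reg rLeft = A) (hstarts : HasStarts S A s)
    (hr : Reported S A s) :
    Sweep S A 1 {0} ((s.setArr aNext 0 (n + n + 1)).setReg rRight 1) where
  ready := (hs.setArr (by omega) _ _).setReg (by omega) _
  left := by simp [hleft]
  cur := by simp
  chain := by
    rw [Ranked.spans_eq_empty (by intro i hi; simp only [Set.mem_Ioo] at hi; omega)]
    exact isChain_empty (by omega) (by simp)
  starts := by simpa [HasStarts] using hstarts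
  reported := hr.congr (by simp) rfl
  settled y hy _ hy1 := absurd hy1 hy.right_mem.1.not_gt

lemma Sweep.runs_countUp (hB : WordBound n B) (hA : A < n + n) (h : Sweep S A 1 {0} s) :
    Runs P B (countUp rRight rWidth sweepStep) s
      (((examineTime n + 10) * 3 + 60) * (n + n + 1) + 7 * (n + n) + 3) fun s' =>
      s'.arr aStart = s.arr aStart ∧ ∃ K, Sweep S A (n + n + 1) K s' := by
  have hsm := hB.small
  set E := examineTime n + 10 with hE
  refine (Stab.runs_countUp (L := n + n + 1) (by omega) (by omega) (fun b φ s' =>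
    s'.arr aStart = s.arr aStart ∧ 1 ≤ b ∧
      ∃ K, Sweep S A b K s' ∧ φ = (E * 2 + 60) * (n + n + 1 - b) + E * K.card) ?_ ?_
    (i := 1) (by omega) ⟨rfl, le_rfl, _, h, rfl⟩).mono ?_ ?_
  · rintro b φ s' ⟨-, -, K, h, -⟩
    exact ⟨h.cur, h.ready.width⟩
  · rintro b φ s' hb ⟨harr, hb1, K, h, rfl⟩
    obtain ⟨T, K', hT, hle⟩ := runs_sweepStep (P := P) hB hA hb1 (by omega) h
    refine ⟨T, hT.imp fun s'' ⟨hcur, harr', h'⟩ =>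
      ⟨hcur, _, ?_, harr'.trans harr, by omega, K', h', rfl⟩⟩
    rw [← hE] at hle
    rw [show n + n + 1 - b = n + n + 1 - (b + 1) + 1 by omega]
    linarith
  · rw [Finset.card_singleton, Nat.add_sub_cancel]
    nlinarith [Nat.zero_le (E * (n + n))]
  · exact fun s' ⟨_, harr, _, K, h, _⟩ => ⟨harr, K, h⟩

lemma Sweep.marked_of_flushing (h : Sweep S A (n + n + 1) K s)
    (hmark : s'.arr aMark = s.arr aMark) (hready : Ready S s')
    (hchain : IsChain (n + n + 1) ((ranked S).spans (Set.Ioo A (n + n + 1))) (s'.arr aNext) K)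
    {s'' : State} (hflush : Flushing S A (n + n + 1) 0 (n + n + 1) K s' s'')
    (hlimit : n + n + 1 ≤ s''.reg rBottom) {y : Box} (hy : (ranked S).IsTight y)
    (hyA : y.left = A) : Marked n s'' y := by
  have hright := hy.right_mem.2
  have htop := hy.top_mem.2
  have hD := hready.isIntervalFamily (Set.Ioo A (n + n + 1))
  rcases h.settled y hy hyA (by omega) with hm | hw
  · exact hflush.advances.marked y hyA (by rwa [Marked, hmark])
  obtain ⟨w, hwK, hwy, hyw⟩ := hchain.exists_window_ge hD hw (by omega)
  have hwlt := hchain.lt_of_mem hD hwK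
  refine hflush.covered w hwK w.zero_le (by omega) y hy hyA ⟨?_, ?_, ?_, ?_⟩ <;>
    simp only [chainWindow] <;> omega

lemma Sweep.runs_final_flush (hB : WordBound n B) (hA : A < n + n)
    (h : Sweep S A (n + n + 1) K s) :
    Runs P B (.assign rBottom (.const 0) ;; .assign rStop (.reg rWidth) ;; flush) s
      ((examineTime n + 10) * (n + n + 1) + 7) fun s' =>
      Ready S s' ∧ s'.reg rLeft = A ∧ s'.arr aStart = s.arr aStart ∧ Reported S A s' ∧
      ∀ y, (ranked S).IsTight y → y.left = A → Marked n s' y := by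
  have hsm := hB.small
  set s₁ := (s.setReg rBottom 0).setReg rStop (n + n + 1) with hs₁
  have hk : Keeps rBottom s s₁ := ((Keeps.refl _ _).setReg le_rfl _).setReg (by omega) _
  have hready := hk.prepared (by omega) h.ready
  have hreported := h.reported.congr (by rw [hk.arr]) hk.out
  have hcard : (K.filter fun u => 0 ≤ u ∧ u < n + n + 1).card ≤ n + n + 1 :=
    (Finset.card_le_card fun u hu => Finset.mem_range.mpr (Finset.mem_filter.mp hu).2.2).trans_eq
      (Finset.card_range _)
  refine (Val.runs_assign_seq (v := 0) (.const (by omega))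
    (Val.runs_assign_seq (v := n + n + 1) (.reg (by simpa using h.ready.width) (by omega))
      ((runs_flush hB hready (by simpa [hs₁] using h.left) (by simpa [hs₁] using h.cur)
        (by simp [hs₁]) (by simp [hs₁]) (by omega) le_rfl le_rfl (.inl h.chain.zero_mem)
        h.chain hreported).mono (Nat.add_le_add_right (Nat.mul_le_mul_left _ hcard) 3) ?_))).of_le
    (by simp only [Expr.cost]; omega)
  rintro s' ⟨hflush, hlimit⟩
  refine ⟨hflush.advances.ready (by omega) hready, ?_, hflush.advances.arr _ (by omega),
    hflush.advances.reported hreported, fun y hy hyA =>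
      h.marked_of_flushing (by rw [hk.arr]) hready h.chain hflush hlimit hy hyA⟩
  rw [hflush.advances.reg _ (by omega), hk.reg _ (by omega), h.left]

lemma runs_sweep (hB : WordBound n B) (hs : Ready S s) (hleft : s.reg rLeft = A)
    (hA : A < n + n) (hstarts : HasStarts S A s) (hr : Reported S A s) :
    Runs P B sweep s ((4 * examineTime n + 110) * (n + n + 1)) fun s' =>
      Ready S s' ∧ s'.reg rLeft = A ∧ s'.arr aStart = s.arr aStart ∧ Reported S A s' ∧
      ∀ y, (ranked S).IsTight y → y.left = A → Marked n s' y := by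
  have hsm := hB.small
  have hinit := sweep_initial hs hleft hstarts hr
  refine (Val.runs_store_seq (v := 0) (w := n + n + 1) (.const (by omega))
    (.reg hs.width (by omega)) (Val.runs_assign_seq (v := 1) (.const (by omega))
      (runs_seq ((hinit.runs_countUp hB hA).imp fun s₁ ⟨harr, K, h⟩ =>
        (h.runs_final_flush hB hA).imp fun s' ⟨hready, hl, harr', hr', hfound⟩ =>
          ⟨hready, hl, (harr'.trans harr).trans (by simp), hr', hfound⟩)))).of_le ?_
  simp only [Expr.cost]
  have hdistrib : (4 * examineTime n + 110) * (n + n + 1) =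
      ((examineTime n + 10) * 3 + 60) * (n + n + 1) + (examineTime n + 10) * (n + n + 1) +
        10 * (n + n + 1) := by ring
  omega

end Sweep

section MainLoop

variable {n : ℕ} (S : Fin n → Segment)

/-- Raise the start of the point in `rRight` to the lower end of the segment of the point in
`rPoint`, if this is the right endpoint of a segment that the sweep meets before the point in
`rRight`, and whose vertical range is below the top of the segment of that point. -/
def raiseStart : Program :=
  .cond (.and (.lt (.cell aX (.reg rPoint)) (.cell aX (.reg rRight)))
      (.and (.lt (.cell aHi (.reg rPoint)) (.cell aHi (.reg rRight)))
        (.lt (.cell aStart (.reg rRight)) (.cell aLo (.reg rPoint)))))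
    (.store aStart (.reg rRight) (.cell aLo (.reg rPoint))) .skip

/-- Update the table of starts for the left side in `rLeft`: the point that is now just to the
right of the left side may be the left endpoint of a segment. -/
def insertLeft : Program :=
  .assign rPoint (.cell aPartner (.cell aPX (.add (.reg rLeft) (.const 1)))) ;;
  .cond (.lt (.add (.reg rLeft) (.const 1)) (.cell aX (.reg rPoint)))
    (.assign rRight (.const 0) ;; countUp rRight rSize raiseStart) .skip

/-- Run the sweep for all left sides, from right to left. -/
def mainLoop : Program :=
  .assign rLeft (.reg rSize) ;;
  .loop (.lt (.const 0) (.reg rLeft))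
    (.assign rLeft (.sub (.reg rLeft) (.const 1)) ;; insertLeft ;; sweep)

/-- The table of starts has been updated from the left side `A + 1` to the left side `A`, for the
points below `i`; the state was `s` before this. -/
structure Raising (A i r : ℕ) (s s' : State) : Prop where
  ready : Ready S s'
  left : s'.reg rLeft = A
  point : s'.reg rPoint = r
  cur : s'.reg rRight = i
  marks : s'.arr aMark = s.arr aMark
  out : s'.out = s.out
  starts : ∀ e < n + n, IsStart
    ((ranked S).spans (Set.Ioo (if e < i then A else A + 1) ((ranked S).X e))) ((ranked S).hi e)
    (s'.arr aStart e)

/-- All boxes with left sides at least `A` have been found. -/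
structure Progress (A : ℕ) (s : State) : Prop where
  ready : Ready S s
  left : s.reg rLeft = A
  le : A ≤ n + n
  starts : HasStarts S A s
  reported : Reported S A s
  found : ∀ y, (ranked S).IsTight y → y.left = A → Marked n s y

/-- The time for one round of the main loop. -/
def roundTime (n : ℕ) : ℕ := (4 * examineTime n + 110) * (n + n + 1) + 40 * (n + n) + 40

variable {S} {m : ℕ} {P : Fin m → Point} {A B b f h i r : ℕ} {s s' : State}

lemma Ranked.isStart_of_succ {I : Ranked n} (hr : r < n + n) (hX : I.X (partner n r) = A + 1)
    (hA : A + 1 < I.X r) (hf : IsStart (I.spans (Set.Ioo (A + 1) b)) h f) :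
    IsStart (I.spans (Set.Ioo A b)) h
      (if I.X r < b ∧ I.hi r < h ∧ f < I.lo r then I.lo r else f) := by
  by_cases hb : I.X r < b
  · rw [spans_Ioo_of_succ hr hX hA hb]
    by_cases hh : I.hi r < h
    · convert hf.insert_of_lt (p := (I.lo r, I.hi r)) hh using 1
      split_ifs <;> omega
    · simpa [hh] using hf.insert_of_le (p := (I.lo r, I.hi r)) (not_lt.mp hh)
  · simpa [hb, spans_Ioo_of_succ_of_notMem hr hX fun h => hb h.2] using hf

lemma runs_raiseStart {Q : State → Prop} (hB : WordBound n B) (hs : Ready S s)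
    (hr : r < n + n) (hi : i < n + n) (hpoint : s.reg rPoint = r) (hcur : s.reg rRight = i)
    (hstart : s.arr aStart i ≤ B)
    (hpos : (ranked S).X r < (ranked S).X i ∧ (ranked S).hi r < (ranked S).hi i ∧
      s.arr aStart i < (ranked S).lo r → Q (s.setArr aStart i ((ranked S).lo r)))
    (hneg : ¬ ((ranked S).X r < (ranked S).X i ∧ (ranked S).hi r < (ranked S).hi i ∧
      s.arr aStart i < (ranked S).lo r) → Q s) :
    Runs P B raiseStart s 25 Q := by
  have hsm := hB.small
  have hXr := ((ranked S).x_spec r hr).2.1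
  have hXi := ((ranked S).x_spec i hi).2.1
  have hlr := Ranked.lo_lt_hi (I := ranked S) hr
  have hhr := Ranked.hi_le (I := ranked S) hr
  have hhi := Ranked.hi_le (I := ranked S) hi
  have hvr : Val B s (.reg rPoint) r := .reg hpoint (by omega)
  have hvi : Val B s (.reg rRight) i := .reg hcur (by omega)
  have hlo : Val B s (.cell aLo (.reg rPoint)) ((ranked S).lo r) :=
    hvr.cell (hs.lo r hr) (by omega)
  exact (((Tests.lt (hvr.cell (hs.x r hr) (by omega)) (hvi.cell (hs.x i hi) (by omega))).and
    ((Tests.lt (hvr.cell (hs.hi r hr) (by omega)) (hvi.cell (hs.hi i hi) (by omega))).and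
      (.lt (hvi.cell rfl hstart) hlo))).runs_cond (fun hc => hvi.runs_store hlo (hpos hc))
        fun hc => runs_skip (hneg hc)).of_le (by simp [Test.cost, Expr.cost])

lemma Raising.succ (h : Raising S A i r s s') (hr : r < n + n)
    (hX : (ranked S).X (partner n r) = A + 1) (hA : A + 1 < (ranked S).X r) (hi : i < n + n)
    {s'' : State} (hready : Ready S s'') (hreg : s''.reg = s'.reg)
    (hmarks : s''.arr aMark = s'.arr aMark) (hout : s''.out = s'.out)
    (hstart : s''.arr aStart i = if (ranked S).X r < (ranked S).X i ∧
      (ranked S).hi r < (ranked S).hi i ∧ s'.arr aStart i < (ranked S).lo r then (ranked S).lo r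
      else s'.arr aStart i)
    (hother : ∀ e ≠ i, s''.arr aStart e = s'.arr aStart e) :
    s''.reg rRight = i ∧ Raising S A (i + 1) r s (s''.setReg rRight (i + 1)) := by
  refine ⟨hreg ▸ h.cur, hready.setReg (by omega) _, by simp [hreg, h.left],
    by simp [hreg, h.point], by simp, hmarks.trans h.marks, hout.trans h.out, fun e he => ?_⟩
  rcases eq_or_ne e i with rfl | hne
  · have hold := h.starts e he
    simp only [lt_irrefl, if_false] at hold
    simpa [hstart] using Ranked.isStart_of_succ hr hX hA hold
  · have hiff : e < i + 1 ↔ e < i := by omega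
    rw [setReg_arr, hother e hne]
    simp only [hiff]
    exact h.starts e he

lemma Raising.runs_countUp (hB : WordBound n B) (h : Raising S A 0 r s s') (hr : r < n + n)
    (hX : (ranked S).X (partner n r) = A + 1) (hA : A + 1 < (ranked S).X r) :
    Runs P B (countUp rRight rSize raiseStart) s' (32 * (n + n) + 3)
      (Raising S A (n + n) r s) := by
  have hsm := hB.small
  refine runs_countUp_const (by omega) (by omega) 25 (fun i s' => Raising S A i r s s')
    (fun i s' h => ⟨h.cur, h.ready.size⟩) (fun i s' hi h => ?_) (Nat.zero_le _) h
  have hlt := (h.ready.isIntervalFamily _).lt_of_isStart (h.starts i hi)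
    ((Nat.zero_le _).trans_lt (Ranked.lo_lt_hi hi))
  have hhi := Ranked.hi_le (I := ranked S) hi
  refine runs_raiseStart hB h.ready hr hi h.point h.cur (by omega) (fun hc => ?_) fun hc => ?_
  · exact h.succ hr hX hA hi (h.ready.setArr (by omega) _ _) (by simp) (by simp) rfl
      (by simp [hc]) fun e he => by simp [he]
  · exact h.succ hr hX hA hi h.ready rfl rfl rfl (by simp [hc]) fun _ _ => rfl

lemma runs_insertLeft (hB : WordBound n B) (hs : Ready S s) (hleft : s.reg rLeft = A)
    (hA : A < n + n) (hstarts : HasStarts S (A + 1) s) :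
    Runs P B insertLeft s (40 * (n + n) + 30) fun s' => Ready S s' ∧ s'.reg rLeft = A ∧
      s'.arr aMark = s.arr aMark ∧ s'.out = s.out ∧ HasStarts S A s' := by
  have hsm := hB.small
  obtain ⟨ha, hXa⟩ := (ranked S).px_spec (A + 1) (by omega) hA
  have hpx := hs.px (A + 1) (by omega) hA
  set a := (ranked S).PX (A + 1)
  have hr := partner_lt ha
  have hX : (ranked S).X (partner n (partner n a)) = A + 1 := by rw [partner_partner ha, hXa]
  have hXr := ((ranked S).x_spec _ hr).2.1
  set s₁ := s.setReg rPoint (partner n a) with hs₁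
  have hready : Ready S s₁ := hs.setReg (by omega) _
  have hnext : Val B s₁ (.add (.reg rLeft) (.const 1)) (A + 1) :=
    (Val.reg (by simp [hs₁, hleft]) (by omega)).add (.const (by omega)) (by omega)
  have hpoint : Val B s₁ (.cell aX (.reg rPoint)) ((ranked S).X (partner n a)) :=
    (Val.reg (by simp [hs₁]) (by omega)).cell (hready.x _ hr) (by omega)
  refine (Val.runs_assign_seq ((((Val.reg hleft (by omega)).add (.const (by omega))
    (by omega)).cell hpx (by omega)).cell (hs.partner a ha) (by omega))
    (((Tests.lt hnext hpoint).runs_cond (T₂ := 1)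
      (fun hlt => Val.runs_assign_seq (v := 0) (.const (by omega))
        ((Raising.runs_countUp (s := s) hB ⟨hready.setReg (by omega) _, ?_, ?_, ?_, rfl, rfl, ?_⟩
          hr hX hlt).imp ?_)) fun hle => runs_skip ?_))).of_le ?_
  · simp [hs₁, hleft]
  · simp [hs₁]
  · simp
  · simpa [hs₁, HasStarts] using hstarts
  · exact fun s' h => ⟨h.ready, h.left, h.marks, h.out, fun e he => by
      simpa [he] using h.starts e he⟩
  · refine ⟨hready, by simp [hs₁, hleft], rfl, rfl, fun e he => ?_⟩
    rw [Ranked.spans_Ioo_of_succ_of_notMem hr hX fun h => hle h.1]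
    exact hstarts e he
  · simp only [Test.cost, Expr.cost]
    omega

lemma Reported.of_succ (hr : Reported S (A + 1) s)
    (hfound : ∀ y, (ranked S).IsTight y → y.left = A + 1 → Marked n s y) : Reported S A s := by
  obtain ⟨K, hout, hnodup, hK⟩ := hr.list
  refine ⟨⟨K, hout, hnodup, fun y => ?_⟩, fun i => ?_⟩
  · have hmark := hr.marks (y.right * (n + n + 1) + y.bottom)
    have hnot : ¬ (y.left = A ∧ Marked n s y) := fun ⟨_, hm⟩ => by
      rw [Marked] at hm
      omega
    rw [hK, or_iff_left hnot]
    exact and_congr_right fun hy => ⟨fun h => by omega, fun h =>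
      (Nat.eq_or_lt_of_le h).symm.imp id fun h => ⟨h.symm, hfound y hy.1 h.symm⟩⟩
  · have := hr.marks i
    omega

lemma Progress.reportsAll (h : Progress S 0 s) (hn : 1 ≤ n) : ReportsAll S s.out := by
  obtain ⟨K, hout, hnodup, hK⟩ := h.reported.list
  rw [hout]
  refine reportsAll_of_isRealized hn hnodup fun y => (hK y).trans (and_iff_left_of_imp fun hy => ?_)
  exact (Nat.eq_zero_or_pos y.left).symm.imp id fun h0 => ⟨h0, h.found y hy.1 h0⟩

lemma Progress.runs_round (hB : WordBound n B) (h : Progress S (A + 1) s) :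
    Runs P B (.assign rLeft (.sub (.reg rLeft) (.const 1)) ;; insertLeft ;; sweep) s
      (roundTime n - 6) (Progress S A) := by
  have hsm := hB.small
  have hA : A < n + n := h.le
  refine (Val.runs_assign_seq (v := A) ((Val.reg h.left (by omega)).sub (.const (by omega)))
    (runs_seq ((runs_insertLeft (A := A) hB (h.ready.setReg (by omega) _) (by simp) hA
      h.starts).imp fun s' ⟨hready, hleft, hmarks, hout, hstarts⟩ =>
        (runs_sweep hB hready hleft hA hstarts
          ((h.reported.of_succ h.found).congr hmarks hout)).imp
            fun s'' ⟨hready', hleft', harr, hr, hfound⟩ =>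
              ⟨hready', hleft', hA.le, by rwa [HasStarts, harr], hr, hfound⟩))).of_le ?_
  simp only [Expr.cost, roundTime]
  omega

lemma progress_initial (hs : Ready S s) (hleft : s.reg rLeft = n + n)
    (hstart : ∀ i, s.arr aStart i = 0) (hmark : ∀ i, s.arr aMark i = 0) (hout : s.out = []) :
    Progress S (n + n) s where
  ready := hs
  left := hleft
  le := le_rfl
  starts e he := by
    have hXe := ((ranked S).x_spec e he).2.1
    rw [Ranked.spans_eq_empty (by intro i hi; simp only [Set.mem_Ioo] at hi; omega), hstart]
    exact ⟨by simp, .inl rfl⟩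
  reported := ⟨⟨[], hout, List.nodup_nil, fun y => by
    simp only [List.not_mem_nil, Marked, hmark, false_iff]
    exact fun hy => hy.2.elim hy.1.1.left_lt.not_gt (by simp)⟩, fun i => .inl (hmark i)⟩
  found y hy hyl := absurd hyl hy.left_lt.ne

lemma runs_mainLoop (hB : WordBound n B) (hs : Ready S s) (hstart : ∀ i, s.arr aStart i = 0)
    (hmark : ∀ i, s.arr aMark i = 0) (hout : s.out = []) :
    Runs P B mainLoop s (roundTime n * (n + n) + 5) fun s' => ReportsAll S s'.out := by
  have hsm := hB.small
  refine (Val.runs_assign_seq (v := n + n) (.reg hs.size (by omega))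
    (runs_loop (φ := roundTime n * (n + n) + 3) (fun φ s' => ∃ A, Progress S A s' ∧
      φ = roundTime n * A + 3) (by simp [Test.cost]) ?_ ⟨n + n, progress_initial
        (hs.setReg le_rfl _) (by simp) hstart hmark hout, rfl⟩)).of_le
    (by simp only [Expr.cost]; omega)
  rintro φ s' ⟨A, h, rfl⟩
  have hA := h.le
  refine ⟨0 < A, .lt (.const (by omega)) (.reg h.left (by omega)), by simp [Test.cost, Expr.cost],
    fun hn => ?_, fun hpos => ?_⟩
  · obtain rfl : A = 0 := by omega
    exact h.reportsAll hB.pos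
  · obtain ⟨A, rfl⟩ := Nat.exists_eq_add_of_lt hpos
    rw [Nat.zero_add] at h
    refine ⟨_, (h.runs_round hB).imp fun s'' h' => ⟨_, ⟨A, h', rfl⟩, ?_⟩⟩
    have hround : 6 ≤ roundTime n := by
      rw [roundTime]
      omega
    rw [Nat.zero_add, Nat.mul_succ]
    simp only [Test.cost, Expr.cost]
    omega

end MainLoop

section Preprocessing

variable {n : ℕ} {S : Fin n → Segment} {B k l T : ℕ} {s s' : State}

/-- The tables with numbers below `k` have been computed, nothing has been stored in the arrays
from number `l` on, and nothing has been reported. -/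
structure Filling (S : Fin n → Segment) (k l : ℕ) (s : State) : Prop extends Prepared S k s where
  blank : ∀ a, l ≤ a → ∀ i, s.arr a i = 0
  out : s.out = []

lemma Filling.setReg (h : Filling S k l s) {x : ℕ} (hx : rLeft ≤ x) (v : ℕ) :
    Filling S k l (s.setReg x v) :=
  ⟨h.toPrepared.setReg hx v, h.blank, h.out⟩

lemma Filling.setArr (h : Filling S k l s) {a : ℕ} (hk : k ≤ a) (hl : a < l) (i v : ℕ) :
    Filling S k l (s.setArr a i v) :=
  ⟨h.toPrepared.setArr hk i v,
    fun b hb => by simpa [show b ≠ a by omega] using h.blank b hb, h.out⟩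

lemma Filling.start (h : Filling S k k s) : Filling S k (k + 1) s :=
  ⟨h.toPrepared, fun a ha => h.blank a (by omega), h.out⟩

lemma Filling.finish (h : Filling S k (k + 1) s) (ht : IsTable S k (s.arr k)) :
    Filling S (k + 1) (k + 1) s :=
  ⟨⟨h.segments, h.size, h.width, fun _ ha =>
    (Nat.lt_succ_iff_lt_or_eq.mp ha).elim (h.tables _) fun heq => heq ▸ ht⟩, h.blank, h.out⟩

lemma Keeps.filling {j : ℕ} (h : Keeps j s s') (hj : rLeft ≤ j) (hs : Filling S k l s) :
    Filling S k l s' :=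
  ⟨h.prepared hj hs.toPrepared, fun a => h.arr ▸ hs.blank a, h.out.trans hs.out⟩

/-- The states `s` and `s'` agree, up to the registers from `rOther` on and the value `w` in cell
`i` of array `a`. -/
def Stores (a i w : ℕ) (s s' : State) : Prop := ∃ s₁, Keeps rOther s s₁ ∧ s' = s₁.setArr a i w

lemma Val.runs_stores {m : ℕ} {P : Fin m → Point} {a i w : ℕ} {e f : Expr} (he : Val B s e i)
    (hf : Val B s f w) : Runs P B (.store a e f) s (e.cost + f.cost + 1) (Stores a i w s) :=
  he.runs_store hf ⟨s, .refl _ _, rfl⟩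

/-- Execute `c` with the register `rKey` running through the numbers of the endpoints. -/
def forKeys (c : Program) : Program := .assign rKey (.const 0) ;; countUp rKey rSize c

lemma runs_forKeys (hB : WordBound n B) {c : Program} {f w : ℕ → ℕ}
    (hc : ∀ i < n + n, ∀ s, Filling S k (k + 1) s → s.reg rKey = i →
      Runs (endpoint S) B c s T (Stores k (f i) (w i) s))
    (hf : ∀ i < n + n, ∀ j < n + n, f i = f j → w i = w j) (hs : Filling S k k s) :
    Runs (endpoint S) B (forKeys c) s ((T + 7) * (n + n) + 5) fun s' =>
      Filling S k (k + 1) s' ∧ ∀ i < n + n, s'.arr k (f i) = w i := by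
  have hsm := hB.small
  refine ((Val.const (Nat.zero_le B)).runs_assign_seq ((runs_countUp_const (L := n + n) (i := 0)
    (by omega) (by omega) T (fun i s' => Filling S k (k + 1) s' ∧ s'.reg rKey = i ∧
      ∀ j < i, s'.arr k (f j) = w j) (fun i s' h => ⟨h.2.1, h.1.size⟩) ?_ (Nat.zero_le _)
    ⟨hs.start.setReg le_rfl _, by simp, by simp⟩).imp fun s' h => ⟨h.1, h.2.2⟩)).of_le
    (by simp only [Expr.cost, Nat.sub_zero]; omega)
  rintro i s₁ hi ⟨hfill, hkey, hdone⟩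
  refine (hc i hi s₁ hfill hkey).imp ?_
  rintro _ ⟨s₂, hkeep, rfl⟩
  refine ⟨(hkeep.reg _ (by omega)).trans hkey,
    ((hkeep.filling (by omega) hfill).setArr le_rfl (by omega) _ _).setReg le_rfl _, by simp,
    fun j hj => ?_⟩
  simp only [setReg_arr, setArr_arr, if_true, Function.update_apply]
  split_ifs with hji
  · exact hf i hi j (by omega) hji.symm
  · rw [hkeep.arr, hdone j (by grind)]

lemma runs_forKeys_table (hB : WordBound n B) {c : Program} {f w : ℕ → ℕ}
    (hc : ∀ i < n + n, ∀ s, Filling S k (k + 1) s → s.reg rKey = i →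
      Runs (endpoint S) B c s T (Stores k (f i) (w i) s))
    (hf : ∀ i < n + n, ∀ j < n + n, f i = f j → w i = w j)
    (ht : ∀ t : ℕ → ℕ, (∀ i < n + n, t (f i) = w i) → IsTable S k t) (hs : Filling S k k s) :
    Runs (endpoint S) B (forKeys c) s ((T + 7) * (n + n) + 5) (Filling S (k + 1) (k + 1)) :=
  (runs_forKeys hB hc hf hs).imp fun _ h => h.1.finish (ht _ h.2)

end Preprocessing

section Counting

variable {m n : ℕ} {P : Fin m → Point} {S : Fin n → Segment} {B k N : ℕ} {s : State} {p : Test}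

/-- Count the values of the register `rOther`, below that of `rSize`, for which the test `p`
holds. -/
def countIf (p : Test) : Program :=
  .assign rCount (.const 0) ;; .assign rOther (.const 0) ;;
  countUp rOther rSize (.cond p (.assign rCount (.add (.reg rCount) (.const 1))) .skip)

lemma runs_countIf {V : ℕ → Prop} [DecidablePred V] (hN : N + 1 ≤ B) (hsize : s.reg rSize = N)
    (hp : ∀ s', s'.reg rKey = s.reg rKey → s'.reg rOther < N → Tests P B s' p (V (s'.reg rOther))) :
    Runs P B (countIf p) s ((p.cost + 11) * N + 7) fun s' =>
      Keeps rOther s s' ∧ s'.reg rCount = Nat.count V N := by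
  refine ((Val.const (Nat.zero_le B)).runs_assign_seq ((Val.const (Nat.zero_le B)).runs_assign_seq
    ((runs_countUp_const (L := N) (i := 0) (by omega) (by omega) (p.cost + 4) (fun j s' =>
      Keeps rOther s s' ∧ s'.reg rOther = j ∧ s'.reg rCount = Nat.count V j)
      (fun j s' h => ⟨h.2.1, (h.1.reg _ (by omega)).trans hsize⟩) ?_ (Nat.zero_le _)
      ⟨((Keeps.refl _ s).setReg (by omega) _).setReg le_rfl _, by simp, by simp⟩).imp
      fun s' h => ⟨h.1, h.2.2⟩))).of_le (by simp only [Expr.cost, Nat.sub_zero]; linarith)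
  rintro j s' hj ⟨hkeep, rfl, hcount⟩
  have hle : Nat.count V (s'.reg rOther) ≤ _ := Nat.count_le _
  refine ((hp s' (hkeep.reg _ (by omega)) hj).runs_cond (T₁ := 4) (T₂ := 1) (fun hV =>
    ((Val.reg hcount (by omega)).add (.const (by omega)) (by omega)).runs_assign ⟨by simp, ?_⟩)
    fun hV => runs_skip ⟨rfl, ?_⟩).of_le (by omega)
  · exact ⟨(hkeep.setReg (by omega) _).setReg le_rfl _, by simp, by simp [Nat.count_succ, hV]⟩
  · exact ⟨hkeep.setReg le_rfl _, by simp, by simp [Nat.count_succ, hV, hcount]⟩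

/-- Fill table `k` with the numbers of endpoints `rOther` for which the test `p` holds. -/
def countPass (k : ℕ) (p : Test) : Program :=
  forKeys (countIf p ;; .store k (.reg rKey) (.reg rCount))

lemma runs_countPass (hB : WordBound n B) (V : ℕ → ℕ → Prop) [∀ i, DecidablePred (V i)]
    (hp : ∀ s i j, i < n + n → j < n + n → Val B s (.reg rKey) i → Val B s (.reg rOther) j →
      Tests (endpoint S) B s p (V i j))
    (ht : ∀ t : ℕ → ℕ, (∀ i < n + n, t i = Nat.count (V i) (n + n)) → IsTable S k t)
    (hs : Filling S k k s) :
    Runs (endpoint S) B (countPass k p) s (((p.cost + 11) * (n + n) + 17) * (n + n) + 5)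
      (Filling S (k + 1) (k + 1)) := by
  have hsm := hB.small
  refine runs_forKeys_table (T := (p.cost + 11) * (n + n) + 10) hB (f := id) (fun i hi s₁ h hkey =>
    ?_) (fun i _ j _ => by rintro rfl; rfl) ht hs
  refine runs_seq (T₂ := 3) ((runs_countIf (V := V i) (by omega) h.size fun s' hs' hj =>
    hp s' i _ hi hj (.reg (hs'.trans hkey) (by omega)) (.reg rfl (by omega))).imp ?_)
  rintro s₂ ⟨hkeep, hcount⟩
  exact ((Val.reg ((hkeep.reg _ (by omega)).trans hkey) (by omega)).runs_store
    (.reg hcount ((Nat.count_le _).trans (by omega)))) ⟨s₂, hkeep, rfl⟩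

/-- The test `lt` compares the coordinates `v` of two endpoints, and the tables for this coordinate
are those with numbers `k` to `k + 3`. -/
structure IsAxis (S : Fin n → Segment) (B k : ℕ) (v : ℕ → ℝ) (lt : Expr → Expr → Test) :
    Prop where
  cost : ∀ e f, (lt e f).cost = e.cost + f.cost + 1
  tests : ∀ {s : State} {e f : Expr} {i j : ℕ}, i < n + n → j < n + n → Val B s e i →
    Val B s f j → Tests (endpoint S) B s (lt e f) (v i < v j)
  table_lt : ∀ t, IsTable S k t ↔ ∀ e < n + n, t e = countLt v (n + n) e
  table_le : ∀ t, IsTable S (k + 1) t ↔ ∀ e < n + n, t e = countLe v (n + n) e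
  table_rank : ∀ t, IsTable S (k + 2) t ↔ ∀ e < n + n, t e = rank v (n + n) e
  table_unrank : ∀ t, IsTable S (k + 3) t ↔
    ∀ r, 1 ≤ r → r ≤ n + n → t r = unrank v (n + n) r

lemma isAxis_x : IsAxis S B aXLt (xkey S) .xlt where
  cost _ _ := rfl
  tests {s e f i j} hi hj he hf := by
    simpa [xkey, pos, hi, hj] using Tests.xlt (P := endpoint S) (i := ⟨i, hi⟩) (j := ⟨j, hj⟩) he hf
  table_lt _ := Iff.rfl
  table_le _ := Iff.rfl
  table_rank _ := Iff.rfl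
  table_unrank _ := Iff.rfl

lemma isAxis_y : IsAxis S B aYLt (ykey S) .ylt where
  cost _ _ := rfl
  tests {s e f i j} hi hj he hf := by
    simpa [ykey, pos, hi, hj] using Tests.ylt (P := endpoint S) (i := ⟨i, hi⟩) (j := ⟨j, hj⟩) he hf
  table_lt _ := Iff.rfl
  table_le _ := Iff.rfl
  table_rank _ := Iff.rfl
  table_unrank _ := Iff.rfl

/-- The test for `rOther` to come no later than `rKey` in the order by the coordinate that `lt`
compares, in which ties are broken by the numbers of the endpoints. -/
def notAfter (lt : Expr → Expr → Test) : Test :=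
  .or (lt (.reg rOther) (.reg rKey))
    (.and (.not (lt (.reg rKey) (.reg rOther))) (.not (.lt (.reg rKey) (.reg rOther))))

/-- Fill table `k + 1` with the inverse of table `k`. -/
def invertPass (k : ℕ) : Program := forKeys (.store (k + 1) (.cell k (.reg rKey)) (.reg rKey))

/-- Fill the tables `k` to `k + 3` for the coordinate that `lt` compares. -/
def axisPasses (k : ℕ) (lt : Expr → Expr → Test) : Program :=
  countPass k (lt (.reg rOther) (.reg rKey)) ;;
  countPass (k + 1) (.not (lt (.reg rKey) (.reg rOther))) ;;
  countPass (k + 2) (notAfter lt) ;;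
  invertPass (k + 2)

namespace IsAxis

variable {v : ℕ → ℝ} {lt : Expr → Expr → Test} (hv : IsAxis S B k v lt)
include hv

lemma tests_notAfter {i j : ℕ} (hi : i < n + n) (hj : j < n + n) (hkey : Val B s (.reg rKey) i)
    (hother : Val B s (.reg rOther) j) :
    Tests (endpoint S) B s (notAfter lt) (toLex (v j, j) ≤ toLex (v i, i)) := by
  have h := (hv.tests hj hi hother hkey).or ((hv.tests hi hj hkey hother).not.and
    (Tests.lt hkey hother).not)
  refine ⟨h.1, h.2.trans ?_⟩
  rw [Prod.Lex.toLex_le_toLex]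
  grind

lemma runs_invertPass (hB : WordBound n B) (hs : Filling S (k + 3) (k + 3) s) :
    Runs (endpoint S) B (invertPass (k + 2)) s (11 * (n + n) + 5) (Filling S (k + 4) (k + 4)) := by
  have hsm := hB.small
  refine runs_forKeys_table (T := 4) hB (f := rank v (n + n)) (w := id) (fun i hi s₁ h hkey => ?_)
    (fun i hi j hj => rank_inj hi hj) (fun t ht => ?_) hs
  · have hkey' : Val B s₁ (.reg rKey) i := .reg hkey (by omega)
    exact (hkey'.cell ((hv.table_rank _).mp (h.tables (k + 2) (by omega)) i hi)
      (rank_le.trans (by omega))).runs_stores hkey'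
  · refine (hv.table_unrank t).mpr fun r h1 h2 => ?_
    obtain ⟨hlt, hr⟩ := unrank_spec (v := v) h1 h2
    simpa [hr] using ht _ hlt

lemma runs_axisPasses (hB : WordBound n B) (hs : Filling S k k s) :
    Runs (endpoint S) B (axisPasses k lt) s (53 * ((n + n) * (n + n)) + 62 * (n + n) + 20)
      (Filling S (k + 4) (k + 4)) := by
  refine (runs_seq ((runs_countPass hB (fun i j => v j < v i)
    (fun s i j hi hj hkey hother => hv.tests hj hi hother hkey)
    (fun t ht => (hv.table_lt t).mpr ht) hs).imp fun s₁ h₁ => runs_seq ((runs_countPass hB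
      (fun i j => v j ≤ v i) (fun s i j hi hj hkey hother => ?_)
      (fun t ht => (hv.table_le t).mpr ht) h₁).imp fun s₂ h₂ => runs_seq ((runs_countPass hB
        (fun i j => toLex (v j, j) ≤ toLex (v i, i))
        (fun s i j hi hj hkey hother => hv.tests_notAfter hi hj hkey hother)
        (fun t ht => (hv.table_rank t).mpr ht) h₂).imp fun s₃ h₃ =>
          hv.runs_invertPass hB h₃)))).of_le ?_
  · simpa only [not_lt] using (hv.tests hi hj hkey hother).not
  · simp only [notAfter, Test.cost, hv.cost, Expr.cost]
    ring_nf
    omega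

end IsAxis

end Counting

section Pairing

variable {n : ℕ} {S : Fin n → Segment} {B k : ℕ} {s : State}

/-- Fill table `k` with the values of `e` where the test `p` holds, and those of `f` elsewhere. -/
def selectPass (k : ℕ) (p : Test) (e f : Expr) : Program :=
  forKeys (.cond p (.store k (.reg rKey) e) (.store k (.reg rKey) f))

lemma runs_selectPass (hB : WordBound n B) {p : Test} {e f : Expr} (R : ℕ → Prop)
    [DecidablePred R] (u w : ℕ → ℕ)
    (hp : ∀ i < n + n, ∀ s, Filling S k (k + 1) s → Val B s (.reg rKey) i →
      Tests (endpoint S) B s p (R i) ∧ (R i → Val B s e (u i)) ∧ (¬ R i → Val B s f (w i)))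
    (ht : ∀ t : ℕ → ℕ, (∀ i < n + n, t i = if R i then u i else w i) → IsTable S k t)
    (hs : Filling S k k s) :
    Runs (endpoint S) B (selectPass k p e f) s
      ((p.cost + (max e.cost f.cost + 2) + 7) * (n + n) + 5) (Filling S (k + 1) (k + 1)) := by
  have hsm := hB.small
  refine runs_forKeys_table hB (f := id) (fun i hi s₁ h hkey => ?_)
    (fun i _ j _ => by rintro rfl; rfl) ht hs
  have hkey' : Val B s₁ (.reg rKey) i := .reg hkey (by omega)
  obtain ⟨hp, he, hf⟩ := hp i hi s₁ h hkey'
  refine (hp.runs_cond (fun hR => ?_) fun hR => ?_).of_le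
    (T := p.cost + max (1 + e.cost + 1) (1 + f.cost + 1)) (by omega)
  · rw [if_pos hR]
    exact hkey'.runs_stores (he hR)
  · rw [if_neg hR]
    exact hkey'.runs_stores (hf hR)

/-- Fill the table of partners. -/
def partnerPass : Program :=
  selectPass aPartner (.lt (.reg rKey) (.reg rSegments)) (.add (.reg rKey) (.reg rSegments))
    (.sub (.reg rKey) (.reg rSegments))

lemma runs_partnerPass (hB : WordBound n B) (hs : Filling S aPartner aPartner s) :
    Runs (endpoint S) B partnerPass s (15 * (n + n) + 5) (Filling S aLo aLo) := by
  have hsm := hB.small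
  refine runs_selectPass hB (· < n) (· + n) (· - n) (fun i hi s₁ h hkey => ?_)
    (fun t ht => ht) hs
  have hseg : Val B s₁ (.reg rSegments) n := .reg h.segments (by omega)
  exact ⟨.lt hkey hseg, fun _ => hkey.add hseg (by omega), fun _ => hkey.sub hseg⟩

/-- The `y`-rank of the endpoint `rKey`. -/
def keyRank : Expr := .cell aY (.reg rKey)

/-- The `y`-rank of the partner of the endpoint `rKey`. -/
def partnerRank : Expr := .cell aY (.cell aPartner (.reg rKey))

lemma Prepared.val_keyRank (h : Prepared S k s) (hk : aY < k) (hB : WordBound n B) {i : ℕ}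
    (hi : i < n + n) (hkey : Val B s (.reg rKey) i) : Val B s keyRank ((ranked S).Y i) := by
  have := ((ranked S).y_spec i hi).2.1
  have := hB.small
  exact hkey.cell (h.tables aY hk i hi) (by omega)

lemma Prepared.val_partnerRank (h : Prepared S k s) (hk : aPartner < k) (hB : WordBound n B)
    {i : ℕ} (hi : i < n + n) (hkey : Val B s (.reg rKey) i) :
    Val B s partnerRank ((ranked S).Y (partner n i)) := by
  have hp := partner_lt hi
  have := ((ranked S).y_spec _ hp).2.1
  have := hB.small
  exact (hkey.cell (h.tables aPartner hk i hi) (by omega)).cell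
    (h.tables aY (by omega) _ hp) (by omega)

/-- Fill the tables of the lower and the higher ranks of the segments. -/
def spanPasses : Program :=
  selectPass aLo (.lt keyRank partnerRank) keyRank partnerRank ;;
  selectPass aHi (.lt keyRank partnerRank) partnerRank keyRank

lemma runs_spanPasses (hB : WordBound n B) (hs : Filling S aLo aLo s) :
    Runs (endpoint S) B spanPasses s (36 * (n + n) + 10) (Filling S aUp aUp) := by
  have hkey {k i : ℕ} {s : State} (hi : i < n + n) (hk : aPartner < k) (h : Filling S k (k + 1) s)
      (hkey : Val B s (.reg rKey) i) := h.val_keyRank (by omega) hB hi hkey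
  have hpartner {k i : ℕ} {s : State} (hi : i < n + n) (hk : aPartner < k)
      (h : Filling S k (k + 1) s) (hkey : Val B s (.reg rKey) i) :=
    h.val_partnerRank hk hB hi hkey
  refine (runs_seq ((runs_selectPass (k := aLo) hB
    (fun i => (ranked S).Y i < (ranked S).Y (partner n i)) _ _
    (fun i hi s h hi' => ⟨.lt (hkey hi (by decide) h hi') (hpartner hi (by decide) h hi'),
      fun _ => hkey hi (by decide) h hi', fun _ => hpartner hi (by decide) h hi'⟩)
    (fun t ht e he => (ht e he).trans (min_def_lt _ _).symm) hs).imp fun s₁ h₁ =>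
      runs_selectPass (k := aHi) hB (fun i => (ranked S).Y i < (ranked S).Y (partner n i)) _ _
      (fun i hi s h hi' => ⟨.lt (hkey hi (by decide) h hi') (hpartner hi (by decide) h hi'),
        fun _ => hpartner hi (by decide) h hi', fun _ => hkey hi (by decide) h hi'⟩)
      (fun t ht e he => (ht e he).trans (max_def_lt _ _).symm) h₁)).of_le ?_
  norm_num [Test.cost, keyRank, partnerRank, Expr.cost]
  omega

/-- Fill the table of upper ends, with the rank of its partner as the entry at the rank of an
endpoint. -/
def upPass : Program := forKeys (.store aUp keyRank partnerRank) ;;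
  .store aUp (.reg rWidth) (.reg rWidth)

lemma Ranked.isUpper_of_partner (I : Ranked n) {t : ℕ → ℕ}
    (ht : ∀ e < n + n, t (I.Y e) = I.Y (partner n e)) :
    I.IsUpper (Function.update t (n + n + 1) (n + n + 1)) where
  last := by simp
  lo e he := by
    have hlt := lo_lt_hi (I := I) he
    have hle := hi_le (I := I) he
    rw [Function.update_of_ne (by omega), lo, hi]
    have := ht _ (partner_lt he)
    rw [partner_partner he] at this
    rcases le_total (I.Y e) (I.Y (partner n e)) with h | h
    · rw [min_eq_left h, max_eq_right h, ht e he]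
    · rw [min_eq_right h, max_eq_left h, this]

lemma runs_upPass (hB : WordBound n B) (hs : Filling S aUp aUp s) :
    Runs (endpoint S) B upPass s (13 * (n + n) + 8) (Filling S aCount aCount) := by
  have hsm := hB.small
  refine runs_seq (T₂ := 3) ((runs_forKeys (T := 6) (f := (ranked S).Y)
    (w := fun e => (ranked S).Y (partner n e)) hB (fun i hi s₁ h hkey => ?_)
    (fun i hi j hj hij => by rw [(ranked S).y_inj hi hj hij]) hs).imp fun s₁ ⟨h, ht⟩ => ?_)
  · have hkey' : Val B s₁ (.reg rKey) i := .reg hkey (by omega)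
    exact (h.val_keyRank (by omega) hB hi hkey').runs_stores
      (h.val_partnerRank (by omega) hB hi hkey')
  · have hw : Val B s₁ (.reg rWidth) (n + n + 1) := .reg h.width (by omega)
    refine hw.runs_store hw ((h.setArr le_rfl (by omega) _ _).finish ?_)
    change (ranked S).IsUpper _
    simpa using (ranked S).isUpper_of_partner ht

end Pairing

section PrefixCountTable

variable {n : ℕ} {S : Fin n → Segment} {B : ℕ} {s : State}

/-- Compute the prefix count that comes one row after the one with index `rKey`. -/
def prefixStep : Program :=
  .cond (.lt (.sub (.reg rKey) (.mul (.div (.reg rKey) (.reg rWidth)) (.reg rWidth)))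
      (.cell aY (.cell aPX (.add (.div (.reg rKey) (.reg rWidth)) (.const 1)))))
    (.store aCount (.add (.reg rKey) (.reg rWidth)) (.cell aCount (.reg rKey)))
    (.store aCount (.add (.reg rKey) (.reg rWidth)) (.add (.cell aCount (.reg rKey)) (.const 1)))

/-- Fill the table of prefix counts, with every row computed from the row before it. -/
def prefixPass : Program :=
  .assign rKey (.const 0) ;;
  .assign rOther (.mul (.reg rSize) (.reg rWidth)) ;;
  countUp rKey rOther prefixStep

/-- The invariant of `prefixPass`: the table has been filled up to row `i / (2n + 1)` and
column `i % (2n + 1)`, and the first row is complete from the start. -/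
structure FillingPrefix (S : Fin n → Segment) (i : ℕ) (s : State) : Prop
    extends Filling S aCount aStart s where
  key : s.reg rKey = i
  limit : s.reg rOther = (n + n) * (n + n + 1)
  done : ∀ j < i + (n + n + 1),
    s.arr aCount j = (ranked S).prefixCount (j / (n + n + 1)) (j % (n + n + 1))

lemma FillingPrefix.next {i : ℕ} (h : FillingPrefix S i s) {v : ℕ}
    (hv : v = (ranked S).prefixCount (i / (n + n + 1) + 1) (i % (n + n + 1))) :
    FillingPrefix S (i + 1) ((s.setArr aCount (i + (n + n + 1)) v).setReg rKey (i + 1)) where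
  toFilling := (h.setArr le_rfl (by omega) _ _).setReg le_rfl _
  key := by simp
  limit := by simp [h.limit]
  done j hj := by
    simp only [setReg_arr, setArr_arr, if_true, Function.update_apply]
    split_ifs with hji
    · rw [hji, Nat.add_div_right _ (by omega), Nat.add_mod_right, hv]
    · exact h.done j (by omega)

lemma FillingPrefix.runs_step (hB : WordBound n B) {i : ℕ} (hi : i < (n + n) * (n + n + 1))
    (h : FillingPrefix S i s) :
    Runs (endpoint S) B prefixStep s 23 fun s' =>
      s'.reg rKey = i ∧ FillingPrefix S (i + 1) (s'.setReg rKey (i + 1)) := by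
  have hsm := hB.small
  have hsq := hB.square
  have hiB : i + (n + n + 1) ≤ B := by nlinarith
  have hrow : i / (n + n + 1) + 1 ≤ n + n := Nat.div_lt_of_lt_mul (by rwa [mul_comm])
  have hkey : Val B s (.reg rKey) i := .reg h.key (by omega)
  have hw : Val B s (.reg rWidth) (n + n + 1) := .reg h.width (by omega)
  have hone : Val B s (.const 1) 1 := .const (by omega)
  have hdiv := hkey.div hw
  have hcol := hkey.sub (hdiv.mul hw ((Nat.div_mul_le_self i (n + n + 1)).trans (by omega)))
  rw [mul_comm, ← Nat.mod_eq_sub] at hcol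
  have hpx := (ranked S).px_spec (i / (n + n + 1) + 1) (Nat.succ_pos _) hrow
  have hy := ((ranked S).y_spec _ hpx.1).2.1
  have hrank := ((hdiv.add hone (by omega)).cell (h.tables aPX (by decide) _ (Nat.succ_pos _) hrow)
    (hpx.1.le.trans (by omega))).cell (h.tables aY (by decide) _ hpx.1) (hy.trans (by omega))
  have hle := (ranked S).prefixCount_le (i / (n + n + 1)) (i % (n + n + 1))
  have hcell := hkey.cell (h.done i (by omega)) (by omega)
  have hsucc := (ranked S).prefixCount_succ hrow (i % (n + n + 1))
  refine ((Tests.lt hcol hrank).runs_cond (fun hlt => ((hkey.add hw hiB).runs_store hcell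
    ⟨h.key, h.next ?_⟩)) fun hge => ((hkey.add hw hiB).runs_store
      (hcell.add hone (by omega)) ⟨h.key, h.next ?_⟩)).of_le (by simp [Test.cost, Expr.cost])
  · rw [hsucc, if_neg hlt.not_ge, add_zero]
  · rw [hsucc, if_pos (not_lt.mp hge)]

lemma FillingPrefix.isTable (h : FillingPrefix S ((n + n) * (n + n + 1)) s) :
    IsTable S aCount (s.arr aCount) := fun A hA C hC => by
  rw [h.done _ (by nlinarith), mul_comm A, Nat.mul_add_div (by omega), Nat.mul_add_mod,
    Nat.div_eq_of_lt (by omega), Nat.mod_eq_of_lt (by omega), add_zero]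

lemma runs_prefixPass (hB : WordBound n B) (hs : Filling S aCount aCount s) :
    Runs (endpoint S) B prefixPass s (30 * ((n + n) * (n + n + 1)) + 9)
      (Filling S aStart aStart) := by
  have hsm := hB.small
  have hsq := hB.square
  have hLB : (n + n) * (n + n + 1) ≤ B := by nlinarith
  have hs₁ := hs.setReg (x := rKey) le_rfl 0
  refine ((Val.const (Nat.zero_le B)).runs_assign_seq (Val.runs_assign_seq
    ((Val.reg hs₁.size (by omega)).mul (.reg hs₁.width (by omega)) hLB)
    ((runs_countUp_const hLB (by omega) 23 (FillingPrefix S) (fun i s h => ⟨h.key, h.limit⟩)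
      (fun i s hi h => h.runs_step hB hi) (Nat.zero_le _)
      ⟨(hs₁.setReg (by omega) _).start, by simp, by simp, fun j hj => ?_⟩).imp
      fun s' h => h.finish h.isTable))).of_le (by simp only [Expr.cost, Nat.sub_zero]; omega)
  rw [zero_add] at hj
  rw [Nat.div_eq_of_lt hj, (ranked S).prefixCount_zero]
  exact hs.blank _ le_rfl j

end PrefixCountTable

section Preprocess

variable {n : ℕ} {S : Fin n → Segment} {B : ℕ}

/-- Compute the sizes and all tables. -/
def preprocess : Program :=
  .assign rSize (.add (.reg rSegments) (.reg rSegments)) ;;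
  .assign rWidth (.add (.reg rSize) (.const 1)) ;;
  axisPasses aXLt .xlt ;; axisPasses aYLt .ylt ;; partnerPass ;; spanPasses ;; upPass ;; prefixPass

/-- A time bound for `preprocess`. -/
def preprocessTime (n : ℕ) : ℕ := 136 * ((n + n) * (n + n)) + 218 * (n + n) + 80

lemma runs_preprocess (hB : WordBound n B) :
    Runs (endpoint S) B preprocess (State.init n) (preprocessTime n)
      (Filling S aStart aStart) := by
  have hsm := hB.small
  have hseg : Val B (State.init n) (.reg rSegments) n := .reg rfl (by omega)
  refine ((hseg.add hseg (by omega)).runs_assign_seq (Val.runs_assign_seq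
    ((Val.reg (v := n + n) (by simp) (by omega)).add (.const (by omega)) (by omega))
    (runs_seq ((isAxis_x.runs_axisPasses hB ?_).imp fun s₁ h₁ =>
    runs_seq ((isAxis_y.runs_axisPasses hB h₁).imp fun s₂ h₂ =>
    runs_seq ((runs_partnerPass hB h₂).imp fun s₃ h₃ =>
    runs_seq ((runs_spanPasses hB h₃).imp fun s₄ h₄ =>
    runs_seq ((runs_upPass hB h₄).imp fun s₅ h₅ => runs_prefixPass hB h₅)))))))).of_le ?_
  · exact ⟨⟨by simp [State.init], by simp, by simp, by simp⟩, fun _ _ _ => rfl, rfl⟩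
  · simp only [Expr.cost, preprocessTime]
    ring_nf
    omega

end Preprocess

section Running

variable {n : ℕ}

lemma wordBound_pow (hn : 1 ≤ n) : WordBound n ((n + 1) ^ 4) := by
  have h2 : 2 * 2 ≤ (n + 1) * (n + 1) := Nat.mul_le_mul (by omega) (by omega)
  have hsq : (n + n + 2) * (n + n + 2) ≤ (n + 1) ^ 4 :=
    calc (n + n + 2) * (n + n + 2) = 2 * 2 * ((n + 1) * (n + 1)) := by ring
      _ ≤ (n + 1) * (n + 1) * ((n + 1) * (n + 1)) := Nat.mul_le_mul_right _ h2
      _ = (n + 1) ^ 4 := by ring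
  exact ⟨hn, (Nat.mul_le_mul_right _ (by omega)).trans hsq, hsq⟩

lemma clog_two_add_self_le : Nat.clog 2 (n + n) ≤ Nat.log 2 n + 2 := by
  refine Nat.clog_le_of_le_pow ?_
  have := Nat.lt_pow_succ_log_self one_lt_two n
  rw [pow_succ] at this ⊢
  omega

lemma roundTime_le (hn : 2 ≤ n) : roundTime n ≤ 7510 * (n * Nat.log 2 n) := by
  have hlog : 1 ≤ Nat.log 2 n := Nat.log_pos one_lt_two hn
  have hclog := clog_two_add_self_le (n := n)
  have hexamine : examineTime n ≤ 590 * Nat.log 2 n := by unfold examineTime shrinkTime; omega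
  have hsweep : (4 * examineTime n + 110) * (n + n + 1) ≤ 7410 * (n * Nat.log 2 n) :=
    calc (4 * examineTime n + 110) * (n + n + 1) ≤ (2470 * Nat.log 2 n) * (3 * n) :=
          Nat.mul_le_mul (by omega) (by omega)
      _ = 7410 * (n * Nat.log 2 n) := by ring
  have hle : n * 1 ≤ n * Nat.log 2 n := Nat.mul_le_mul_left n hlog
  unfold roundTime
  omega

lemma preprocessTime_le (hn : 2 ≤ n) : preprocessTime n + 5 ≤ 1000 * (n * n) := by
  have hsq : n * 2 ≤ n * n := Nat.mul_le_mul_left n hn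
  have htime : preprocessTime n = 544 * (n * n) + 436 * n + 80 := by unfold preprocessTime; ring
  omega

lemma total_time_le (hn : 2 ≤ n) :
    preprocessTime n + (roundTime n * (n + n) + 5) ≤ 17000 * (n * n * Nat.log 2 n) := by
  have hrounds : roundTime n * (n + n) ≤ 15020 * (n * n * Nat.log 2 n) :=
    (Nat.mul_le_mul_right (n + n) (roundTime_le hn)).trans_eq (by ring)
  have hsq : n * n * 1 ≤ n * n * Nat.log 2 n :=
    Nat.mul_le_mul_left _ (Nat.log_pos one_lt_two hn)
  have := preprocessTime_le hn
  omega

lemma natLog_two_le (hn : 1 ≤ n) : (Nat.log 2 n : ℝ) ≤ 2 * Real.log n := by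
  have hpow : ((2 : ℕ) : ℝ) ^ Nat.log 2 n ≤ n := by
    exact_mod_cast Nat.pow_log_le_self 2 (by omega)
  have hlog := Real.log_le_log (by positivity) hpow
  rw [Real.log_pow, Nat.cast_ofNat] at hlog
  have := Real.log_two_gt_d9
  nlinarith [(Nat.log 2 n).cast_nonneg (α := ℝ)]

/-- The algorithm that reports all combinatorially different stabbing rectangles. -/
def reportStabbers : Program := preprocess ;; mainLoop

theorem runs_reportStabbers (hn : 1 ≤ n) (S : Fin n → Segment) :
    Runs (endpoint S) ((n + 1) ^ 4) reportStabbers (State.init n)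
      (preprocessTime n + (roundTime n * (n + n) + 5)) fun s => ReportsAll S s.out :=
  runs_seq ((runs_preprocess (wordBound_pow hn)).imp fun _ h => runs_mainLoop (wordBound_pow hn)
    h.toPrepared (h.blank aStart le_rfl) (h.blank aMark (by decide)) h.out)

lemma time_le_of_le_total {t : ℕ} (hn : 2 ≤ n)
    (ht : t ≤ preprocessTime n + (roundTime n * (n + n) + 5)) :
    (t : ℝ) ≤ 34000 * ((n : ℝ) ^ 2 * Real.log n) := by
  have hlog : (t : ℝ) ≤ 17000 * ((n : ℝ) * n * Nat.log 2 n) := by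
    exact_mod_cast ht.trans (total_time_le hn)
  have := mul_le_mul_of_nonneg_left (natLog_two_le (n := n) (by omega)) (mul_self_nonneg (n : ℝ))
  nlinarith

end Running

end Stab

theorem mainTheorem2 :
    (∃ (prog : Stab.Program) (k : ℕ) (C : ℝ), ∀ n : ℕ, 1 ≤ n →
      ∀ S : Fin n → Stab.Segment, (∀ i, (S i).1 ≠ (S i).2) →
        ∃ (s : Stab.State) (t : ℕ),
          Stab.Exec (Stab.endpoint S) ((n + 1) ^ k) prog (Stab.State.init n) s t ∧
          Stab.ReportsAll S s.out ∧
          (2 ≤ n → (t : ℝ) ≤ C * ((n : ℝ) ^ 2 * Real.log n))) ∧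
    (∃ C : ℝ, ∀ n : ℕ, 1 ≤ n →
      ∀ S : Fin n → Stab.Segment, (∀ i, (S i).1 ≠ (S i).2) →
        (Stab.stabberClasses S).Finite ∧
        ((Stab.stabberClasses S).ncard : ℝ) ≤ C * (n : ℝ) ^ 2) ∧
    (∃ c : ℝ, 0 < c ∧ ∀ n : ℕ, 1 ≤ n →
      ∃ S : Fin n → Stab.Segment,
        (∀ i, (S i).1.1 ≠ (S i).2.1 ∧ (S i).1.2 ≠ (S i).2.2) ∧
        (Function.Injective fun i => s((S i).1, (S i).2)) ∧
        (Stab.stabberClasses S).Finite ∧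
        c * (n : ℝ) ^ 2 ≤ ((Stab.stabberClasses S).ncard : ℝ)) := by
  refine ⟨⟨Stab.reportStabbers, 4, 34000, fun n hn S _ => ?_⟩, ⟨12, fun n hn S _ => ?_⟩, 1 / 4,
    by norm_num, fun n hn => ⟨fun i => Stab.crossSegment n i, fun i => ?_,
      Stab.crossSegment_injective n, (Stab.stabberClasses_ncard_le hn _).1, ?_⟩⟩
  · obtain ⟨s, t, hexec, htime, hreports⟩ := Stab.runs_reportStabbers hn S
    exact ⟨s, t, hexec, hreports, fun hn₂ => Stab.time_le_of_le_total hn₂ htime⟩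
  · obtain ⟨hfin, hcard⟩ := Stab.stabberClasses_ncard_le hn S
    exact ⟨hfin, by exact_mod_cast hcard⟩
  · have hlt := Stab.crossSegment_lt n i
    exact ⟨hlt.1.ne, hlt.2.ne⟩
  · linarith [Stab.le_ncard_stabberClasses_crossSegment hn]
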